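/- Let $n\ge 2$ be an integer, $\kappa>0$, and let $h:(0,\infty)\to[0,\infty)$ be a $C^1$ function with $h''(d)>0$ for all $d>0$, $\lim_{d\to0^+}h(d)=\infty$, $\lim_{d\to\infty}h(d)/d=\infty$, $\lim_{d\to0^+}h'(d)=-\infty$ and $\lim_{d\to\infty}h'(d)=\infty$. Put $$\hat\Phi(v_1,\dots,v_n)=\frac{\kappa}{n}v_1^n+h(v_1\cdots v_n)+\kappa\,v_1\cdots v_n\Big(\frac{n-1}{n}+\ln(v_2\cdots v_n)\Big),\qquad v_i>0,$$ write $\hat\Phi_{,i}$ for the partial derivatives, and write $\hat\Phi(r(R))$, $\hat\Phi_{,i}(r(R))$ for their values at $(r'(R),r(R)/R,\dots,r(R)/R)$. Let $\hat T(r(R))=(r(R)/R)^{1-n}\hat\Phi_{,1}(r(R))$. For $\lambda>0$ and $\varepsilon\in[0,1)$ let $$\mathcal A_\lambda^\varepsilon=\{r\in W^{1,1}(\varepsilon,1): r(1)=\lambda,\ r'(R)>0\text{ for a.e. }R\in(\varepsilon,1),\ r(\varepsilon)\ge0\},$$ $$\hat I_\varepsilon(r)=\int_\varepsilon^1R^{n-1}\hat\Phi(r(R))\,dR-\frac{\kappa(n-1)}{n}\lambda^n\ln\lambda\in(-\infty,\infty],$$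 where functions in $W^{1,1}(\varepsilon,1)$ are identified with their continuous representatives on $[\varepsilon,1]$, and write $\hat I=\hat I_0$, $\mathcal A_\lambda=\mathcal A_\lambda^0$. A cavitating solution is a function $r_c:[0,\infty)\to\mathbb R$, continuous at $0$ and $C^1$ on $(0,\infty)$, with $r_c(0)>0$, $r_c'>0$ on $(0,\infty)$, $$\frac{d}{dR}\big[R^{n-1}\hat\Phi_{,1}(r_c(R))\big]=(n-1)R^{n-2}\hat\Phi_{,2}(r_c(R))\quad(R>0),\qquad \lim_{R\to0^+}\hat T(r_c(R))=0 .$$ Then there is exactly one number $\lambda_c$ such that $\lambda_c=\lim_{R\to\infty}r_c'(R)=\lim_{R\to\infty}r_c(R)/R$ for some cavitating solution $r_c$. Moreover, let $\lambda>0$ and, for every $\varepsilon\in(0,1)$, let $r_\varepsilon$ be a global minimizer of $\hat I_\varepsilon$ over $\mathcal A_\lambda^\varepsilon$. 1. If $\lambda\le\lambda_c$, then $\displaystyle\lim_{\varepsilon\to0^+}\ \sup_{R\in[\varepsilon,1]}|r_\varepsilon(R)-\lambda R|=0$. 2. If $\lambda>\lambda_c$, then $\hat I$ has exactly one global minimizer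 $r_\lambda$ over $\mathcal A_\lambda$, it is cavitating, i.e. $r_\lambda(0)>0$, and $\displaystyle\lim_{\varepsilon\to0^+}\ \sup_{R\in[\varepsilon,1]}|r_\varepsilon(R)-r_\lambda(R)|=0$. -/

import Mathlib

open Set Filter Topology MeasureTheory

/-- The assumptions on the volumetric part `h : (0,∞) → [0,∞)` of the stored energy: `h` is `C¹`,
`h'' > 0`, and `h`, `h'` have the usual behaviour at `0⁺` and at `∞`.  Only the values of `h` on
`(0,∞)` matter.  (`0 < deriv (deriv h) d` includes the existence of the second derivative,
since `deriv` is `0` where a function is not differentiable.) -/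
structure IsVolumetricEnergy (h : ℝ → ℝ) : Prop where
  nonneg : ∀ d, 0 < d → 0 ≤ h d
  contDiffOn : ContDiffOn ℝ 1 h (Ioi 0)
  deriv2_pos : ∀ d, 0 < d → 0 < deriv (deriv h) d
  tendsto_zero : Tendsto h (𝓝[>] 0) atTop
  superlinear : Tendsto (fun d => h d / d) atTop atTop
  deriv_tendsto_zero : Tendsto (deriv h) (𝓝[>] 0) atBot
  deriv_tendsto_top : Tendsto (deriv h) atTop atTop

/-- The modified stored energy function
`Φ̂(v₁,…,vₙ) = (κ/n) v₁ⁿ + h(v₁⋯vₙ) + κ v₁⋯vₙ ((n-1)/n + ln(v₂⋯vₙ))`,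
with `q = v₁` and `w = (v₂,…,vₙ)`. -/
noncomputable def modPhi (n : ℕ) (κ : ℝ) (h : ℝ → ℝ) (q : ℝ) (w : Fin (n - 1) → ℝ) : ℝ :=
  κ / n * q ^ n + h (q * ∏ i, w i)
    + κ * (q * ∏ i, w i) * (((n : ℝ) - 1) / n + Real.log (∏ i, w i))

/-- The partial derivative `Φ̂,₁(q,v,…,v)`; see `hasDerivAt_modPhi_fst`. -/
noncomputable def modPhi₁ (n : ℕ) (κ : ℝ) (h : ℝ → ℝ) (q v : ℝ) : ℝ :=
  κ * q ^ (n - 1)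
    + v ^ (n - 1) * (deriv h (q * v ^ (n - 1)) + ((n : ℝ) - 1) * κ * (1 / n + Real.log v))

/-- The partial derivative `Φ̂,₂(q,v,…,v) = ⋯ = Φ̂,ₙ(q,v,…,v)`; see `hasDerivAt_modPhi_snd`. -/
noncomputable def modPhi₂ (n : ℕ) (κ : ℝ) (h : ℝ → ℝ) (q v : ℝ) : ℝ :=
  q * v ^ (n - 2)
    * (deriv h (q * v ^ (n - 1)) + κ + κ * ((n : ℝ) - 1) * (1 / n + Real.log v))

theorem hasDerivAt_modPhi_fst {n : ℕ} (hn : 2 ≤ n) {κ : ℝ} {h : ℝ → ℝ}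
    (hh : IsVolumetricEnergy h) {q v : ℝ} (hq : 0 < q) (hv : 0 < v) :
    HasDerivAt (fun t => modPhi n κ h t (fun _ => v)) (modPhi₁ n κ h q v) q := by
  have hδ : 0 < q * v ^ (n - 1) := by positivity
  have h1 : HasDerivAt h (deriv h (q * v ^ (n - 1))) (q * v ^ (n - 1)) :=
    ((hh.contDiffOn.differentiableOn one_ne_zero).differentiableAt
      (Ioi_mem_nhds hδ)).hasDerivAt
  have hp : HasDerivAt (fun t : ℝ => t * v ^ (n - 1)) (v ^ (n - 1)) q := by
    simpa using (hasDerivAt_id q).mul_const (v ^ (n - 1))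
  have h2 := h1.comp q hp
  have h3 := ((hasDerivAt_pow n q).const_mul (κ / n)).add h2
  have h4 := h3.add ((hp.const_mul κ).mul_const (((n : ℝ) - 1) / n + Real.log (v ^ (n - 1))))
  have hn0 : (n : ℝ) ≠ 0 := by positivity
  have hc : ((n - 1 : ℕ) : ℝ) = (n : ℝ) - 1 := by
    rw [Nat.cast_sub (by omega)]; simp
  have hf : (fun t => modPhi n κ h t (fun _ => v)) = fun t => κ / n * t ^ n
      + h (t * v ^ (n - 1))
      + κ * (t * v ^ (n - 1)) * (((n : ℝ) - 1) / n + Real.log (v ^ (n - 1))) := by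
    funext t; simp [modPhi]
  rw [hf]
  refine h4.congr_deriv ?_
  simp only [modPhi₁, Real.log_pow, hc]
  field_simp
  ring

theorem hasDerivAt_modPhi_snd {n : ℕ} (hn : 2 ≤ n) {κ : ℝ} {h : ℝ → ℝ}
    (hh : IsVolumetricEnergy h) {q v : ℝ} (hq : 0 < q) (hv : 0 < v) (i : Fin (n - 1)) :
    HasDerivAt (fun t => modPhi n κ h q (Function.update (fun _ => v) i t))
      (modPhi₂ n κ h q v) v := by
  obtain ⟨m, rfl⟩ : ∃ m, n = m + 2 := ⟨n - 2, by omega⟩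
  have hprod : ∀ t : ℝ, ∏ j, Function.update (fun _ : Fin (m + 2 - 1) => v) i t j
      = t * v ^ m := by
    intro t
    rw [Finset.prod_update_of_mem (Finset.mem_univ i), Finset.prod_const,
      Finset.card_sdiff_of_subset (Finset.subset_univ _)]
    simp
  have hδ : 0 < q * (v * v ^ m) := by positivity
  have h1 : HasDerivAt h (deriv h (q * (v * v ^ m))) (q * (v * v ^ m)) :=
    ((hh.contDiffOn.differentiableOn one_ne_zero).differentiableAt
      (Ioi_mem_nhds hδ)).hasDerivAt
  have hp0 : HasDerivAt (fun t : ℝ => t * v ^ m) (v ^ m) v := by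
    simpa using (hasDerivAt_id v).mul_const (v ^ m)
  have hp : HasDerivAt (fun t : ℝ => q * (t * v ^ m)) (q * v ^ m) v := hp0.const_mul q
  have hl' := (hp0.log (by positivity)).const_add ((((m + 2 : ℕ) : ℝ) - 1) / (m + 2 : ℕ))
  have h4 := ((h1.comp v hp).const_add (κ / (m + 2 : ℕ) * q ^ (m + 2))).add
    ((hp.const_mul κ).mul hl')
  have hf : (fun t => modPhi (m + 2) κ h q (Function.update (fun _ => v) i t)) = fun t =>
      κ / (m + 2 : ℕ) * q ^ (m + 2) + h (q * (t * v ^ m))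
      + κ * (q * (t * v ^ m))
        * ((((m + 2 : ℕ) : ℝ) - 1) / (m + 2 : ℕ) + Real.log (t * v ^ m)) := by
    funext t; simp only [modPhi, hprod]
  rw [hf]
  refine h4.congr_deriv ?_
  have e : v * v ^ m = v ^ (m + 1) := by ring
  have hm : ((m : ℝ) + 2) ≠ 0 := by positivity
  simp only [modPhi₂, e, Real.log_pow, show m + 2 - 1 = m + 1 by omega,
    show m + 2 - 2 = m by omega]
  push_cast
  field_simp
  ring

/-- The modified radial Cauchy stress `T̂(q,v) = v^{1-n} Φ̂,₁(q,v,…,v)`. -/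
noncomputable def modCauchyStress (n : ℕ) (κ : ℝ) (h : ℝ → ℝ) (q v : ℝ) : ℝ :=
  modPhi₁ n κ h q v / v ^ (n - 1)

/-- The admissible set `{r ∈ W^{1,1}(ε,1) : r(1) = lam, r' > 0 a.e., r(ε) ≥ 0}`.
Elements of `W^{1,1}(ε,1)` are represented by their absolutely continuous representatives on
`[ε,1]`, whose weak derivative is the a.e. classical derivative; values of `r` outside `[ε,1]`
are irrelevant.  The case `ε = 0` is the admissible set for the full ball. -/
def admissible (lam ε : ℝ) : Set (ℝ → ℝ) :=
  {r | AbsolutelyContinuousOnInterval r ε 1 ∧ r 1 = lam ∧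
    (∀ᵐ R ∂(volume.restrict (Ioo ε 1)), 0 < deriv r R) ∧ 0 ≤ r ε}

/-- The integrand `R^{n-1} Φ̂(r'(R), r(R)/R, …, r(R)/R)`. -/
noncomputable def modIntegrand (n : ℕ) (κ : ℝ) (h : ℝ → ℝ) (r : ℝ → ℝ) (R : ℝ) : ℝ :=
  R ^ (n - 1) * modPhi n κ h (deriv r R) (fun _ => r R / R)

open Classical in
/-- The modified energy over the punctured ball `ε < |x| < 1` (over the full ball if `ε = 0`),
`∫_ε^1 R^{n-1} Φ̂(r', r/R, …, r/R) dR - (κ(n-1)/n) lamⁿ ln lam`, with values in `(-∞,∞]`.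
For admissible `r` the negative part of the integrand is integrable, so that the integral is
`+∞` when the integrand is not integrable. -/
noncomputable def modEnergy (n : ℕ) (κ : ℝ) (h : ℝ → ℝ) (lam ε : ℝ) (r : ℝ → ℝ) : EReal :=
  if IntegrableOn (modIntegrand n κ h r) (Ioo ε 1) then
    (((∫ R in Ioo ε 1, modIntegrand n κ h r R)
      - κ * ((n : ℝ) - 1) / n * lam ^ n * Real.log lam : ℝ) : EReal)
  else ⊤

/-- `r` is a global minimizer of the modified energy over the admissible set; `ε = 0` is the
problem on the full ball, `0 < ε < 1` the problem on the punctured ball. -/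
def IsGlobalMinimizer (n : ℕ) (κ : ℝ) (h : ℝ → ℝ) (lam ε : ℝ) (r : ℝ → ℝ) : Prop :=
  r ∈ admissible lam ε ∧ IsMinOn (modEnergy n κ h lam ε) (admissible lam ε) r

/-- `r : [0,∞) → ℝ` is a cavitating solution on `(0,∞)` of the radial equilibrium equation
`d/dR [R^{n-1} Φ̂,₁] = (n-1) R^{n-2} Φ̂,₂` for which the modified radial Cauchy stress vanishes at
the cavity surface. -/
structure IsCavitatingSolution (n : ℕ) (κ : ℝ) (h : ℝ → ℝ) (r : ℝ → ℝ) : Prop where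
  cavity : 0 < r 0
  continuous_zero : ContinuousWithinAt r (Ici 0) 0
  contDiffOn : ContDiffOn ℝ 1 r (Ioi 0)
  deriv_pos : ∀ R, 0 < R → 0 < deriv r R
  equilibrium : ∀ R, 0 < R →
    HasDerivAt (fun S => S ^ (n - 1) * modPhi₁ n κ h (deriv r S) (r S / S))
      (((n : ℝ) - 1) * R ^ (n - 2) * modPhi₂ n κ h (deriv r R) (r R / R)) R
  stress_free : Tendsto (fun R => modCauchyStress n κ h (deriv r R) (r R / R)) (𝓝[>] 0) (𝓝 0)

/-- `lamc` is the critical boundary displacement: the common limit at infinity of `r_c'(R)` and of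
`r_c(R)/R` for a cavitating solution `r_c` on `(0,∞)`. -/
def IsCriticalStretch (n : ℕ) (κ : ℝ) (h : ℝ → ℝ) (lamc : ℝ) : Prop :=
  ∃ rc : ℝ → ℝ, IsCavitatingSolution n κ h rc ∧
    Tendsto (deriv rc) atTop (𝓝 lamc) ∧ Tendsto (fun R => rc R / R) atTop (𝓝 lamc)

/-- `lim_{ε → 0⁺} sup_{R ∈ [ε,1]} |r_ε(R) - s(R)| = 0`. -/
def PuncturedUniformLimit (r : ℝ → ℝ → ℝ) (s : ℝ → ℝ) : Prop :=
  Tendsto (fun ε : ℝ => ⨆ R ∈ Icc ε 1, ENNReal.ofReal |r ε R - s R|) (𝓝[>] 0) (𝓝 0)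

/-!
The proof is a calibration argument.  Write `m = n - 1`, `v = r / R` for the hoop stretch and `q =
r'` for the slope.  The energy density at `(q, v, …, v)` is a strictly convex function of `q`
(`energy`), and the radial equilibrium equation amounts to a first order equation for the Cauchy
stress `T` as a function of `v` (`stressDecay`).  Its solution with `T → 0` as `v → ∞`, which is
found by monotone iteration in the variable `z = v ^ (-n)` (`exists_stress_solution`), gives the
slope `qs v` of a cavitating equilibrium at the hoop stretch `v`.  As `v` decreases, it reaches the
homogeneous state `q = v` at a stretch `vc`, the critical one (`exists_isCavityField`). Homogeneous
deformations for `v ≤ vc` and cavitating equilibria for `v ≥ vc` form a field of extremals, with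
slope `fieldSlope v`.

The least energy on the ball of radius `R` is `R ^ n * potential (r / R)`.  For every `r` the
energy density is the derivative of this function plus a nonnegative Weierstrass excess
(`hasDerivAt_pow_mul_potential`, `integral_energyDensity`), and the boundary term at the origin
vanishes because `potential v = o(v ^ n)` (`tendsto_potential_div_pow`).  As `potential` would be
infinite at `v = 0`, the volumetric energy is replaced by its tangent line below a stretch `l`
which the field solution in question never goes below.  Solutions of `r' = fieldSlope (r / R)`,
that is `r = lam R` if `lam ≤ vc` and a cavitating solution if `lam > vc`, have no excess and are
therefore minimizers.  A minimizer on the punctured ball has a total excess which tends to `0` with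
the radius of the puncture (`integral_excess_le_of_isGlobalMinimizer`), and a small total excess
implies uniform closeness to the field solution (`uniformly_close`): away from the origin by
Grönwall's inequality, and near the origin because the excess bounds the growth of `r ^ n`.  The
same estimate shows that the minimizer on the full ball is unique.

A cavitating solution on `(0, ∞)` with limit stretch `vc` is obtained from the field by separation
of variables (`exists_fieldCurve`).  Conversely, for an arbitrary cavitating solution the quantity
`energyGap` compares the energy, in the form given by the virial identity, with the calibration.
It tends to `0` at the cavity and increases, while its quotient by `r ^ n` decreases; hence it
vanishes and the solution belongs to the field (`deriv_eq_slope`), which makes the critical stretch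
unique.
-/

namespace Cavitation

variable {m : ℕ} {κ : ℝ} {h : ℝ → ℝ}

/-! ### The volumetric energy -/

theorem hasDerivAt_vol (hh : IsVolumetricEnergy h) {d : ℝ} (hd : 0 < d) :
    HasDerivAt h (deriv h d) d :=
  ((hh.contDiffOn.differentiableOn one_ne_zero).differentiableAt (Ioi_mem_nhds hd)).hasDerivAt

theorem hasDerivAt_deriv_vol (hh : IsVolumetricEnergy h) {d : ℝ} (hd : 0 < d) :
    HasDerivAt (deriv h) (deriv (deriv h) d) d :=
  (differentiableAt_of_deriv_ne_zero (hh.deriv2_pos d hd).ne').hasDerivAt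

theorem continuousOn_deriv_vol (hh : IsVolumetricEnergy h) : ContinuousOn (deriv h) (Ioi 0) :=
  fun _ hd => (hasDerivAt_deriv_vol hh hd).continuousAt.continuousWithinAt

theorem continuousOn_vol (hh : IsVolumetricEnergy h) : ContinuousOn h (Ioi 0) :=
  hh.contDiffOn.continuousOn

theorem strictMonoOn_deriv_vol (hh : IsVolumetricEnergy h) : StrictMonoOn (deriv h) (Ioi 0) :=
  strictMonoOn_of_deriv_pos (convex_Ioi 0) (continuousOn_deriv_vol hh) fun d hd =>
    hh.deriv2_pos d (by simpa using hd)

theorem deriv_vol_lt_iff (hh : IsVolumetricEnergy h) {d e : ℝ} (hd : 0 < d) (he : 0 < e) :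
    deriv h d < deriv h e ↔ d < e :=
  (strictMonoOn_deriv_vol hh).lt_iff_lt hd he

theorem deriv_vol_le_iff (hh : IsVolumetricEnergy h) {d e : ℝ} (hd : 0 < d) (he : 0 < e) :
    deriv h d ≤ deriv h e ↔ d ≤ e :=
  (strictMonoOn_deriv_vol hh).le_iff_le hd he

/-- The Bregman distance of the volumetric energy: the height at `d` of its graph above the tangent
line at `e`. -/
noncomputable def volBregman (h : ℝ → ℝ) (d e : ℝ) : ℝ := h d - h e - deriv h e * (d - e)

theorem volBregman_pos (hh : IsVolumetricEnergy h) {d e : ℝ} (hd : 0 < d) (he : 0 < e)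
    (hne : d ≠ e) : 0 < volBregman h d e := by
  unfold volBregman
  have hcont : ∀ a b : ℝ, 0 < a → ContinuousOn h (Icc a b) := fun a b ha =>
    (continuousOn_vol hh).mono fun x hx => lt_of_lt_of_le ha hx.1
  rcases lt_or_gt_of_ne hne with hlt | hlt
  · obtain ⟨c, hc, hc'⟩ := exists_hasDerivAt_eq_slope h (deriv h) hlt (hcont d e hd)
      fun x hx => hasDerivAt_vol hh (hd.trans hx.1)
    have h1 := (deriv_vol_lt_iff hh (hd.trans hc.1) he).2 hc.2
    rw [hc', div_lt_iff₀ (by linarith)] at h1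
    nlinarith
  · obtain ⟨c, hc, hc'⟩ := exists_hasDerivAt_eq_slope h (deriv h) hlt (hcont e d he)
      fun x hx => hasDerivAt_vol hh (he.trans hx.1)
    have h1 := (deriv_vol_lt_iff hh he (he.trans hc.1)).2 hc.1
    rw [hc', lt_div_iff₀ (by linarith)] at h1
    nlinarith

theorem volBregman_self (h : ℝ → ℝ) (d : ℝ) : volBregman h d d = 0 := by simp [volBregman]

theorem volBregman_nonneg (hh : IsVolumetricEnergy h) {d e : ℝ} (hd : 0 < d) (he : 0 < e) :
    0 ≤ volBregman h d e := by
  rcases eq_or_ne d e with rfl | hne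
  · rw [volBregman_self]
  · exact (volBregman_pos hh hd he hne).le

/-- The Bregman distance controls the volume ratio `d`, uniformly for bounded `e`. -/
theorem mul_sub_le_volBregman (hh : IsVolumetricEnergy h) {d e M : ℝ} (hd : 0 < d) (he : 0 < e)
    (heM : e ≤ M) :
    (deriv h (M + 1) - deriv h M) * (d - (M + 1)) ≤ volBregman h d e := by
  have hM : 0 < M := he.trans_le heM
  have h0 : deriv h M < deriv h (M + 1) := (deriv_vol_lt_iff hh hM (by linarith)).2 (by linarith)
  rcases le_or_gt (M + 1) d with hle | hlt
  · have h1 := volBregman_nonneg hh hd (e := M + 1) (by linarith)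
    have h2 := volBregman_nonneg hh (d := M + 1) (by linarith) he
    have h3 : deriv h e ≤ deriv h M := (deriv_vol_le_iff hh he hM).2 heM
    unfold volBregman at *
    nlinarith
  · have := volBregman_nonneg hh hd he
    nlinarith

/-! ### Powers -/

/-- The Bregman distance of `q ↦ q ^ (m + 1)`. -/
def powBregman (m : ℕ) (q p : ℝ) : ℝ := q ^ (m + 1) - p ^ (m + 1) - (m + 1) * p ^ m * (q - p)

theorem powBregman_self (m : ℕ) (q : ℝ) : powBregman m q q = 0 := by simp [powBregman]

theorem powBregman_succ (m : ℕ) (q p : ℝ) :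
    powBregman (m + 1) q p = q * powBregman m q p + (m + 1) * p ^ m * (q - p) ^ 2 := by
  simp only [powBregman]; push_cast; ring

theorem powBregman_nonneg (m : ℕ) {q p : ℝ} (hq : 0 ≤ q) (hp : 0 ≤ p) : 0 ≤ powBregman m q p := by
  induction m with
  | zero => simp [powBregman]
  | succ k ih => rw [powBregman_succ]; positivity

theorem pow_abs_sub_le_powBregman (hm : 1 ≤ m) {q p : ℝ} (hq : 0 ≤ q) (hp : 0 ≤ p) :
    |q - p| ^ (m + 1) ≤ powBregman m q p := by
  induction m, hm using Nat.le_induction with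
  | base =>
    change |q - p| ^ 2 ≤ _
    rw [sq_abs]
    simp only [powBregman]
    push_cast
    nlinarith
  | succ k hk ih =>
    rw [powBregman_succ]
    have hB := powBregman_nonneg k hq hp
    rcases le_total p q with hpq | hpq
    · have h1 : |q - p| = q - p := abs_of_nonneg (by linarith)
      rw [h1] at ih ⊢
      have : (q - p) ^ (k + 1) * (q - p) ≤ q * powBregman k q p := by
        rw [mul_comm]; gcongr; linarith
      have h2 : 0 ≤ (k + 1 : ℝ) * p ^ k * (q - p) ^ 2 := by positivity
      rw [pow_succ]; linarith
    · have h1 : |q - p| = p - q := by rw [abs_of_nonpos (by linarith)]; ring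
      rw [h1, show k + 1 + 1 = k + 2 from rfl, pow_add]
      have h2 : (p - q) ^ k ≤ p ^ k := pow_le_pow_left₀ (by linarith) (by linarith) _
      have h3 : (p - q) ^ k * (p - q) ^ 2 ≤ p ^ k * (q - p) ^ 2 := by
        rw [show (q - p) ^ 2 = (p - q) ^ 2 by ring]; gcongr
      have h4 : 0 ≤ q * powBregman k q p := by positivity
      have h5 : 0 ≤ (k : ℝ) * (p ^ k * (q - p) ^ 2) := by positivity
      nlinarith

/-- `(b - a) ^ n ≤ b ^ n - a ^ n` for `0 ≤ a ≤ b`, in symmetric form. -/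
theorem abs_sub_pow_le (m : ℕ) {a b : ℝ} (ha : 0 ≤ a) (hb : 0 ≤ b) :
    |a - b| ^ (m + 1) ≤ |a ^ (m + 1) - b ^ (m + 1)| := by
  wlog hab : b ≤ a generalizing a b
  · rw [abs_sub_comm, abs_sub_comm (a ^ _)]; exact this hb ha (le_of_not_ge hab)
  have h1 : b ^ (m + 1) ≤ a ^ (m + 1) := pow_le_pow_left₀ hb hab _
  rw [abs_of_nonneg (by linarith), abs_of_nonneg (by linarith)]
  have := pow_add_pow_le (x := a - b) (y := b) (n := m + 1) (by linarith) hb (by omega)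
  rw [sub_add_cancel] at this
  linarith

/-! ### The energy density and the Cauchy stress at equal hoop stretches -/

/-- The modified stored energy at `(q, v, …, v)` in dimension `n = m + 1`. -/
noncomputable def energy (m : ℕ) (κ : ℝ) (h : ℝ → ℝ) (q v : ℝ) : ℝ :=
  κ / (m + 1) * q ^ (m + 1) + h (q * v ^ m) + κ * (q * v ^ m) * (m * (1 / (m + 1) + Real.log v))

/-- The modified radial Cauchy stress in dimension `n = m + 1`, for positive `v`. -/
noncomputable def stress (m : ℕ) (κ : ℝ) (h : ℝ → ℝ) (q v : ℝ) : ℝ :=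
  κ * (q / v) ^ m + deriv h (q * v ^ m) + m * κ * (1 / (m + 1) + Real.log v)

/-- The quantity `Φ̂ - (q - v) Φ̂,₁`.  Along a radial equilibrium `r` the derivative of `Rⁿ` times
it is `n R ^ (n - 1) Φ̂`, the conservation law belonging to the scaling `r ↦ a r(R/a)`. -/
noncomputable def virial (m : ℕ) (κ : ℝ) (h : ℝ → ℝ) (q v : ℝ) : ℝ :=
  energy m κ h q v - (q - v) * (v ^ m * stress m κ h q v)

/-- Weierstrass excess of the slope `q` over a field slope `p` with field volume ratio `d`. -/
noncomputable def excess (m : ℕ) (κ : ℝ) (h : ℝ → ℝ) (v q p d : ℝ) : ℝ :=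
  κ / (m + 1) * powBregman m q p + volBregman h (q * v ^ m) d

theorem excess_nonneg (hκ : 0 < κ) (hh : IsVolumetricEnergy h) {v q p d : ℝ} (hv : 0 < v)
    (hq : 0 < q) (hp : 0 ≤ p) (hd : 0 < d) : 0 ≤ excess m κ h v q p d := by
  have h1 := powBregman_nonneg m hq.le hp
  have h2 := volBregman_nonneg hh (d := q * v ^ m) (by positivity) hd
  unfold excess; positivity

/-- Taylor expansion of the energy density in the slope; the derivative at `p` is `Φ̂,₁`. -/
theorem energy_eq_add_excess {v : ℝ} (hv : 0 < v) (q p : ℝ) :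
    energy m κ h q v = energy m κ h p v + v ^ m * stress m κ h p v * (q - p)
      + excess m κ h v q p (p * v ^ m) := by
  unfold energy stress excess powBregman volBregman
  have hm : ((m : ℝ) + 1) ≠ 0 := by positivity
  rw [div_pow]
  field_simp
  ring

theorem stress_lt_stress (hκ : 0 < κ) (hh : IsVolumetricEnergy h) {v q p : ℝ} (hv : 0 < v)
    (hq : 0 < q) (hqp : q < p) : stress m κ h q v < stress m κ h p v := by
  unfold stress
  have h1 : deriv h (q * v ^ m) < deriv h (p * v ^ m) :=
    (deriv_vol_lt_iff hh (by positivity) (mul_pos (hq.trans hqp) (by positivity))).2 (by gcongr)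
  have h2 : (q / v) ^ m ≤ (p / v) ^ m := by gcongr
  have := mul_le_mul_of_nonneg_left h2 hκ.le
  linarith

/-- The derivative of the virial in `q` is `(v - q)` times that of `v ^ m * stress`; hence the
virial determines the slope among the slopes `q ≤ v`. -/
theorem virial_lt_virial (hκ : 0 < κ) (hh : IsVolumetricEnergy h) {v q p : ℝ} (hv : 0 < v)
    (hq : 0 < q) (hqp : q < p) (hpv : p ≤ v) : virial m κ h q v < virial m κ h p v := by
  unfold virial
  have hp := hq.trans hqp
  have h1 := energy_eq_add_excess (m := m) (κ := κ) (h := h) hv p q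
  have h2 : 0 < excess m κ h v p q (q * v ^ m) := by
    have h3 := powBregman_nonneg m hp.le hq.le
    have h4 := volBregman_pos hh (d := p * v ^ m) (e := q * v ^ m) (by positivity) (by positivity)
      (by intro h5; exact hqp.ne' (mul_right_cancel₀ (by positivity) h5))
    unfold excess; positivity
  have h3 : v ^ m * stress m κ h q v ≤ v ^ m * stress m κ h p v := by
    gcongr; exact (stress_lt_stress hκ hh hv hq hqp).le
  nlinarith

/-- The excess is at most the sum of the two excesses between `q` and `p`, which is
`(q - p)` times the increment of `Φ̂,₁`. -/
theorem excess_le (hκ : 0 < κ) (hh : IsVolumetricEnergy h) {v q p : ℝ} (hv : 0 < v)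
    (hp : 0 < p) (hpq : p ≤ q) :
    excess m κ h v q p (p * v ^ m)
      ≤ q * (v ^ m * stress m κ h q v - v ^ m * stress m κ h p v) := by
  have hq := hp.trans_le hpq
  have h1 := energy_eq_add_excess (m := m) (κ := κ) (h := h) hv p q
  have h2 := energy_eq_add_excess (m := m) (κ := κ) (h := h) hv q p
  have h3 := excess_nonneg (m := m) hκ hh hv hp hq.le (d := q * v ^ m) (by positivity)
  have h4 : v ^ m * stress m κ h p v ≤ v ^ m * stress m κ h q v := by
    gcongr
    rcases hpq.eq_or_lt with rfl | hlt
    · rfl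
    · exact (stress_lt_stress hκ hh hv hp hlt).le
  nlinarith

theorem virial_eq_energy_self (v : ℝ) : virial m κ h v v = energy m κ h v v := by simp [virial]

/-- An implicit differentiation rule which does not require `φ` and `ψ` to be strictly
differentiable, because the solution `δ` is known to be continuous. -/
theorem hasDerivAt_of_implicit {δ a B φ ψ : ℝ → ℝ} {t a' B' φ' ψ' : ℝ} (hδ : ContinuousAt δ t)
    (ha : HasDerivAt a a' t) (hB : HasDerivAt B B' t) (hφ : HasDerivAt φ φ' (δ t))
    (hψ : HasDerivAt ψ ψ' (δ t)) (heq : ∀ᶠ s in 𝓝 t, φ (δ s) * a s + ψ (δ s) = B s)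
    (hne : φ' * a t + ψ' ≠ 0) :
    HasDerivAt δ ((B' - φ (δ t) * a') / (φ' * a t + ψ')) t := by
  have hs1 : Tendsto (fun s => dslope φ (δ t) (δ s)) (𝓝 t) (𝓝 φ') := by
    have := (continuousAt_dslope_same.2 hφ.differentiableAt).comp_of_eq hδ rfl
    have h2 := this.tendsto
    simpa [Function.comp_def, dslope_same, hφ.deriv] using h2
  have hs2 : Tendsto (fun s => dslope ψ (δ t) (δ s)) (𝓝 t) (𝓝 ψ') := by
    have := (continuousAt_dslope_same.2 hψ.differentiableAt).comp_of_eq hδ rfl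
    have h2 := this.tendsto
    simpa [Function.comp_def, dslope_same, hψ.deriv] using h2
  have hden : Tendsto (fun s => dslope φ (δ t) (δ s) * a s + dslope ψ (δ t) (δ s)) (𝓝 t)
      (𝓝 (φ' * a t + ψ')) := (hs1.mul ha.continuousAt.tendsto).add hs2
  rw [hasDerivAt_iff_tendsto_slope] at ha hB ⊢
  have hlim := (hB.sub (ha.const_mul (φ (δ t)))).div (hden.mono_left nhdsWithin_le_nhds) hne
  refine hlim.congr' ?_
  filter_upwards [(heq.filter_mono nhdsWithin_le_nhds),
    ((hden.eventually_ne hne).filter_mono nhdsWithin_le_nhds), self_mem_nhdsWithin] with s h1 h2 h3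
  have h0 := heq.self_of_nhds
  have e1 : φ (δ s) - φ (δ t) = (δ s - δ t) * dslope φ (δ t) (δ s) := by
    rw [← smul_eq_mul, sub_smul_dslope]
  have e2 : ψ (δ s) - ψ (δ t) = (δ s - δ t) * dslope ψ (δ t) (δ s) := by
    rw [← smul_eq_mul, sub_smul_dslope]
  have h3' : s - t ≠ 0 := sub_ne_zero.2 h3
  simp only [Pi.div_apply, slope_def_field]
  rw [div_eq_iff h2, ← mul_div_assoc, ← sub_div, div_mul_eq_mul_div]
  congr 1
  rw [← h1, ← h0]
  linear_combination a s * e1 + e2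

/-- Regularity and a derivative bound for the volume ratio along a curve on which the stress and
the hoop stretch are differentiable. -/
theorem exists_hasDerivAt_volRatio (hm : 1 ≤ m) (hκ : 0 < κ) (hh : IsVolumetricEnergy h)
    {q v T : ℝ → ℝ} {t v' T' : ℝ} (hq : ContinuousAt q t) (hq0 : 0 < q t) (hv0 : 0 < v t)
    (hv : HasDerivAt v v' t) (hT : HasDerivAt T T' t)
    (heq : ∀ᶠ s in 𝓝 t, T s = stress m κ h (q s) (v s)) :
    ∃ D, HasDerivAt (fun s => q s * v s ^ m) D t ∧
      |D| * (κ * m * (q t / v t) ^ m / (q t * v t ^ m))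
        ≤ |T' + m * κ * ((m + 1) * (q t / v t) ^ m - 1) * (v' / v t)| := by
  obtain ⟨k, rfl⟩ : ∃ k, m = k + 1 := ⟨m - 1, by omega⟩
  -- The definition of the stress as an equation for `d`, with the dependence on `v` separated off:
  -- `κ * d ^ m / v ^ (m * (m + 1)) + h'(d) = T - m * κ * (1 / (m + 1) + log v)`.
  set d := q t * v t ^ (k + 1) with hd
  have hd0 : 0 < d := by positivity
  have hva : ∀ᶠ s in 𝓝 t, 0 < v s := hv.continuousAt.eventually (lt_mem_nhds hv0)
  have ha := (hv.pow ((k + 1) * (k + 2))).inv (by simp; positivity)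
  have hB := hT.sub (((hv.log hv0.ne').const_add (1 / (((k + 1 : ℕ) : ℝ) + 1))).const_mul
    (((k + 1 : ℕ) : ℝ) * κ))
  have hφ := (hasDerivAt_pow (k + 1) d).const_mul κ
  have hψ := hasDerivAt_deriv_vol hh hd0
  have hpos : 0 < κ * (((k + 1 : ℕ) : ℝ) * d ^ (k + 1 - 1)) * ((v ^ ((k + 1) * (k + 2)))⁻¹) t
      + deriv (deriv h) d := by
    have := hh.deriv2_pos d hd0
    simp only [Pi.inv_apply, Pi.pow_apply]
    positivity
  have key := hasDerivAt_of_implicit (δ := fun s => q s * v s ^ (k + 1))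
    (hq.mul (hv.continuousAt.pow _)) ha hB hφ hψ ?_ hpos.ne'
  · refine ⟨_, key, ?_⟩
    rw [abs_div, abs_of_pos hpos, div_mul_eq_mul_div, div_le_iff₀ hpos]
    have h2 := hh.deriv2_pos d hd0
    have e1 : κ * (((k + 1 : ℕ) : ℝ) * d ^ (k + 1 - 1)) * ((v ^ ((k + 1) * (k + 2)))⁻¹) t
        = κ * ((k + 1 : ℕ) : ℝ) * (q t / v t) ^ (k + 1) / d := by
      simp only [Pi.inv_apply, Pi.pow_apply, hd, Nat.add_sub_cancel, div_pow]
      field_simp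
      ring
    rw [e1]
    have e2 : ∀ N X Y : ℝ, 0 < Y → 0 ≤ X → |N| * X ≤ |N| * (X + Y) := fun N X Y hY hX => by
      have := abs_nonneg N; nlinarith
    refine (e2 _ _ _ h2 (by positivity)).trans (mul_le_mul_of_nonneg_right (le_of_eq ?_) ?_)
    · congr 1
      simp only [Pi.pow_apply, ← hd]
      have e3 : d ^ (k + 1) = (q t / v t) ^ (k + 1) * v t ^ ((k + 1) * (k + 2)) := by
        rw [hd, mul_pow, div_pow]; field_simp; ring
      have e4 : v t ^ ((k + 1) * (k + 2)) = v t ^ ((k + 1) * (k + 2) - 1) * v t := by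
        rw [← pow_succ]; congr 1
      rw [e3, e4]
      push_cast
      field_simp
      ring
    · exact add_nonneg (by positivity) h2.le
  · filter_upwards [heq, hva] with s hs hvs
    simp only [Pi.inv_apply, Pi.pow_apply, hs, stress, Pi.sub_apply]
    rw [mul_pow, div_pow]
    field_simp
    ring

/-- Regularity of equilibria: a continuous slope is differentiable when the stress is, since the
stress is a strictly increasing function of the slope. -/
theorem differentiableAt_slope (hm : 1 ≤ m) (hκ : 0 < κ) (hh : IsVolumetricEnergy h)
    {q v T : ℝ → ℝ} {t v' T' : ℝ} (hq : ContinuousAt q t) (hq0 : 0 < q t) (hv0 : 0 < v t)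
    (hv : HasDerivAt v v' t) (hT : HasDerivAt T T' t)
    (heq : ∀ᶠ s in 𝓝 t, T s = stress m κ h (q s) (v s)) : DifferentiableAt ℝ q t := by
  obtain ⟨D, hD, -⟩ := exists_hasDerivAt_volRatio hm hκ hh hq hq0 hv0 hv hT heq
  have h1 := hD.div (hv.pow m) (pow_pos hv0 m).ne'
  refine h1.differentiableAt.congr_of_eventuallyEq ?_
  filter_upwards [hv.continuousAt.eventually (lt_mem_nhds hv0)] with s hs
  simp only [Pi.div_apply, Pi.pow_apply]
  field_simp

/-- The derivative of the virial along a curve.  The derivative of the slope cancels: only those of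
the hoop stretch and of the stress remain. -/
theorem hasDerivAt_virial (hm : 1 ≤ m) (hκ : 0 < κ) (hh : IsVolumetricEnergy h)
    {q v T : ℝ → ℝ} {t v' T' : ℝ} (hq : ContinuousAt q t) (hq0 : 0 < q t) (hv0 : 0 < v t)
    (hv : HasDerivAt v v' t) (hT : HasDerivAt T T' t)
    (heq : ∀ᶠ s in 𝓝 t, T s = stress m κ h (q s) (v s)) :
    HasDerivAt (fun s => virial m κ h (q s) (v s))
      (v t ^ m * (v' * ((m + 1) * T t + m * κ * (q t / v t - (q t / v t) ^ (m + 1)))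
        - (q t - v t) * T')) t := by
  have hqd := (differentiableAt_slope hm hκ hh hq hq0 hv0 hv hT heq).hasDerivAt
  set q' := deriv q t
  obtain ⟨k, rfl⟩ : ∃ k, m = k + 1 := ⟨m - 1, by omega⟩
  have hδ := hqd.mul (hv.pow (k + 1))
  have h1 : HasDerivAt h (deriv h (q t * v t ^ (k + 1))) (q t * v t ^ (k + 1)) :=
    hasDerivAt_vol hh (by positivity)
  have h2 := h1.comp t hδ
  have h3 := ((hqd.pow (k + 1 + 1)).const_mul (κ / ((k + 1 : ℕ) + 1))).add h2
  have h4 := h3.add ((hδ.const_mul κ).mul (((hv.log hv0.ne').const_add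
    (1 / (((k + 1 : ℕ) : ℝ) + 1))).const_mul ((k + 1 : ℕ) : ℝ)))
  have h5 := h4.sub ((hqd.sub hv).mul ((hv.pow (k + 1)).mul hT))
  refine (h5.congr_of_eventuallyEq ?_).congr_deriv ?_
  · filter_upwards [heq] with s hs
    simp only [virial, energy, Pi.sub_apply, Pi.add_apply, Pi.mul_apply, Pi.pow_apply,
      Function.comp, ← hs]
  · simp only [Pi.sub_apply, Pi.mul_apply, Pi.pow_apply, heq.self_of_nhds, stress]
    push_cast
    simp only [div_pow]
    field_simp
    ring

/-! ### Large hoop stretches -/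

/-- For a bounded stress `h'` is at most of the order `log v`, and convexity then bounds `h` itself
at volume ratios below `1`. -/
theorem abs_virial_le (hκ : 0 < κ) (hh : IsVolumetricEnergy h) {q v : ℝ} (hq : 0 < q) (hv : 1 ≤ v)
    (hδ : q * v ^ m ≤ 1) :
    |virial m κ h q v| ≤ (2 * κ + h 1 + 2 * m * κ) * (1 + Real.log v)
      + 2 * v ^ (m + 1) * |stress m κ h q v| := by
  have hv0 : 0 < v := by linarith
  have hvm : 1 ≤ v ^ m := one_le_pow₀ hv
  have hvm1 : 1 ≤ v ^ (m + 1) := one_le_pow₀ hv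
  have hδ0 : 0 < q * v ^ m := by positivity
  have hq1 : q ≤ 1 := by nlinarith
  have hlog : 0 ≤ Real.log v := Real.log_nonneg hv
  have hx1 : (q / v) ^ m ≤ 1 := pow_le_one₀ (by positivity) ((div_le_one hv0).2 (by linarith))
  have hx0 : 0 ≤ (q / v) ^ m := by positivity
  have hq2 : q ^ (m + 1) ≤ 1 := pow_le_one₀ hq.le hq1
  have hq3 : 0 ≤ q ^ (m + 1) := by positivity
  have hc : (1 : ℝ) / (m + 1) ≤ 1 := by
    rw [div_le_one (by positivity)]; have : (0 : ℝ) ≤ m := by positivity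
    linarith
  have hc0 : (0 : ℝ) ≤ 1 / (m + 1) := by positivity
  set T := stress m κ h q v with hT
  have hmk : 0 ≤ m * κ := by positivity
  have hd : |deriv h (q * v ^ m)| ≤ |T| + κ + m * κ * (1 + Real.log v) := by
    have e : deriv h (q * v ^ m) = T - κ * (q / v) ^ m - m * κ * (1 / (m + 1) + Real.log v) := by
      rw [hT, stress]; ring
    have h1 : κ * (q / v) ^ m ≤ κ := by nlinarith
    have h2 : 0 ≤ κ * (q / v) ^ m := by positivity
    have h3 : m * κ * (1 / (m + 1) + Real.log v) ≤ m * κ * (1 + Real.log v) := by gcongr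
    have h4 : 0 ≤ m * κ * (1 / (m + 1) + Real.log v) := by positivity
    rw [e, abs_le]
    constructor <;> linarith [neg_abs_le T, le_abs_self T]
  have hh1 : h (q * v ^ m) ≤ h 1 + |deriv h (q * v ^ m)| := by
    have h1 := volBregman_nonneg hh (d := 1) one_pos hδ0
    unfold volBregman at h1
    have h2 : - (deriv h (q * v ^ m) * (1 - q * v ^ m)) ≤ |deriv h (q * v ^ m)| := by
      refine (neg_le_abs _).trans ?_
      rw [abs_mul, abs_of_nonneg (show 0 ≤ 1 - q * v ^ m by linarith)]
      nlinarith [abs_nonneg (deriv h (q * v ^ m))]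
    linarith
  have hh0 := hh.nonneg _ hδ0
  have hE0 : 0 ≤ energy m κ h q v := by unfold energy; positivity
  have hE : energy m κ h q v
      ≤ κ + (h 1 + (|T| + κ + m * κ * (1 + Real.log v))) + m * κ * (1 + Real.log v) := by
    unfold energy
    have h1 : κ / (m + 1) * q ^ (m + 1) ≤ κ := by
      have : κ / (m + 1) ≤ κ := by rw [div_eq_mul_one_div]; nlinarith
      have h2 : 0 ≤ κ / (m + 1) := by positivity
      nlinarith
    have h2 : κ * (q * v ^ m) * (m * (1 / (m + 1) + Real.log v))
        ≤ κ * 1 * (m * (1 + Real.log v)) := by gcongr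
    linarith
  have hS : |(q - v) * (v ^ m * T)| ≤ v ^ (m + 1) * |T| := by
    rw [abs_mul, abs_mul, abs_of_pos (show 0 < v ^ m by positivity),
      abs_of_nonpos (show q - v ≤ 0 by linarith), pow_succ]
    have h1 : 0 ≤ v ^ m * |T| := by positivity
    nlinarith
  have hV : |virial m κ h q v| ≤ energy m κ h q v + |(q - v) * (v ^ m * T)| := by
    unfold virial
    rw [← hT]
    refine (abs_sub _ _).trans ?_
    rw [abs_of_nonneg hE0]
  have h5 : |T| ≤ v ^ (m + 1) * |T| := by nlinarith [abs_nonneg T]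
  have h6 : h 1 ≤ h 1 * (1 + Real.log v) := by nlinarith [hh.nonneg 1 one_pos]
  have h7 : κ ≤ κ * (1 + Real.log v) := by nlinarith
  nlinarith

theorem tendsto_one_add_log_div_pow (m : ℕ) :
    Tendsto (fun v : ℝ => (1 + Real.log v) / v ^ (m + 1)) atTop (𝓝 0) := by
  have h1 : Tendsto (fun v : ℝ => 1 / v ^ (m + 1)) atTop (𝓝 0) := by
    simpa [Function.comp_def] using
      tendsto_inv_atTop_zero.comp (tendsto_pow_atTop (α := ℝ) (Nat.succ_ne_zero m))
  have h2 : Tendsto (fun v : ℝ => Real.log v / v ^ (m + 1)) atTop (𝓝 0) := by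
    have := isLittleO_log_rpow_atTop (r := ((m + 1 : ℕ) : ℝ)) (by positivity)
    have h3 := this.tendsto_div_nhds_zero
    simpa only [Real.rpow_natCast] using h3
  simpa [add_div] using h1.add h2

/-- When the stress is bounded and the hoop stretch is large, the volume ratio is small. -/
theorem eventually_volRatio_le_one (hm : 1 ≤ m) (hκ : 0 < κ) (hh : IsVolumetricEnergy h) :
    ∀ᶠ v in atTop, ∀ q, 0 < q → stress m κ h q v ≤ 1 → q * v ^ m ≤ 1 := by
  have hmk : 0 < m * κ := by positivity
  filter_upwards [Real.tendsto_log_atTop.eventually_ge_atTop ((1 - deriv h 1) / (m * κ)),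
    eventually_gt_atTop 0] with v hv hv0 q hq hT
  by_contra! hlt
  have h1 := (deriv_vol_lt_iff hh one_pos (by linarith)).2 hlt
  rw [div_le_iff₀ hmk] at hv
  unfold stress at hT
  have h2 : 0 < κ * (q / v) ^ m := by positivity
  have h3 : 0 < m * κ * (1 / ((m : ℝ) + 1)) := by positivity
  nlinarith

/-- `Φ̂ - (q - v) Φ̂,₁ = o(vⁿ)` as `v → ∞`, along slopes whose Cauchy stress tends to zero. -/
theorem tendsto_virial_div_pow (hm : 1 ≤ m) (hκ : 0 < κ) (hh : IsVolumetricEnergy h) {ι : Type*}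
    {l : Filter ι} {q v : ι → ℝ} (hq : ∀ᶠ i in l, 0 < q i) (hv : Tendsto v l atTop)
    (hT : Tendsto (fun i => stress m κ h (q i) (v i)) l (𝓝 0)) :
    Tendsto (fun i => virial m κ h (q i) (v i) / v i ^ (m + 1)) l (𝓝 0) := by
  have h1 : Tendsto (fun i => (2 * κ + h 1 + 2 * m * κ) * ((1 + Real.log (v i)) / v i ^ (m + 1))
      + 2 * |stress m κ h (q i) (v i)|) l (𝓝 0) := by
    have := (((tendsto_one_add_log_div_pow m).comp hv).const_mul
      (2 * κ + h 1 + 2 * m * κ)).add (hT.abs.const_mul 2)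
    simpa using this
  refine squeeze_zero_norm' ?_ h1
  filter_upwards [hq, hv.eventually (eventually_volRatio_le_one hm hκ hh),
    hv.eventually (eventually_ge_atTop 1), hT.eventually_le_const zero_lt_one]
    with i hi1 hi2 hi3 hi4
  have hv0 : 0 < v i := by linarith
  have := abs_virial_le hκ hh hi1 hi3 (hi2 _ hi1 hi4)
  rw [Real.norm_eq_abs, abs_div, abs_of_pos (show 0 < v i ^ (m + 1) by positivity),
    div_le_iff₀ (by positivity)]
  refine this.trans (le_of_eq ?_)
  field_simp

/-! ### The field of cavitating extremals -/

/-- The factor in `dT/dv = - stressDecay (r' / v) / v`, the radial equilibrium equation for the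
Cauchy stress `T` as a function of the hoop stretch `v`. -/
noncomputable def stressDecay (m : ℕ) (κ x : ℝ) : ℝ := κ * m * x * ∑ i ∈ Finset.range m, x ^ i

theorem sub_one_mul_stressDecay (m : ℕ) (κ x : ℝ) :
    (x - 1) * stressDecay m κ x = κ * m * (x ^ (m + 1) - x) := by
  have := mul_geom_sum x m
  unfold stressDecay
  linear_combination κ * m * x * this

theorem stressDecay_nonneg (hκ : 0 < κ) {x : ℝ} (hx : 0 ≤ x) : 0 ≤ stressDecay m κ x := by
  unfold stressDecay
  have : 0 ≤ ∑ i ∈ Finset.range m, x ^ i := Finset.sum_nonneg fun i _ => by positivity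
  positivity

theorem continuous_stressDecay (m : ℕ) (κ : ℝ) : Continuous (stressDecay m κ) := by
  unfold stressDecay; fun_prop

/-- `T` and `qs` are the Cauchy stress and the slope `r'` of cavitating equilibria as functions of
the hoop stretch `v = r / R`, and `vc` is the hoop stretch at which these equilibria reach the
homogeneous state `r' = r / R`.  Only the values at `v ≥ vc` have a meaning; the requirements below
`vc` make `T` and `qs` regular at `vc`. -/
structure IsCavityField (m : ℕ) (κ : ℝ) (h : ℝ → ℝ) (vc : ℝ) (T qs : ℝ → ℝ) : Prop where
  vc_pos : 0 < vc
  slope_pos : ∀ v, 0 < v → 0 < qs v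
  slope_vc : qs vc = vc
  slope_lt : ∀ v, vc < v → qs v < v
  continuousAt_slope : ∀ v, 0 < v → ContinuousAt qs v
  stress_eq : ∀ v, 0 < v → T v = stress m κ h (qs v) v
  hasDerivAt_stress : ∀ v, vc ≤ v → HasDerivAt T (-stressDecay m κ (qs v / v) / v) v
  tendsto_stress : Tendsto T atTop (𝓝 0)

namespace IsCavityField

variable {vc : ℝ} {T qs : ℝ → ℝ}

theorem slope_le (F : IsCavityField m κ h vc T qs) {v : ℝ} (hv : vc ≤ v) : qs v ≤ v := by
  rcases hv.eq_or_lt with rfl | hlt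
  · exact F.slope_vc.le
  · exact (F.slope_lt v hlt).le

/-- Along the field the virial is a primitive of `n * v ^ m * T`, so that `virial / n` serves as the
calibration beyond `vc`. -/
theorem hasDerivAt_virial_slope (F : IsCavityField m κ h vc T qs) (hm : 1 ≤ m) (hκ : 0 < κ)
    (hh : IsVolumetricEnergy h) {v : ℝ} (hv : vc ≤ v) :
    HasDerivAt (fun w => virial m κ h (qs w) w) ((m + 1) * (v ^ m * T v)) v := by
  have hv0 := F.vc_pos.trans_le hv
  refine (hasDerivAt_virial hm hκ hh (q := qs) (v := fun w => w) (F.continuousAt_slope v hv0)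
    (F.slope_pos v hv0) hv0 (hasDerivAt_id v) (F.hasDerivAt_stress v hv)
    ((lt_mem_nhds hv0).mono fun w hw => F.stress_eq w hw)).congr_deriv ?_
  have h1 := sub_one_mul_stressDecay m κ (qs v / v)
  have h2 : (qs v - v) * (-stressDecay m κ (qs v / v) / v)
      = -((qs v / v - 1) * stressDecay m κ (qs v / v)) := by field_simp
  rw [h2, h1]
  ring

theorem antitoneOn_stress (F : IsCavityField m κ h vc T qs) (hκ : 0 < κ) :
    AntitoneOn T (Ici vc) := by
  refine antitoneOn_of_hasDerivWithinAt_nonpos (f' := fun v => -stressDecay m κ (qs v / v) / v)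
    (convex_Ici vc) (fun v hv => (F.hasDerivAt_stress v hv).continuousAt.continuousWithinAt)
    (fun v hv => (F.hasDerivAt_stress v (interior_subset hv)).hasDerivWithinAt) fun v hv => ?_
  have hv' : vc ≤ v := interior_subset hv
  have hv0 := F.vc_pos.trans_le hv'
  have := stressDecay_nonneg (m := m) hκ (div_pos (F.slope_pos v hv0) hv0).le
  exact div_nonpos_of_nonpos_of_nonneg (by linarith) hv0.le

/-- Along the field the stress decreases and `log v` increases, which bounds `h'` at the volume
ratio from above. -/
theorem exists_volRatio_le (F : IsCavityField m κ h vc T qs) (hκ : 0 < κ)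
    (hh : IsVolumetricEnergy h) : ∃ M, ∀ v, vc ≤ v → qs v * v ^ m ≤ M := by
  obtain ⟨M, hM0, hM⟩ := ((eventually_gt_atTop 0).and (hh.deriv_tendsto_top.eventually_ge_atTop
    (T vc - m * κ * (1 / (m + 1) + Real.log vc)))).exists
  refine ⟨M, fun v hv => ?_⟩
  have hv0 := F.vc_pos.trans_le hv
  have hq := F.slope_pos v hv0
  rw [← deriv_vol_le_iff hh (by positivity) hM0]
  refine le_trans ?_ hM
  have h1 := F.antitoneOn_stress hκ self_mem_Ici hv hv
  rw [F.stress_eq v hv0, stress] at h1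
  have h2 : Real.log vc ≤ Real.log v := Real.log_le_log F.vc_pos hv
  have h3 : 0 ≤ κ * (qs v / v) ^ m := by positivity
  have h4 : m * κ * Real.log vc ≤ m * κ * Real.log v := by gcongr
  linarith

theorem exists_lipschitz_slope_Icc (F : IsCavityField m κ h vc T qs) (hm : 1 ≤ m) (hκ : 0 < κ)
    (hh : IsVolumetricEnergy h) (V : ℝ) :
    ∃ L, 0 ≤ L ∧ ∀ v ∈ Icc vc V, ∀ w ∈ Icc vc V, |qs v - qs w| ≤ L * |v - w| := by
  have hpos : ∀ v ∈ Icc vc V, 0 < v := fun v hv => F.vc_pos.trans_le hv.1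
  set B : ℝ → ℝ := fun v => |-stressDecay m κ (qs v / v) / v
    + m * κ * ((m + 1) * (qs v / v) ^ m - 1) * (1 / v)| * (qs v * v ^ m / (κ * m * (qs v / v) ^ m))
      / v ^ m + qs v * m / v with hB
  have hqc : ContinuousOn qs (Icc vc V) := fun v hv =>
    (F.continuousAt_slope v (hpos v hv)).continuousWithinAt
  have hxc : ContinuousOn (fun v => qs v / v) (Icc vc V) :=
    hqc.div continuousOn_id fun v hv => (hpos v hv).ne'
  have hBc : ContinuousOn B (Icc vc V) := by
    have hm0 : (0 : ℝ) < m := by exact_mod_cast hm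
    have hne : ∀ v ∈ Icc vc V, v ≠ 0 := fun v hv => (hpos v hv).ne'
    have h1 := (continuous_stressDecay m κ).comp_continuousOn hxc
    refine ContinuousOn.add (ContinuousOn.div (ContinuousOn.mul (ContinuousOn.abs
      (ContinuousOn.add (h1.neg.div continuousOn_id hne) (ContinuousOn.mul ?_ ?_)))
      (ContinuousOn.div (hqc.mul (by fun_prop)) (by fun_prop) ?_)) (by fun_prop) ?_)
      (ContinuousOn.div (by fun_prop) continuousOn_id hne)
    · fun_prop
    · exact continuousOn_const.div continuousOn_id hne
    · intro v hv
      have := F.slope_pos v (hpos v hv)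
      have := hpos v hv
      positivity
    · intro v hv
      exact pow_ne_zero _ (hne v hv)
  obtain ⟨L, hL⟩ := isCompact_Icc.exists_bound_of_continuousOn hBc
  have hd : ∀ v ∈ Icc vc V, ∃ q', HasDerivAt qs q' v ∧ |q'| ≤ L := by
    intro v hv
    have hv0 := hpos v hv
    have hq0 := F.slope_pos v hv0
    have heq : ∀ᶠ w in 𝓝 v, T w = stress m κ h (qs w) w :=
      (lt_mem_nhds hv0).mono fun w hw => F.stress_eq w hw
    have hqd := (differentiableAt_slope hm hκ hh (F.continuousAt_slope v hv0) hq0 hv0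
      (hasDerivAt_id v) (F.hasDerivAt_stress v hv.1) heq).hasDerivAt
    obtain ⟨D, hD, hDle⟩ := exists_hasDerivAt_volRatio hm hκ hh (F.continuousAt_slope v hv0) hq0 hv0
      (hasDerivAt_id v) (F.hasDerivAt_stress v hv.1) heq
    have hDeq := hD.unique (hqd.mul ((hasDerivAt_id v).pow m))
    refine ⟨_, hqd, ?_⟩
    have hL' := (le_abs_self _).trans (hL v hv)
    refine le_trans ?_ hL'
    simp only [id, mul_one] at hDeq hDle
    have hm0 : (0 : ℝ) < m := by exact_mod_cast hm
    have e1 : (m : ℝ) * v ^ (m - 1) = m * v ^ m / v := by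
      obtain ⟨k, rfl⟩ : ∃ k, m = k + 1 := ⟨m - 1, by omega⟩
      simp only [Nat.add_sub_cancel]; field_simp; ring
    rw [e1] at hDeq
    have e2 : deriv qs v = D / v ^ m - qs v * m / v := by
      rw [hDeq]; field_simp; ring
    have h3 : |D| ≤ |-stressDecay m κ (qs v / v) / v
        + m * κ * ((m + 1) * (qs v / v) ^ m - 1) * (1 / v)|
          * (qs v * v ^ m / (κ * m * (qs v / v) ^ m)) := by
      rw [mul_div_assoc', le_div_iff₀ (by positivity)]
      rw [mul_div_assoc', div_le_iff₀ (by positivity)] at hDle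
      exact hDle
    rw [e2]
    refine (abs_sub _ _).trans ?_
    rw [abs_div, abs_of_pos (show 0 < v ^ m by positivity),
      abs_of_pos (show 0 < qs v * m / v by positivity)]
    simp only [hB]
    gcongr
  refine ⟨|L|, abs_nonneg L, fun v hv w hw => ?_⟩
  choose! q' hq' hq'L using hd
  have := (convex_Icc vc V).norm_image_sub_le_of_norm_hasDerivWithin_le (f := qs) (f' := q')
    (C := |L|) (fun x hx => (hq' x hx).hasDerivWithinAt)
    (fun x hx => (hq'L x hx).trans (le_abs_self L)) hw hv
  simpa using this

end IsCavityField

/-! ### The calibration -/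

theorem hasDerivAt_ite_le {f g f' g' : ℝ → ℝ} {c x : ℝ} (hf : x ≤ c → HasDerivAt f (f' x) x)
    (hg : c ≤ x → HasDerivAt g (g' x) x) (h0 : f c = g c) (h1 : f' c = g' c) :
    HasDerivAt (fun y => if y ≤ c then f y else g y) (if x ≤ c then f' x else g' x) x := by
  rcases lt_trichotomy x c with hx | rfl | hx
  · rw [if_pos hx.le]
    refine (hf hx.le).congr_of_eventuallyEq ?_
    filter_upwards [Iio_mem_nhds hx] with y hy
    rw [if_pos (le_of_lt hy)]
  · rw [if_pos le_rfl]
    have hl : HasDerivWithinAt (fun y => if y ≤ x then f y else g y) (f' x) (Iic x) x :=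
      (hf le_rfl).hasDerivWithinAt.congr (fun y hy => if_pos hy) (if_pos le_rfl)
    have hr : HasDerivWithinAt (fun y => if y ≤ x then f y else g y) (f' x) (Ici x) x := by
      rw [h1]
      refine (hg le_rfl).hasDerivWithinAt.congr (fun y hy => ?_) ?_
      · rcases (show x ≤ y from hy).eq_or_lt with rfl | hlt
        · rw [if_pos le_rfl, h0]
        · rw [if_neg (not_le.2 hlt)]
      · rw [if_pos le_rfl, h0]
    have := hl.union hr
    rwa [Iic_union_Ici, hasDerivWithinAt_univ] at this
  · rw [if_neg (not_le.2 hx)]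
    refine (hg hx.le).congr_of_eventuallyEq ?_
    filter_upwards [Ioi_mem_nhds hx] with y hy
    rw [if_neg (not_le.2 hy)]

/-- The volumetric energy, replaced below `d₀` by its tangent line at `d₀`.  It is bounded near
`0`, in contrast to `h`. -/
noncomputable def truncVol (h : ℝ → ℝ) (d₀ d : ℝ) : ℝ :=
  if d ≤ d₀ then h d₀ + deriv h d₀ * (d - d₀) else h d

theorem hasDerivAt_truncVol (hh : IsVolumetricEnergy h) {d₀ : ℝ} (hd₀ : 0 < d₀) (d : ℝ) :
    HasDerivAt (truncVol h d₀) (deriv h (max d d₀)) d := by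
  have := hasDerivAt_ite_le (f := fun d => h d₀ + deriv h d₀ * (d - d₀)) (g := h)
    (f' := fun _ => deriv h d₀) (g' := deriv h) (c := d₀) (x := d)
    (fun _ => ((((hasDerivAt_id d).sub_const d₀).const_mul (deriv h d₀)).const_add
      (h d₀)).congr_deriv (by simp))
    (fun hd => hasDerivAt_vol hh (hd₀.trans_le hd)) (by simp) rfl
  refine this.congr_deriv ?_
  split_ifs with hd
  · rw [max_eq_right hd]
  · rw [max_eq_left (le_of_not_ge hd)]

/-- The slope field `r' = fieldSlope (r / R)`: homogeneous deformations up to the hoop stretch `vc`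
and cavitating equilibria beyond it. -/
noncomputable def fieldSlope (vc : ℝ) (qs : ℝ → ℝ) (v : ℝ) : ℝ := if v ≤ vc then v else qs v

/-- The volume ratio of the field; below `l` it is frozen at its value at `l`, in accordance with
the truncation of the volumetric energy. -/
noncomputable def fieldVol (m : ℕ) (l vc : ℝ) (qs : ℝ → ℝ) (v : ℝ) : ℝ :=
  if v ≤ vc then max (v ^ (m + 1)) (l ^ (m + 1)) else qs v * v ^ m

/-- The Cauchy stress of the field. -/
noncomputable def fieldStress (m : ℕ) (κ : ℝ) (h : ℝ → ℝ) (l vc : ℝ) (T : ℝ → ℝ) (v : ℝ) : ℝ :=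
  if v ≤ vc then κ + deriv h (max (v ^ (m + 1)) (l ^ (m + 1))) + m * κ * (1 / (m + 1) + Real.log v)
  else T v

/-- The calibration: `R ^ n * potential (r / R)` is the least energy on the ball of radius `R`
under the boundary condition `r(R) = r`, except that below the hoop stretch `l` the volumetric
energy is truncated, which makes it a lower bound that stays bounded as `r / R → 0`. -/
noncomputable def potential (m : ℕ) (κ : ℝ) (h : ℝ → ℝ) (l vc : ℝ) (qs : ℝ → ℝ) (v : ℝ) : ℝ :=
  (if v ≤ vc then truncVol h (l ^ (m + 1)) (v ^ (m + 1)) + κ * v ^ (m + 1)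
      + κ * m * (v ^ (m + 1) * Real.log v)
    else virial m κ h (qs v) v) / (m + 1)

namespace IsCavityField

variable {vc l : ℝ} {T qs : ℝ → ℝ}

theorem fieldSlope_of_le (F : IsCavityField m κ h vc T qs) {v : ℝ} (hv : vc ≤ v) :
    fieldSlope vc qs v = qs v := by
  unfold fieldSlope
  split_ifs with h1
  · rw [le_antisymm h1 hv, F.slope_vc]
  · rfl

theorem fieldSlope_pos (F : IsCavityField m κ h vc T qs) {v : ℝ} (hv : 0 < v) :
    0 < fieldSlope vc qs v := by
  unfold fieldSlope
  split_ifs with h1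
  exacts [hv, F.slope_pos v hv]

theorem fieldVol_of_le (hl0 : 0 < l) {v : ℝ} (hv : l ≤ v) :
    fieldVol m l vc qs v = fieldSlope vc qs v * v ^ m := by
  unfold fieldVol fieldSlope
  split_ifs with h1
  · rw [max_eq_left (pow_le_pow_left₀ hl0.le hv _), pow_succ']
  · rfl

theorem fieldVol_pos (F : IsCavityField m κ h vc T qs) {v : ℝ} (hv : 0 < v) :
    0 < fieldVol m l vc qs v := by
  unfold fieldVol
  split_ifs with h1
  · exact lt_max_of_lt_left (by positivity)
  · have := F.slope_pos v hv
    positivity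

theorem exists_fieldVol_le (F : IsCavityField m κ h vc T qs) (hκ : 0 < κ)
    (hh : IsVolumetricEnergy h) (hl0 : 0 < l) (hl : l ≤ vc) :
    ∃ M, ∀ v, 0 < v → fieldVol m l vc qs v ≤ M := by
  obtain ⟨M, hM⟩ := F.exists_volRatio_le hκ hh
  refine ⟨max M (vc ^ (m + 1)), fun v hv => ?_⟩
  unfold fieldVol
  split_ifs with h1
  · refine le_max_of_le_right (max_le ?_ ?_) <;> gcongr
  · exact le_max_of_le_left (hM v (le_of_not_ge h1))

theorem fieldStress_of_le (F : IsCavityField m κ h vc T qs) (hl0 : 0 < l) {v : ℝ}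
    (hv : l ≤ v) : fieldStress m κ h l vc T v = stress m κ h (fieldSlope vc qs v) v := by
  have hv0 := hl0.trans_le hv
  unfold fieldStress fieldSlope
  split_ifs with h1
  · rw [max_eq_left (pow_le_pow_left₀ hl0.le hv _), pow_succ', stress, div_self hv0.ne', one_pow,
      mul_one]
  · exact F.stress_eq v hv0

theorem stress_vc (F : IsCavityField m κ h vc T qs) (hl0 : 0 < l) (hl : l ≤ vc) :
    κ + deriv h (max (vc ^ (m + 1)) (l ^ (m + 1))) + m * κ * (1 / (m + 1) + Real.log vc)
      = T vc := by
  have h1 := F.fieldStress_of_le hl0 hl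
  rw [F.fieldSlope_of_le le_rfl, ← F.stress_eq vc F.vc_pos, fieldStress, if_pos le_rfl] at h1
  exact h1

theorem hasDerivAt_potential (F : IsCavityField m κ h vc T qs) (hm : 1 ≤ m) (hκ : 0 < κ)
    (hh : IsVolumetricEnergy h) (hl0 : 0 < l) (hl : l ≤ vc) {v : ℝ} (hv : 0 < v) :
    HasDerivAt (potential m κ h l vc qs) (v ^ m * fieldStress m κ h l vc T v) v := by
  have hm1 : ((m : ℝ) + 1) ≠ 0 := by positivity
  have hd0 : 0 < l ^ (m + 1) := by positivity
  have hf : HasDerivAt (fun v : ℝ => truncVol h (l ^ (m + 1)) (v ^ (m + 1)) + κ * v ^ (m + 1)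
      + κ * m * (v ^ (m + 1) * Real.log v)) ((m + 1) * (v ^ m * (κ
        + deriv h (max (v ^ (m + 1)) (l ^ (m + 1))) + m * κ * (1 / (m + 1) + Real.log v)))) v := by
    have hp := hasDerivAt_pow (m + 1) v
    have h1 := HasDerivAt.comp (h := fun v : ℝ => v ^ (m + 1)) v
      (hasDerivAt_truncVol hh hd0 (v ^ (m + 1))) hp
    refine ((h1.add (hp.const_mul κ)).add ((hp.mul (Real.hasDerivAt_log hv.ne')).const_mul
      (κ * m))).congr_deriv ?_
    push_cast
    field_simp
    ring
  have key := (hasDerivAt_ite_le (c := vc) (x := v)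
    (f' := fun v => (m + 1) * (v ^ m * (κ
        + deriv h (max (v ^ (m + 1)) (l ^ (m + 1))) + m * κ * (1 / (m + 1) + Real.log v))))
    (g' := fun v => (m + 1) * (v ^ m * T v)) (fun _ => hf)
    (fun hv => F.hasDerivAt_virial_slope hm hκ hh hv) ?_ ?_).div_const ((m : ℝ) + 1)
  · refine key.congr_deriv ?_
    unfold fieldStress
    split_ifs <;> field_simp
  · have h1 : truncVol h (l ^ (m + 1)) (vc ^ (m + 1)) = h (vc ^ (m + 1)) := by
      unfold truncVol
      split_ifs with h2
      · rw [le_antisymm h2 (pow_le_pow_left₀ hl0.le hl _)]; simp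
      · rfl
    rw [h1, F.slope_vc, virial_eq_energy_self, energy, ← pow_succ']
    field_simp
    ring
  · rw [F.stress_vc hl0 hl]

/-- The Hamilton-Jacobi equation for the potential, with the Weierstrass excess. -/
theorem energy_eq_potential (F : IsCavityField m κ h vc T qs)
    (hl0 : 0 < l) (hl : l ≤ vc) {v : ℝ} (hv : 0 < v) (q : ℝ) :
    energy m κ h q v = (m + 1) * potential m κ h l vc qs v
      + v ^ m * fieldStress m κ h l vc T v * (q - v)
      + excess m κ h v q (fieldSlope vc qs v) (fieldVol m l vc qs v) := by
  have hm1 : ((m : ℝ) + 1) ≠ 0 := by positivity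
  unfold potential
  rw [mul_div_cancel₀ _ hm1]
  rcases lt_or_ge vc v with hlt | hle
  · rw [if_neg (not_le.2 hlt), fieldVol_of_le hl0 (hl.trans hlt.le),
      F.fieldStress_of_le hl0 (hl.trans hlt.le), F.fieldSlope_of_le hlt.le, virial]
    have := energy_eq_add_excess (m := m) (κ := κ) (h := h) hv q (qs v)
    linarith
  · rw [if_pos hle, fieldStress, if_pos hle, fieldSlope, if_pos hle, fieldVol, if_pos hle]
    have h1 : truncVol h (l ^ (m + 1)) (v ^ (m + 1)) = h (max (v ^ (m + 1)) (l ^ (m + 1)))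
        + deriv h (max (v ^ (m + 1)) (l ^ (m + 1)))
          * (v ^ (m + 1) - max (v ^ (m + 1)) (l ^ (m + 1))) := by
      unfold truncVol
      split_ifs with h2
      · rw [max_eq_right h2]
      · rw [max_eq_left (le_of_not_ge h2)]; ring
    rw [h1]
    unfold energy excess volBregman powBregman
    field_simp
    ring

theorem continuousOn_potential (F : IsCavityField m κ h vc T qs) (hm : 1 ≤ m) (hκ : 0 < κ)
    (hh : IsVolumetricEnergy h) (hl0 : 0 < l) (hl : l ≤ vc) :
    ContinuousOn (potential m κ h l vc qs) (Ici 0) := by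
  intro v hv
  rcases (show 0 ≤ v from hv).eq_or_lt with rfl | hv0
  · have hc : ContinuousAt (fun v : ℝ => (truncVol h (l ^ (m + 1)) (v ^ (m + 1)) + κ * v ^ (m + 1)
      + κ * m * (v ^ m * (v * Real.log v))) / (m + 1)) 0 := by
      have h1 : Continuous (truncVol h (l ^ (m + 1))) := continuous_iff_continuousAt.2 fun d =>
        (hasDerivAt_truncVol hh (by positivity) d).continuousAt
      have h2 := Real.continuous_mul_log
      exact (by fun_prop : Continuous _).continuousAt
    refine (hc.congr ?_).continuousWithinAt
    filter_upwards [Iio_mem_nhds F.vc_pos] with v hv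
    rw [potential, if_pos (le_of_lt hv), pow_succ]
    ring
  · exact (F.hasDerivAt_potential hm hκ hh hl0 hl hv0).continuousAt.continuousWithinAt

theorem tendsto_potential_div_pow (F : IsCavityField m κ h vc T qs) (hm : 1 ≤ m) (hκ : 0 < κ)
    (hh : IsVolumetricEnergy h) :
    Tendsto (fun v => potential m κ h l vc qs v / v ^ (m + 1)) atTop (𝓝 0) := by
  have h1 := tendsto_virial_div_pow hm hκ hh (l := atTop) (q := qs) (v := fun v => v)
    ((eventually_gt_atTop 0).mono F.slope_pos) tendsto_id
    (F.tendsto_stress.congr' ((eventually_gt_atTop 0).mono F.stress_eq))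
  have h2 := h1.div_const ((m : ℝ) + 1)
  rw [zero_div] at h2
  refine h2.congr' ?_
  filter_upwards [eventually_gt_atTop vc] with v hv
  rw [potential, if_neg (not_le.2 hv), div_right_comm]

theorem exists_abs_potential_le (F : IsCavityField m κ h vc T qs) (hm : 1 ≤ m) (hκ : 0 < κ)
    (hh : IsVolumetricEnergy h) (hl0 : 0 < l) (hl : l ≤ vc) {τ : ℝ} (hτ : 0 < τ) :
    ∃ C, ∀ v, 0 ≤ v → |potential m κ h l vc qs v| ≤ τ * v ^ (m + 1) + C := by
  have h1 := (F.tendsto_potential_div_pow (l := l) hm hκ hh).abs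
  rw [abs_zero] at h1
  obtain ⟨V, hV⟩ := ((h1.eventually_le_const hτ).and (eventually_gt_atTop 0)).exists_forall_of_atTop
  obtain ⟨C, hC⟩ := isCompact_Icc.exists_bound_of_continuousOn
    ((F.continuousOn_potential hm hκ hh hl0 hl).mono (Icc_subset_Ici_self : Icc 0 V ⊆ _))
  refine ⟨|C|, fun v hv => ?_⟩
  rcases le_total v V with h2 | h2
  · have := (hC v ⟨hv, h2⟩).trans (le_abs_self C)
    rw [Real.norm_eq_abs] at this
    have h3 : 0 ≤ τ * v ^ (m + 1) := by positivity
    linarith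
  · obtain ⟨h3, h4⟩ := hV v h2
    rw [abs_div, abs_of_pos (show 0 < v ^ (m + 1) by positivity), div_le_iff₀ (by positivity)] at h3
    linarith [abs_nonneg C]

theorem exists_abs_fieldStress_le (F : IsCavityField m κ h vc T qs)
    (hh : IsVolumetricEnergy h) {c V : ℝ} (hl0 : 0 < l) (hc : 0 < c) :
    ∃ C, 0 ≤ C ∧ ∀ v ∈ Icc c V, |v ^ m * fieldStress m κ h l vc T v| ≤ C := by
  have hA : ContinuousOn (fun v : ℝ => v ^ m * (κ + deriv h (max (v ^ (m + 1)) (l ^ (m + 1)))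
      + m * κ * (1 / (m + 1) + Real.log v))) (Icc c V) := by
    have h1 : ContinuousOn (fun v : ℝ => deriv h (max (v ^ (m + 1)) (l ^ (m + 1)))) (Icc c V) :=
      (continuousOn_deriv_vol hh).comp (by fun_prop) fun v _ =>
        lt_max_of_lt_right (pow_pos hl0 _)
    have h2 : ContinuousOn Real.log (Icc c V) := Real.continuousOn_log.mono fun v hv =>
      (hc.trans_le hv.1).ne'
    fun_prop
  have hB : ContinuousOn (fun v => v ^ m * T v) (Icc vc V) := by
    have h1 : ContinuousOn T (Icc vc V) := fun v hv =>
      (F.hasDerivAt_stress v hv.1).continuousAt.continuousWithinAt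
    fun_prop
  obtain ⟨A, hA⟩ := isCompact_Icc.exists_bound_of_continuousOn hA
  obtain ⟨B, hB⟩ := isCompact_Icc.exists_bound_of_continuousOn hB
  refine ⟨max |A| |B|, le_max_of_le_left (abs_nonneg A), fun v hv => ?_⟩
  unfold fieldStress
  split_ifs with h1
  · exact ((hA v hv).trans (le_abs_self A)).trans (le_max_left _ _)
  · exact ((hB v ⟨le_of_not_ge h1, hv.2⟩).trans (le_abs_self B)).trans (le_max_right _ _)

theorem exists_lipschitz_fieldSlope (F : IsCavityField m κ h vc T qs) (hm : 1 ≤ m) (hκ : 0 < κ)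
    (hh : IsVolumetricEnergy h) (V : ℝ) :
    ∃ L, 0 ≤ L ∧ ∀ v ≤ V, ∀ w ≤ V, |fieldSlope vc qs v - fieldSlope vc qs w| ≤ L * |v - w| := by
  obtain ⟨L, hL0, hL⟩ := F.exists_lipschitz_slope_Icc hm hκ hh V
  have key : ∀ v ≤ V, ∀ w ≤ V, v ≤ w →
      |fieldSlope vc qs v - fieldSlope vc qs w| ≤ (L + 1) * |v - w| := by
    intro v hv w hw hvw
    rw [abs_of_nonpos (sub_nonpos.2 hvw)]
    rcases le_total w vc with h1 | h1
    · rw [fieldSlope, if_pos (hvw.trans h1), fieldSlope, if_pos h1,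
        abs_of_nonpos (sub_nonpos.2 hvw)]
      nlinarith
    · rw [F.fieldSlope_of_le h1]
      rcases le_total v vc with h2 | h2
      · rw [fieldSlope, if_pos h2]
        have h3 := hL vc ⟨le_rfl, h1.trans hw⟩ w ⟨h1, hw⟩
        rw [F.slope_vc, abs_of_nonpos (sub_nonpos.2 h1)] at h3
        have h4 : |v - qs w| ≤ |v - vc| + |vc - qs w| := abs_sub_le _ _ _
        rw [abs_of_nonpos (sub_nonpos.2 h2)] at h4
        nlinarith
      · rw [F.fieldSlope_of_le h2]
        have h3 := hL v ⟨h2, hv⟩ w ⟨h1, hw⟩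
        rw [abs_of_nonpos (sub_nonpos.2 hvw)] at h3
        nlinarith
  refine ⟨L + 1, by linarith, fun v hv w hw => ?_⟩
  rcases le_total v w with h1 | h1
  · exact key v hv w hw h1
  · rw [abs_sub_comm, abs_sub_comm v]
    exact key w hw v hv h1

end IsCavityField

/-! ### Absolutely continuous functions -/

theorem absolutelyContinuous_comp {f g : ℝ → ℝ} {a b C : ℝ} (hC : 0 ≤ C)
    (hf : AbsolutelyContinuousOnInterval f a b)
    (hg : ∀ x ∈ uIcc a b, ∀ y ∈ uIcc a b, |g (f x) - g (f y)| ≤ C * |f x - f y|) :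
    AbsolutelyContinuousOnInterval (fun x => g (f x)) a b := by
  rw [absolutelyContinuousOnInterval_iff] at hf ⊢
  intro ε hε
  obtain ⟨δ, hδ, H⟩ := hf (ε / (C + 1)) (by positivity)
  refine ⟨δ, hδ, fun E hE hlen => ?_⟩
  calc ∑ i ∈ Finset.range E.1, dist (g (f (E.2 i).1)) (g (f (E.2 i).2))
      ≤ ∑ i ∈ Finset.range E.1, C * dist (f (E.2 i).1) (f (E.2 i).2) :=
        Finset.sum_le_sum fun i hi => hg _ (hE.1 i hi).1 _ (hE.1 i hi).2
    _ = C * ∑ i ∈ Finset.range E.1, dist (f (E.2 i).1) (f (E.2 i).2) := by rw [Finset.mul_sum]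
    _ ≤ C * (ε / (C + 1)) := by gcongr; exact (H E hE hlen).le
    _ < (C + 1) * (ε / (C + 1)) := by gcongr; linarith
    _ = ε := by field_simp

theorem absolutelyContinuous_pow {f : ℝ → ℝ} {a b : ℝ} (hf : AbsolutelyContinuousOnInterval f a b)
    (k : ℕ) : AbsolutelyContinuousOnInterval (fun x => f x ^ (k + 1)) a b := by
  induction k with
  | zero => simpa using hf
  | succ k ih => simpa only [pow_succ _ (k + 1)] using ih.fun_mul hf

theorem absolutelyContinuous_mono {f : ℝ → ℝ} {a b c d : ℝ}
    (hf : AbsolutelyContinuousOnInterval f a b) (hac : a ≤ c) (hcd : c ≤ d) (hdb : d ≤ b) :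
    AbsolutelyContinuousOnInterval f c d :=
  hf.mono (by
    rw [uIcc_of_le hcd, uIcc_of_le (hac.trans (hcd.trans hdb))]
    exact Icc_subset_Icc hac hdb)

theorem intervalIntegral_le_of_ae {f g : ℝ → ℝ} {a b : ℝ} (hab : a ≤ b)
    (hf : IntervalIntegrable f volume a b) (hg : IntervalIntegrable g volume a b)
    (hfg : ∀ᵐ x, x ∈ Ioo a b → f x ≤ g x) : ∫ x in a..b, f x ≤ ∫ x in a..b, g x := by
  refine intervalIntegral.integral_mono_ae_restrict hab hf hg ?_
  rw [← restrict_Ioo_eq_restrict_Icc]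
  exact (ae_restrict_iff' measurableSet_Ioo).2 hfg

theorem intervalIntegral_congr_of_ae {f g : ℝ → ℝ} {a b : ℝ} (hab : a ≤ b)
    (hfg : ∀ᵐ x, x ∈ Ioo a b → f x = g x) : ∫ x in a..b, f x = ∫ x in a..b, g x := by
  rw [intervalIntegral.integral_of_le hab, intervalIntegral.integral_of_le hab,
    integral_Ioc_eq_integral_Ioo, integral_Ioc_eq_integral_Ioo]
  exact setIntegral_congr_ae measurableSet_Ioo hfg

theorem intervalIntegrable_congr_of_ae {f g : ℝ → ℝ} {a b : ℝ} (hab : a ≤ b)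
    (hf : IntervalIntegrable f volume a b) (hfg : ∀ᵐ x, x ∈ Ioo a b → f x = g x) :
    IntervalIntegrable g volume a b := by
  rw [intervalIntegrable_iff_integrableOn_Ioo_of_le hab] at hf ⊢
  exact hf.congr_fun_ae ((ae_restrict_iff' measurableSet_Ioo).2 hfg)

theorem ae_deriv_pos_of_mem_admissible {lam ε : ℝ} {r : ℝ → ℝ} (hr : r ∈ admissible lam ε) :
    ∀ᵐ R, R ∈ Ioo ε 1 → 0 < deriv r R := (ae_restrict_iff' measurableSet_Ioo).1 hr.2.2.1

theorem strictMonoOn_of_mem_admissible {lam ε : ℝ} {r : ℝ → ℝ}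
    (hr : r ∈ admissible lam ε) : StrictMonoOn r (Icc ε 1) := by
  intro a ha b hb hab
  have hac := absolutelyContinuous_mono hr.1 ha.1 hab.le hb.2
  have h1 := hac.integral_deriv_eq_sub
  have h2 : 0 < ∫ x in a..b, deriv r x := by
    rw [intervalIntegral.integral_of_le hab.le, integral_Ioc_eq_integral_Ioo]
    have h0 : ∀ᵐ x ∂volume.restrict (Ioo a b), 0 < deriv r x := by
      rw [ae_restrict_iff' measurableSet_Ioo]
      filter_upwards [ae_deriv_pos_of_mem_admissible hr] with x hx hx'
      exact hx ⟨ha.1.trans_lt hx'.1, hx'.2.trans_le hb.2⟩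
    have hint : IntegrableOn (deriv r) (Ioo a b) :=
      (intervalIntegrable_iff_integrableOn_Ioo_of_le hab.le).1 hac.intervalIntegrable_deriv
    rw [setIntegral_pos_iff_support_of_nonneg_ae (h0.mono fun x hx => hx.le) hint]
    have h3 : (Ioo a b : Set ℝ) ≤ᵐ[volume] (Function.support (deriv r) ∩ Ioo a b : Set ℝ) := by
      filter_upwards [(ae_restrict_iff' measurableSet_Ioo).1 h0] with x hx hx'
      exact ⟨(hx hx').ne', hx'⟩
    refine lt_of_lt_of_le ?_ (measure_mono_ae h3)
    simpa using hab
  linarith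

/-! ### The energy identity -/

theorem hasDerivAt_div_id {r : ℝ → ℝ} {r' R : ℝ} (hR : 0 < R) (hr : HasDerivAt r r' R) :
    HasDerivAt (fun S => r S / S) ((r' - r R / R) / R) R := by
  refine (hr.div (hasDerivAt_id R) hR.ne').congr_deriv ?_
  simp only [id]
  field_simp

/-- The integrand of the total Weierstrass excess of `r` over the slope field. -/
noncomputable def excessDensity (m : ℕ) (κ : ℝ) (h : ℝ → ℝ) (l vc : ℝ) (qs r : ℝ → ℝ) (R : ℝ) : ℝ :=
  R ^ m * excess m κ h (r R / R) (deriv r R) (fieldSlope vc qs (r R / R))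
    (fieldVol m l vc qs (r R / R))

/-- The integrand of the energy in dimension `m + 1`. -/
noncomputable def energyDensity (m : ℕ) (κ : ℝ) (h r : ℝ → ℝ) (R : ℝ) : ℝ :=
  R ^ m * energy m κ h (deriv r R) (r R / R)

namespace IsCavityField

variable {vc l : ℝ} {T qs : ℝ → ℝ}

theorem excessDensity_nonneg (F : IsCavityField m κ h vc T qs) (hκ : 0 < κ)
    (hh : IsVolumetricEnergy h) {r : ℝ → ℝ} {R : ℝ} (hR : 0 < R) (hr : 0 < r R)
    (hr' : 0 < deriv r R) : 0 ≤ excessDensity m κ h l vc qs r R := by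
  have hv : 0 < r R / R := by positivity
  have := excess_nonneg (m := m) hκ hh hv hr' (F.fieldSlope_pos hv).le (F.fieldVol_pos (l := l) hv)
  unfold excessDensity; positivity

/-- The energy density is a total derivative plus the excess over the slope field. -/
theorem hasDerivAt_pow_mul_potential (F : IsCavityField m κ h vc T qs) (hm : 1 ≤ m) (hκ : 0 < κ)
    (hh : IsVolumetricEnergy h) (hl0 : 0 < l) (hl : l ≤ vc) {r : ℝ → ℝ} {r' R : ℝ} (hR0 : 0 < R)
    (hr0 : 0 < r R) (hr : HasDerivAt r r' R) :
    HasDerivAt (fun R => R ^ (m + 1) * potential m κ h l vc qs (r R / R))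
      (R ^ m * (energy m κ h r' (r R / R) - excess m κ h (r R / R) r'
        (fieldSlope vc qs (r R / R)) (fieldVol m l vc qs (r R / R)))) R := by
  have hv : 0 < r R / R := by positivity
  have h1 := hasDerivAt_div_id hR0 hr
  have h2 := HasDerivAt.comp (h := fun R => r R / R) R
    (F.hasDerivAt_potential hm hκ hh hl0 hl hv) h1
  refine ((hasDerivAt_pow (m + 1) R).mul h2).congr_deriv ?_
  rw [F.energy_eq_potential hl0 hl hv r']
  simp only [Function.comp]
  push_cast
  field_simp
  ring

/-- Hilbert's invariant integral for the slope field. -/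
theorem integral_energyDensity (F : IsCavityField m κ h vc T qs) (hm : 1 ≤ m) (hκ : 0 < κ)
    (hh : IsVolumetricEnergy h) (hl0 : 0 < l) (hl : l ≤ vc) {r : ℝ → ℝ} {a b : ℝ} (ha : 0 < a)
    (hab : a ≤ b) (hr : AbsolutelyContinuousOnInterval r a b) (hr0 : ∀ R ∈ Icc a b, 0 < r R)
    (hint : IntervalIntegrable (energyDensity m κ h r) volume a b) :
    IntervalIntegrable (excessDensity m κ h l vc qs r) volume a b ∧
    ∫ R in a..b, energyDensity m κ h r R
      = b ^ (m + 1) * potential m κ h l vc qs (r b / b)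
        - a ^ (m + 1) * potential m κ h l vc qs (r a / a)
        + ∫ R in a..b, excessDensity m κ h l vc qs r R := by
  have hI : uIcc a b = Icc a b := uIcc_of_le hab
  set g : ℝ → ℝ := fun R => r R / R with hg
  have hgac : AbsolutelyContinuousOnInterval g a b := by
    have h1 : ContDiffOn ℝ 1 (fun R : ℝ => R⁻¹) (uIcc a b) := by
      rw [hI]
      exact contDiffOn_id.inv fun x hx => (ha.trans_le hx.1).ne'
    simpa only [hg, div_eq_mul_inv] using hr.fun_mul h1.absolutelyContinuousOnInterval
  have hgc : ContinuousOn g (Icc a b) := hI ▸ hgac.continuousOn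
  have hg0 : ∀ R ∈ Icc a b, 0 < g R := fun R hR => div_pos (hr0 R hR) (ha.trans_le hR.1)
  obtain ⟨x₁, hx₁, hmin⟩ := isCompact_Icc.exists_isMinOn (nonempty_Icc.2 hab) hgc
  obtain ⟨x₂, hx₂, hmax⟩ := isCompact_Icc.exists_isMaxOn (nonempty_Icc.2 hab) hgc
  have hmem : ∀ R ∈ Icc a b, g R ∈ Icc (g x₁) (g x₂) := fun R hR => ⟨hmin hR, hmax hR⟩
  obtain ⟨C, hC0, hC⟩ := F.exists_abs_fieldStress_le (l := l) (c := g x₁) (V := g x₂) hh hl0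
    (hg0 _ hx₁)
  have hψac : AbsolutelyContinuousOnInterval (fun R => potential m κ h l vc qs (g R)) a b := by
    refine absolutelyContinuous_comp hC0 hgac fun x hx y hy => ?_
    rw [hI] at hx hy
    have := (convex_Icc (g x₁) (g x₂)).norm_image_sub_le_of_norm_hasDerivWithin_le
      (f := potential m κ h l vc qs) (C := C)
      (fun v hv => (F.hasDerivAt_potential hm hκ hh hl0 hl
        ((hg0 _ hx₁).trans_le hv.1)).hasDerivWithinAt) (fun v hv => hC v hv) (hmem y hy) (hmem x hx)
    simpa using this
  have hpac : AbsolutelyContinuousOnInterval (fun R : ℝ => R ^ (m + 1)) a b :=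
    (contDiff_id.pow (m + 1)).contDiffOn.absolutelyContinuousOnInterval
  have hGac := hpac.mul hψac
  have hGint := hGac.intervalIntegrable_deriv
  have hGeq := hGac.integral_deriv_eq_sub
  have hae : ∀ᵐ R, R ∈ Ioo a b → energyDensity m κ h r R
      - deriv ((fun R : ℝ => R ^ (m + 1)) * fun R => potential m κ h l vc qs (g R)) R
      = excessDensity m κ h l vc qs r R := by
    filter_upwards [hr.ae_differentiableAt] with R hR hR'
    have hRI : R ∈ Icc a b := Ioo_subset_Icc_self hR'
    have hR0 : 0 < R := ha.trans hR'.1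
    have hd := (hR (hI ▸ hRI)).hasDerivAt
    have h3 := (F.hasDerivAt_pow_mul_potential hm hκ hh hl0 hl hR0 (hr0 R hRI) hd).deriv
    rw [show ((fun R : ℝ => R ^ (m + 1)) * fun R => potential m κ h l vc qs (g R))
      = fun R => R ^ (m + 1) * potential m κ h l vc qs (r R / R) from rfl, h3]
    unfold energyDensity excessDensity
    ring
  have hX := intervalIntegrable_congr_of_ae hab (hint.sub hGint) hae
  refine ⟨hX, ?_⟩
  rw [← intervalIntegral_congr_of_ae hab hae, intervalIntegral.integral_sub hint hGint, hGeq]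
  simp only [Pi.mul_apply, hg]
  ring

/-- The total excess controls how fast `r ^ n` can grow.  This prevents cavities from closing near
the origin, where the energy gives no useful control of `r'` itself. -/
theorem pow_sub_pow_le (F : IsCavityField m κ h vc T qs) (hκ : 0 < κ)
    (hh : IsVolumetricEnergy h) {M : ℝ} (hM0 : 0 < M)
    (hM : ∀ v, 0 < v → fieldVol m l vc qs v ≤ M) {r : ℝ → ℝ}
    {a b : ℝ} (ha : 0 < a) (hab : a ≤ b) (hr : AbsolutelyContinuousOnInterval r a b)
    (hr0 : ∀ R ∈ Icc a b, 0 < r R) (hr' : ∀ᵐ R, R ∈ Ioo a b → 0 < deriv r R)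
    (hint : IntervalIntegrable (excessDensity m κ h l vc qs r) volume a b) :
    r b ^ (m + 1) - r a ^ (m + 1) ≤ (M + 1) * (b ^ (m + 1) - a ^ (m + 1))
      + (m + 1) / (deriv h (M + 1) - deriv h M)
        * ∫ R in a..b, excessDensity m κ h l vc qs r R := by
  have hc0 : 0 < deriv h (M + 1) - deriv h M :=
    sub_pos.2 ((deriv_vol_lt_iff hh hM0 (by linarith)).2 (by linarith))
  set c₀ := deriv h (M + 1) - deriv h M
  have hpac := absolutelyContinuous_pow hr m
  have h1 : IntervalIntegrable (fun R : ℝ => (M + 1) * ((m + 1) * R ^ m)) volume a b :=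
    (by fun_prop : Continuous fun R : ℝ => (M + 1) * ((m + 1) * R ^ m)).intervalIntegrable a b
  have h2 := hint.const_mul ((m + 1) / c₀)
  have h3 : ∫ R in a..b, (M + 1) * ((m + 1) * R ^ m) = (M + 1) * (b ^ (m + 1) - a ^ (m + 1)) := by
    rw [intervalIntegral.integral_const_mul, intervalIntegral.integral_const_mul, integral_pow]
    field_simp
  rw [← hpac.integral_deriv_eq_sub, ← h3, ← intervalIntegral.integral_const_mul,
    ← intervalIntegral.integral_add h1 h2]
  refine intervalIntegral_le_of_ae hab hpac.intervalIntegrable_deriv (h1.add h2) ?_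
  filter_upwards [hr.ae_differentiableAt, hr'] with R hR hRd hR'
  have hRI : R ∈ Icc a b := Ioo_subset_Icc_self hR'
  have hR0 : 0 < R := ha.trans hR'.1
  have hr0R := hr0 R hRI
  have hv : 0 < r R / R := by positivity
  have hd := (hR (by rwa [uIcc_of_le hab])).hasDerivAt
  have hq := hRd hR'
  have hpow := (hd.pow (m + 1)).deriv
  have e : (fun x => r x ^ (m + 1)) = r ^ (m + 1) := rfl
  rw [e, hpow]
  -- `r ^ m * r'` is `R ^ m` times the volume ratio, which the volumetric excess controls.
  have h4 := mul_sub_le_volBregman hh (d := deriv r R * (r R / R) ^ m) (by positivity)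
    (F.fieldVol_pos (l := l) hv) (hM _ hv)
  have h5 : volBregman h (deriv r R * (r R / R) ^ m) (fieldVol m l vc qs (r R / R))
      ≤ excess m κ h (r R / R) (deriv r R) (fieldSlope vc qs (r R / R))
        (fieldVol m l vc qs (r R / R)) := by
    have := powBregman_nonneg m hq.le (F.fieldSlope_pos hv).le
    have h6 : 0 ≤ κ / (m + 1) * powBregman m (deriv r R) (fieldSlope vc qs (r R / R)) := by
      positivity
    unfold excess; linarith
  have h6 := h4.trans h5
  rw [mul_comm, ← le_div_iff₀ hc0] at h6
  have e2 : ((m + 1 : ℕ) : ℝ) * r R ^ (m + 1 - 1) * deriv r R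
      = (m + 1) * R ^ m * (deriv r R * (r R / R) ^ m) := by
    push_cast
    simp only [div_pow]
    field_simp
  have e3 : (M + 1) * ((m + 1) * R ^ m) + (m + 1) / c₀ * excessDensity m κ h l vc qs r R
      = (m + 1) * R ^ m * ((M + 1) + excess m κ h (r R / R) (deriv r R)
        (fieldSlope vc qs (r R / R)) (fieldVol m l vc qs (r R / R)) / c₀) := by
    unfold excessDensity
    field_simp
  rw [e2, e3]
  gcongr
  linarith

end IsCavityField

/-! ### Stability -/

/-- Grönwall's inequality, integrated from the right end point. -/
theorem le_mul_exp_of_le_add_integral {φ : ℝ → ℝ} {a b A B : ℝ} (hB : 0 ≤ B)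
    (hφ : ContinuousOn φ (Icc a b))
    (H : ∀ R ∈ Icc a b, φ R ≤ A + B * ∫ x in R..b, φ x) :
    ∀ R ∈ Icc a b, φ R ≤ A * Real.exp (B * (b - R)) := by
  intro R hR
  have hab : a ≤ b := hR.1.trans hR.2
  set φ' := IccExtend hab ((Icc a b).domRestrict φ) with hφ'
  have hc : Continuous φ' := (continuousOn_iff_continuous_domRestrict.1 hφ).Icc_extend'
  have heq : ∀ x ∈ Icc a b, φ' x = φ x := fun x hx => by rw [hφ', IccExtend_of_mem _ _ hx]; rfl
  have hint : ∀ x ∈ Icc a b, ∫ y in x..b, φ y = ∫ y in x..b, φ' y := fun x hx =>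
    intervalIntegral.integral_congr fun y hy => (heq y (by
      rw [uIcc_of_le hx.2] at hy; exact ⟨hx.1.trans hy.1, hy.2⟩)).symm
  set G : ℝ → ℝ := fun x => (A + B * ∫ y in x..b, φ' y) * Real.exp (B * x)
  have hG : ∀ x, HasDerivAt G ((B * (-φ' x)) * Real.exp (B * x)
      + (A + B * ∫ y in x..b, φ' y) * (Real.exp (B * x) * (B * 1))) x := fun x =>
    (((intervalIntegral.integral_hasDerivAt_left (hc.intervalIntegrable x b)
      (hc.stronglyMeasurableAtFilter _ _) hc.continuousAt).const_mul B).const_add A).mul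
      (((hasDerivAt_id x).const_mul B).exp)
  have hmono : MonotoneOn G (Icc a b) := by
    refine monotoneOn_of_hasDerivWithinAt_nonneg (convex_Icc a b)
      (fun x _ => (hG x).continuousAt.continuousWithinAt) (fun x _ => (hG x).hasDerivWithinAt)
      fun x hx => ?_
    have hx' := interior_subset hx
    have h1 := H x hx'
    rw [hint x hx', ← heq x hx'] at h1
    have h2 := Real.exp_pos (B * x)
    have h3 : 0 ≤ B * Real.exp (B * x) * (A + B * (∫ y in x..b, φ' y) - φ' x) :=
      mul_nonneg (by positivity) (by linarith)
    linarith
  have h1 := hmono hR ⟨hab, le_rfl⟩ hR.2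
  have h2 := H R hR
  rw [hint R hR] at h2
  simp only [G, intervalIntegral.integral_same, mul_zero, add_zero] at h1
  have e : A * Real.exp (B * (b - R)) = A * Real.exp (B * b) * Real.exp (-(B * R)) := by
    rw [mul_assoc, ← Real.exp_add]; ring_nf
  rw [e]
  refine h2.trans ?_
  calc _ = (A + B * ∫ y in R..b, φ' y) * Real.exp (B * R) * Real.exp (-(B * R)) := by
        rw [mul_assoc, ← Real.exp_add]; simp
    _ ≤ _ := by gcongr

/-- A solution on `(0, 1]` of the equation `r' = fieldSlope (r / R)` with the boundary displacement
`lam`.  The lower bound `l` for its hoop stretch keeps it in the region where the truncation of the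
volumetric energy in `potential` has no effect. -/
structure IsFieldSolution (l vc : ℝ) (qs : ℝ → ℝ) (lam : ℝ) (rl : ℝ → ℝ) : Prop where
  continuousOn : ContinuousOn rl (Icc 0 1)
  zero_nonneg : 0 ≤ rl 0
  one : rl 1 = lam
  le_stretch : ∀ R ∈ Ioc (0 : ℝ) 1, l ≤ rl R / R
  hasDerivAt : ∀ R ∈ Ioc (0 : ℝ) 1, HasDerivAt rl (fieldSlope vc qs (rl R / R)) R

namespace IsCavityField

variable {vc l lam : ℝ} {T qs rl : ℝ → ℝ}

theorem pos_of_isFieldSolution (hl0 : 0 < l) (S : IsFieldSolution l vc qs lam rl) {R : ℝ}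
    (hR : R ∈ Ioc (0 : ℝ) 1) : 0 < rl R := by
  have := hl0.trans_le (S.le_stretch R hR)
  exact (div_pos_iff_of_pos_right hR.1).1 this

theorem excessDensity_eq_zero (hl0 : 0 < l) (S : IsFieldSolution l vc qs lam rl) {R : ℝ}
    (hR : R ∈ Ioc (0 : ℝ) 1) : excessDensity m κ h l vc qs rl R = 0 := by
  rw [excessDensity, (S.hasDerivAt R hR).deriv, fieldVol_of_le hl0 (S.le_stretch R hR),
    excess, powBregman_self, volBregman_self]
  ring

/-- Since its volume ratio is bounded and its hoop stretch is bounded below, a field solution is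
Lipschitz. -/
theorem fieldSolution_mem_admissible (F : IsCavityField m κ h vc T qs) (hκ : 0 < κ)
    (hh : IsVolumetricEnergy h) (hl0 : 0 < l) (hl : l ≤ vc) (S : IsFieldSolution l vc qs lam rl)
    {ε : ℝ} (hε : ε ∈ Ico (0 : ℝ) 1) : rl ∈ admissible lam ε := by
  obtain ⟨M, hM⟩ := F.exists_fieldVol_le hκ hh hl0 hl
  have hpos : ∀ R ∈ Ioc (0 : ℝ) 1, 0 < deriv rl R := fun R hR => by
    rw [(S.hasDerivAt R hR).deriv]
    exact F.fieldSlope_pos (hl0.trans_le (S.le_stretch R hR))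
  have hle : ∀ R ∈ Ioc (0 : ℝ) 1, deriv rl R ≤ |M| / l ^ m := fun R hR => by
    have hv := S.le_stretch R hR
    have h1 := hM _ (hl0.trans_le hv)
    rw [fieldVol_of_le hl0 hv] at h1
    rw [(S.hasDerivAt R hR).deriv, le_div_iff₀ (by positivity)]
    have h2 : l ^ m ≤ (rl R / R) ^ m := pow_le_pow_left₀ hl0.le hv m
    have h3 := F.fieldSlope_pos (hl0.trans_le hv)
    nlinarith [le_abs_self M]
  have hint : ∀ R ∈ interior (Icc (0 : ℝ) 1), R ∈ Ioc (0 : ℝ) 1 := fun R hR => by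
    rw [interior_Icc] at hR; exact Ioo_subset_Ioc_self hR
  have hdiff : DifferentiableOn ℝ rl (interior (Icc 0 1)) := fun R hR =>
    (S.hasDerivAt R (hint R hR)).differentiableAt.differentiableWithinAt
  have hmono : MonotoneOn rl (Icc 0 1) := monotoneOn_of_deriv_nonneg (convex_Icc 0 1)
    S.continuousOn hdiff fun R hR => (hpos R (hint R hR)).le
  have key : ∀ a ∈ Icc (0 : ℝ) 1, ∀ b ∈ Icc (0 : ℝ) 1, a ≤ b →
      |rl a - rl b| ≤ |M| / l ^ m * |a - b| := by
    intro a ha b hb hab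
    rw [abs_of_nonpos (sub_nonpos.2 (hmono ha hb hab)), abs_of_nonpos (sub_nonpos.2 hab)]
    have := (convex_Icc (0 : ℝ) 1).image_sub_le_mul_sub_of_deriv_le S.continuousOn hdiff
      (fun R hR => hle R (hint R hR)) a ha b hb hab
    linarith
  have hlip : LipschitzOnWith (Real.toNNReal (|M| / l ^ m)) rl (Icc 0 1) := by
    refine LipschitzOnWith.of_dist_le_mul fun a ha b hb => ?_
    rw [Real.coe_toNNReal _ (by positivity), Real.dist_eq, Real.dist_eq]
    rcases le_total a b with hab | hab
    · exact key a ha b hb hab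
    · rw [abs_sub_comm, abs_sub_comm a]; exact key b hb a ha hab
  refine ⟨LipschitzOnWith.absolutelyContinuousOnInterval (K := Real.toNNReal (|M| / l ^ m)) ?_,
    S.one, ?_, ?_⟩
  · rw [uIcc_of_le hε.2.le]; exact hlip.mono (Icc_subset_Icc_left hε.1)
  · rw [ae_restrict_iff' measurableSet_Ioo]
    exact Eventually.of_forall fun R hR => hpos R ⟨hε.1.trans_lt hR.1, hR.2.le⟩
  · exact S.zero_nonneg.trans (hmono ⟨le_rfl, zero_le_one⟩ ⟨hε.1, hε.2.le⟩ hε.1)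

theorem pos_of_mem_admissible {ε : ℝ} {r : ℝ → ℝ} (hr : r ∈ admissible lam ε) {R : ℝ}
    (hR : R ∈ Ioc ε 1) : 0 < r R :=
  hr.2.2.2.trans_lt (strictMonoOn_of_mem_admissible hr ⟨le_rfl, hR.1.le.trans hR.2⟩
    (Ioc_subset_Icc_self hR) hR.1)

theorem le_of_mem_admissible {ε : ℝ} {r : ℝ → ℝ} (hr : r ∈ admissible lam ε) {R : ℝ}
    (hR : R ∈ Icc ε 1) : r R ≤ lam := by
  have := (strictMonoOn_of_mem_admissible hr).monotoneOn hR ⟨hR.1.trans hR.2, le_rfl⟩ hR.2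
  rwa [hr.2.1] at this

/-- Away from the origin a small total excess forces `r` to be close to the field solution. -/
theorem close_on_Icc (F : IsCavityField m κ h vc T qs) (hm : 1 ≤ m) (hκ : 0 < κ)
    (hh : IsVolumetricEnergy h) (hl0 : 0 < l) (hl : l ≤ vc) (S : IsFieldSolution l vc qs lam rl)
    {R₀ η : ℝ} (hR₀ : R₀ ∈ Ioo (0 : ℝ) 1) (hη : 0 < η) :
    ∃ μ > 0, ∀ ε r, 0 ≤ ε → ε < R₀ → r ∈ admissible lam ε →
      IntervalIntegrable (excessDensity m κ h l vc qs r) volume R₀ 1 →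
      ∫ R in R₀..1, excessDensity m κ h l vc qs r R ≤ μ → ∀ R ∈ Icc R₀ 1, |r R - rl R| ≤ η := by
  obtain ⟨L, hL0, hL⟩ := F.exists_lipschitz_fieldSlope hm hκ hh (lam / R₀)
  have hR0 := hR₀.1
  obtain ⟨B, hB⟩ : ∃ B, B = L / R₀ := ⟨_, rfl⟩
  have hB0 : 0 ≤ B := by rw [hB]; positivity
  obtain ⟨τ, hτ⟩ : ∃ τ, τ = η / 2 * Real.exp (-B) := ⟨_, rfl⟩
  have hτ0 : 0 < τ := by rw [hτ]; positivity
  obtain ⟨C, hC⟩ : ∃ C, C = (m + 1) / (κ * τ ^ m * R₀ ^ m) := ⟨_, rfl⟩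
  have hC0 : 0 < C := by rw [hC]; positivity
  refine ⟨τ / C, by positivity, fun ε r hε hεR hr hX hXμ => ?_⟩
  have hrl := F.fieldSolution_mem_admissible hκ hh hl0 hl S (ε := 0) ⟨le_rfl, one_pos⟩
  have hrac := absolutelyContinuous_mono hr.1 hεR.le hR₀.2.le le_rfl
  have hrlac := absolutelyContinuous_mono hrl.1 hR0.le hR₀.2.le le_rfl
  have hdac := hrac.sub hrlac
  have hI : ∀ R ∈ Icc R₀ 1, R ∈ Ioc ε 1 := fun R hR => ⟨hεR.trans_le hR.1, hR.2⟩
  have hI' : ∀ R ∈ Icc R₀ 1, R ∈ Ioc (0 : ℝ) 1 := fun R hR => ⟨hR0.trans_le hR.1, hR.2⟩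
  set φ : ℝ → ℝ := fun R => |r R - rl R| with hφ
  have hφc : ContinuousOn φ (Icc R₀ 1) := by
    have := hdac.continuousOn
    rw [uIcc_of_le hR₀.2.le] at this
    exact this.abs
  have hXnn : ∀ᵐ R, R ∈ Ioo R₀ 1 → 0 ≤ excessDensity m κ h l vc qs r R := by
    filter_upwards [ae_deriv_pos_of_mem_admissible hr] with R hR hR'
    exact F.excessDensity_nonneg hκ hh (hR0.trans hR'.1)
      (pos_of_mem_admissible hr (hI R (Ioo_subset_Icc_self hR'))) (hR ⟨hεR.trans hR'.1, hR'.2⟩)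
  -- the defect `r' - fieldSlope (r / R)` is absorbed by the excess through Young's inequality
  have hpt : ∀ᵐ R, R ∈ Ioo R₀ 1 → |deriv (r - rl) R|
      ≤ (τ + C * excessDensity m κ h l vc qs r R) + B * φ R := by
    filter_upwards [ae_deriv_pos_of_mem_admissible hr, hrac.ae_differentiableAt] with R hR hRd hR'
    have hRI : R ∈ Icc R₀ 1 := Ioo_subset_Icc_self hR'
    have hRp : 0 < R := hR0.trans hR'.1
    have hd1 := (hRd (by rwa [uIcc_of_le hR₀.2.le])).hasDerivAt
    have hd2 := S.hasDerivAt R (hI' R hRI)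
    rw [(hd1.sub hd2).deriv]
    have hq := hR ⟨hεR.trans hR'.1, hR'.2⟩
    have hrp := pos_of_mem_admissible hr (hI R hRI)
    have hv : 0 < r R / R := by positivity
    have hlam : 0 ≤ lam := by
      have := pos_of_mem_admissible hr (R := 1) ⟨hεR.trans hR₀.2, le_rfl⟩
      rw [hr.2.1] at this; exact this.le
    have hV : ∀ s : ℝ, s ≤ lam → s / R ≤ lam / R₀ := fun s hs => by
      have h1 : s / R ≤ lam / R := by gcongr
      have h2 : lam / R ≤ lam / R₀ := by gcongr; exact hR'.1.le
      linarith
    have h1 := hL (r R / R) (hV _ (le_of_mem_admissible hr (Ioc_subset_Icc_self (hI R hRI))))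
      (rl R / R) (hV _ (le_of_mem_admissible hrl (Ioc_subset_Icc_self (hI' R hRI))))
    have h2 : L * |r R / R - rl R / R| ≤ B * φ R := by
      rw [← sub_div, abs_div, abs_of_pos hRp, hB, hφ]
      have : |r R - rl R| / R ≤ |r R - rl R| / R₀ := by gcongr; exact hR'.1.le
      calc L * (|r R - rl R| / R) ≤ L * (|r R - rl R| / R₀) := by gcongr
        _ = L / R₀ * |r R - rl R| := by ring
    set e := |deriv r R - fieldSlope vc qs (r R / R)| with he
    have he0 : 0 ≤ e := abs_nonneg _
    have h3 : e ≤ τ + C * excessDensity m κ h l vc qs r R := by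
      have h4 := pow_abs_sub_le_powBregman hm hq.le (F.fieldSlope_pos hv).le
      have h5 := volBregman_nonneg hh (d := deriv r R * (r R / R) ^ m) (by positivity)
        (F.fieldVol_pos (l := l) hv)
      have h6 : κ / (m + 1) * e ^ (m + 1) ≤ excess m κ h (r R / R) (deriv r R)
          (fieldSlope vc qs (r R / R)) (fieldVol m l vc qs (r R / R)) := by
        unfold excess
        have : κ / (m + 1) * e ^ (m + 1)
          ≤ κ / (m + 1) * powBregman m (deriv r R) (fieldSlope vc qs (r R / R)) := by gcongr
        linarith
      have h7 : R₀ ^ m * (κ / (m + 1) * e ^ (m + 1)) ≤ excessDensity m κ h l vc qs r R := by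
        unfold excessDensity
        have : 0 ≤ κ / (m + 1) * e ^ (m + 1) := by positivity
        gcongr
        exact hR'.1.le
      rcases le_total e τ with h8 | h8
      · have : 0 ≤ excessDensity m κ h l vc qs r R := le_trans (by positivity) h7
        have : 0 ≤ C * excessDensity m κ h l vc qs r R := by positivity
        linarith
      · have h9 : C * (R₀ ^ m * (κ / (m + 1) * e ^ (m + 1))) = e * (e / τ) ^ m := by
          rw [hC, div_pow, pow_succ]
          field_simp
        have h10 : 1 ≤ (e / τ) ^ m := one_le_pow₀ ((one_le_div hτ0).2 h8)
        have h11 : C * (R₀ ^ m * (κ / (m + 1) * e ^ (m + 1)))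
          ≤ C * excessDensity m κ h l vc qs r R := by gcongr
        nlinarith
    have h12 := abs_sub_le (deriv r R) (fieldSlope vc qs (r R / R)) (fieldSlope vc qs (rl R / R))
    linarith
  have hone : r 1 - rl 1 = 0 := by rw [hr.2.1, S.one, sub_self]
  have hG := le_mul_exp_of_le_add_integral (A := 2 * τ) hB0 hφc (fun R hR => ?_)
  · intro R hR
    refine (hG R hR).trans ?_
    have h1 : Real.exp (B * (1 - R)) ≤ Real.exp B := by
      apply Real.exp_le_exp.2
      nlinarith [hR.1]
    calc 2 * τ * Real.exp (B * (1 - R)) ≤ 2 * τ * Real.exp B := by gcongr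
      _ = η := by rw [hτ, Real.exp_neg]; field_simp
  · have hsub : AbsolutelyContinuousOnInterval (r - rl) R 1 :=
      absolutelyContinuous_mono hdac hR.1 hR.2 le_rfl
    have hXR : IntervalIntegrable (excessDensity m κ h l vc qs r) volume R 1 :=
      hX.mono_set (by rw [uIcc_of_le hR.2, uIcc_of_le hR₀.2.le]; exact Icc_subset_Icc_left hR.1)
    have hφi : IntervalIntegrable φ volume R 1 := ContinuousOn.intervalIntegrable
      (by rw [uIcc_of_le hR.2]; exact hφc.mono (Icc_subset_Icc_left hR.1))
    have h0 := hsub.integral_deriv_eq_sub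
    have h1 : φ R = |∫ x in R..1, deriv (r - rl) x| := by
      rw [h0]; simp only [Pi.sub_apply, hone, hφ, zero_sub, abs_neg]
    have hsum := ((intervalIntegrable_const (c := τ)).add (hXR.const_mul C)).add (hφi.const_mul B)
    have h2 := intervalIntegral.abs_integral_le_integral_abs (f := deriv (r - rl))
      (μ := volume) hR.2
    have h3 := intervalIntegral_le_of_ae hR.2 hsub.intervalIntegrable_deriv.abs hsum
      (hpt.mono fun x hx hx' => hx ⟨hR.1.trans_lt hx'.1, hx'.2⟩)
    rw [intervalIntegral.integral_add ((intervalIntegrable_const (c := τ)).add (hXR.const_mul C))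
      (hφi.const_mul B), intervalIntegral.integral_add intervalIntegrable_const (hXR.const_mul C),
      intervalIntegral.integral_const_mul, intervalIntegral.integral_const_mul,
      intervalIntegral.integral_const, smul_eq_mul] at h3
    have h4 : ∫ x in R..1, excessDensity m κ h l vc qs r x
        ≤ ∫ x in R₀..1, excessDensity m κ h l vc qs r x := by
      have hadd := intervalIntegral.integral_add_adjacent_intervals (a := R₀) (b := R)
        (hX.mono_set (by
          rw [uIcc_of_le hR.1, uIcc_of_le hR₀.2.le]; exact Icc_subset_Icc_right hR.2)) hXR
      have : 0 ≤ ∫ x in R₀..R, excessDensity m κ h l vc qs r x := by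
        rw [intervalIntegral.integral_of_le hR.1, integral_Ioc_eq_integral_Ioo]
        refine setIntegral_nonneg_of_ae_restrict ((ae_restrict_iff' measurableSet_Ioo).2 ?_)
        exact hXnn.mono fun x hx hx' => hx ⟨hx'.1, hx'.2.trans_le hR.2⟩
      linarith
    have h5 : C * ∫ x in R..1, excessDensity m κ h l vc qs r x ≤ τ := by
      calc _ ≤ C * (τ / C) := by gcongr; exact h4.trans hXμ
        _ = τ := by field_simp
    have h6 : (1 - R) * τ ≤ τ := by nlinarith [hR.1]
    rw [h1]
    linarith

/-- A small total excess forces `r` to be uniformly close to the field solution.  On `[R₀, 1]` this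
is Grönwall's inequality; on `[ε, R₀]` neither `r ^ n` nor `rl ^ n` can vary by much, because the
volume of the ball of radius `R₀` and the excess are small. -/
theorem uniformly_close (F : IsCavityField m κ h vc T qs) (hm : 1 ≤ m) (hκ : 0 < κ)
    (hh : IsVolumetricEnergy h) (hl0 : 0 < l) (hl : l ≤ vc) (S : IsFieldSolution l vc qs lam rl)
    {η : ℝ} (hη : 0 < η) :
    ∃ μ > 0, ∃ ε₀ > 0, ∀ ε r, 0 ≤ ε → ε < ε₀ → r ∈ admissible lam ε →
      (∀ a ∈ Ioo ε 1, IntervalIntegrable (excessDensity m κ h l vc qs r) volume a 1 ∧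
        ∫ R in a..1, excessDensity m κ h l vc qs r R ≤ μ) →
      ∀ R ∈ Icc ε 1, |r R - rl R| ≤ η := by
  obtain ⟨M₁, hM₁⟩ := F.exists_fieldVol_le hκ hh hl0 hl
  set M := |M₁| + 1
  have hM0 : 0 < M := by positivity
  have hM : ∀ v, 0 < v → fieldVol m l vc qs v ≤ M := fun v hv => by
    have := hM₁ v hv; have := le_abs_self M₁; simp only [M]; linarith
  have hc0 : 0 < deriv h (M + 1) - deriv h M :=
    sub_pos.2 ((deriv_vol_lt_iff hh hM0 (by linarith)).2 (by linarith))
  set c := (m + 1) / (deriv h (M + 1) - deriv h M) with hc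
  have hcp : 0 < c := by positivity
  have hrl := F.fieldSolution_mem_admissible hκ hh hl0 hl S (ε := 0) ⟨le_rfl, one_pos⟩
  have hlam : 0 < lam := by
    rw [← S.one]; exact pos_of_isFieldSolution hl0 S ⟨one_pos, le_rfl⟩
  -- a radius such that the volume enclosed by it is negligible
  obtain ⟨R₀, hR₀, hR₀η⟩ : ∃ R₀ ∈ Ioo (0 : ℝ) 1, (M + 1) * R₀ ^ (m + 1) ≤ η ^ (m + 1) / 3 := by
    have h1 : Tendsto (fun R : ℝ => (M + 1) * R ^ (m + 1)) (𝓝[>] 0) (𝓝 0) := by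
      have : Continuous fun R : ℝ => (M + 1) * R ^ (m + 1) := by fun_prop
      simpa using (this.tendsto 0).mono_left nhdsWithin_le_nhds
    have h2 := h1.eventually_le_const (show 0 < η ^ (m + 1) / 3 by positivity)
    obtain ⟨R, hR1, hR2⟩ := (h2.and (Ioo_mem_nhdsGT (zero_lt_one (α := ℝ)))).exists
    exact ⟨R, hR2, hR1⟩
  have hpow : Tendsto (fun s : ℝ => s ^ (m + 1)) (𝓝 (rl R₀)) (𝓝 (rl R₀ ^ (m + 1))) :=
    (continuous_pow (m + 1)).tendsto _
  obtain ⟨η₁, hη₁, hη₁'⟩ := Metric.tendsto_nhds_nhds.1 hpow (η ^ (m + 1) / 3) (by positivity)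
  obtain ⟨μ₁, hμ₁, H⟩ := F.close_on_Icc hm hκ hh hl0 hl S hR₀
    (show 0 < min η (η₁ / 2) by positivity)
  refine ⟨min μ₁ (η ^ (m + 1) / 3 / c), by positivity, R₀, hR₀.1, fun ε r hε hεR hr hX => ?_⟩
  have h0 := H ε r hε hεR hr (hX R₀ ⟨hεR, hR₀.2⟩).1
    ((hX R₀ ⟨hεR, hR₀.2⟩).2.trans (min_le_left _ _))
  intro R hR
  rcases le_total R₀ R with h1 | h1
  · exact (h0 R ⟨h1, hR.2⟩).trans (min_le_left _ _)
  -- variation of the `n`-th powers on `[δ, R₀]`, for `r` as well as for the field solution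
  have hdrop : ∀ (δ : ℝ) (s : ℝ → ℝ), 0 ≤ δ → δ ≤ R → δ < R₀ → s ∈ admissible lam δ →
      (∀ a ∈ Ioo δ 1, IntervalIntegrable (excessDensity m κ h l vc qs s) volume a 1 ∧
        ∫ R in a..1, excessDensity m κ h l vc qs s R ≤ η ^ (m + 1) / 3 / c) →
      0 ≤ s R₀ ^ (m + 1) - s R ^ (m + 1) ∧
      s R₀ ^ (m + 1) - s R ^ (m + 1) ≤ η ^ (m + 1) / 3 + η ^ (m + 1) / 3 := by
    intro δ s hδ hδR hδR₀ hs hXs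
    have hRI : R ∈ Icc δ 1 := ⟨hδR, hR.2⟩
    have hsm := (strictMonoOn_of_mem_admissible hs).monotoneOn
    have hRnn : 0 ≤ s R := hs.2.2.2.trans (hsm ⟨le_rfl, hδR.trans hR.2⟩ hRI hδR)
    refine ⟨sub_nonneg.2 (pow_le_pow_left₀ hRnn (hsm hRI ⟨hδR₀.le, hR₀.2.le⟩ h1) _), ?_⟩
    have key : ∀ a ∈ Ioo δ R₀, s R₀ ^ (m + 1) - s a ^ (m + 1)
        ≤ η ^ (m + 1) / 3 + η ^ (m + 1) / 3 := by
      intro a ha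
      have ha0 : 0 < a := hδ.trans_lt ha.1
      have ha1 : a < 1 := ha.2.trans hR₀.2
      obtain ⟨hXi, hXle⟩ := hXs a ⟨ha.1, ha1⟩
      have hXi' : IntervalIntegrable (excessDensity m κ h l vc qs s) volume a R₀ :=
        hXi.mono_set (by
          rw [uIcc_of_le ha.2.le, uIcc_of_le ha1.le]; exact Icc_subset_Icc_right hR₀.2.le)
      have hXi'' : IntervalIntegrable (excessDensity m κ h l vc qs s) volume R₀ 1 :=
        hXi.mono_set (by
          rw [uIcc_of_le hR₀.2.le, uIcc_of_le ha1.le]; exact Icc_subset_Icc_left ha.2.le)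
      have h3 := F.pow_sub_pow_le hκ hh hM0 hM ha0 ha.2.le
        (absolutelyContinuous_mono hs.1 ha.1.le ha.2.le hR₀.2.le)
        (fun x hx => pos_of_mem_admissible hs ⟨ha.1.trans_le hx.1, hx.2.trans hR₀.2.le⟩)
        ((ae_deriv_pos_of_mem_admissible hs).mono fun x hx hx' =>
          hx ⟨ha.1.trans hx'.1, hx'.2.trans hR₀.2⟩) hXi'
      have h4 : ∫ x in a..R₀, excessDensity m κ h l vc qs s x ≤ η ^ (m + 1) / 3 / c := by
        refine le_trans ?_ hXle
        rw [← intervalIntegral.integral_add_adjacent_intervals hXi' hXi'']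
        have : 0 ≤ ∫ x in R₀..1, excessDensity m κ h l vc qs s x := by
          rw [intervalIntegral.integral_of_le hR₀.2.le, integral_Ioc_eq_integral_Ioo]
          refine setIntegral_nonneg_of_ae_restrict ((ae_restrict_iff' measurableSet_Ioo).2 ?_)
          filter_upwards [ae_deriv_pos_of_mem_admissible hs] with x hx hx'
          exact F.excessDensity_nonneg hκ hh (hR₀.1.trans hx'.1)
            (pos_of_mem_admissible hs ⟨hδR₀.trans hx'.1, hx'.2.le⟩) (hx ⟨hδR₀.trans hx'.1, hx'.2⟩)
        linarith
      have h5 : c * ∫ x in a..R₀, excessDensity m κ h l vc qs s x ≤ η ^ (m + 1) / 3 := by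
        calc _ ≤ c * (η ^ (m + 1) / 3 / c) := by gcongr
          _ = η ^ (m + 1) / 3 := by field_simp
      have h6 : (M + 1) * (R₀ ^ (m + 1) - a ^ (m + 1)) ≤ (M + 1) * R₀ ^ (m + 1) := by
        gcongr; linarith [pow_pos ha0 (m + 1)]
      linarith
    have hsc : ContinuousOn s (Icc δ 1) := by
      have := hs.1.continuousOn
      rwa [uIcc_of_le (hδR.trans hR.2)] at this
    rcases hδR.lt_or_eq with hlt | rfl
    · rcases h1.lt_or_eq with hlt' | rfl
      · exact key R ⟨hlt, hlt'⟩
      · rw [sub_self]; positivity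
    · have hlim : Tendsto (fun a => s R₀ ^ (m + 1) - s a ^ (m + 1)) (𝓝[>] δ)
          (𝓝 (s R₀ ^ (m + 1) - s δ ^ (m + 1))) := by
        have h7 : Tendsto s (𝓝[>] δ) (𝓝 (s δ)) := by
          have := hsc δ ⟨le_rfl, hR.2⟩
          refine Tendsto.mono_left this ?_
          rw [← nhdsWithin_Ioo_eq_nhdsGT (hδR₀.trans hR₀.2)]
          exact nhdsWithin_mono _ Ioo_subset_Icc_self
        exact (h7.pow (m + 1)).const_sub _
      exact le_of_tendsto hlim (Filter.mem_of_superset (Ioo_mem_nhdsGT hδR₀) key)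
  have hR0 : 0 ≤ R := hε.trans hR.1
  obtain ⟨d1, d2⟩ := hdrop ε r hε hR.1 hεR hr fun a ha => ⟨(hX a ha).1,
    (hX a ha).2.trans (min_le_right _ _)⟩
  obtain ⟨d3, d4⟩ := hdrop 0 rl le_rfl hR0 hR₀.1 hrl fun a ha => by
    have hz : ∀ᵐ x, x ∈ Ioo a 1 → (0 : ℝ) = excessDensity m κ h l vc qs rl x :=
      Eventually.of_forall fun x hx =>
        (excessDensity_eq_zero hl0 S ⟨ha.1.trans hx.1, hx.2.le⟩).symm
    refine ⟨intervalIntegrable_congr_of_ae ha.2.le (intervalIntegrable_const (c := (0 : ℝ))) hz, ?_⟩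
    rw [← intervalIntegral_congr_of_ae ha.2.le hz]
    simp only [intervalIntegral.integral_zero]
    positivity
  have d5 : |r R₀ ^ (m + 1) - rl R₀ ^ (m + 1)| < η ^ (m + 1) / 3 := by
    have h8 := h0 R₀ ⟨le_rfl, hR₀.2.le⟩
    refine hη₁' ?_
    rw [Real.dist_eq]
    exact (h8.trans (min_le_right _ _)).trans_lt (by linarith)
  have hrnn : 0 ≤ r R := by
    rcases hR.1.lt_or_eq with hlt | rfl
    · exact (pos_of_mem_admissible hr ⟨hlt, hR.2⟩).le
    · exact hr.2.2.2
  have hrlnn : 0 ≤ rl R := by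
    rcases hR0.lt_or_eq with hlt | rfl
    · exact (pos_of_isFieldSolution hl0 S ⟨hlt, hR.2⟩).le
    · exact S.zero_nonneg
  have h9 := abs_sub_pow_le m hrnn hrlnn
  have h10 : |r R ^ (m + 1) - rl R ^ (m + 1)| ≤ η ^ (m + 1) := by
    rw [abs_lt] at d5
    rw [abs_le]
    constructor <;> linarith
  exact le_of_pow_le_pow_left₀ (Nat.succ_ne_zero m) hη.le (h9.trans h10)

end IsCavityField

/-! ### Minimizers -/

theorem modPhi_eq_energy (m : ℕ) (κ : ℝ) (h : ℝ → ℝ) (q v : ℝ) :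
    modPhi (m + 1) κ h q (fun _ => v) = energy m κ h q v := by
  have hm : ((m : ℝ) + 1) ≠ 0 := by positivity
  simp only [modPhi, energy, Finset.prod_const, Finset.card_univ, Fintype.card_fin,
    Nat.add_sub_cancel, Real.log_pow]
  push_cast
  field_simp
  ring

theorem modIntegrand_eq_energyDensity (m : ℕ) (κ : ℝ) (h : ℝ → ℝ) (r : ℝ → ℝ) :
    modIntegrand (m + 1) κ h r = energyDensity m κ h r := by
  funext R
  rw [modIntegrand, modPhi_eq_energy, energyDensity, Nat.add_sub_cancel]

theorem tendsto_integral_left {f : ℝ → ℝ} {ε : ℝ} (hε : ε < 1) (hf : IntegrableOn f (Ioo ε 1)) :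
    Tendsto (fun a => ∫ R in a..1, f R) (𝓝[>] ε) (𝓝 (∫ R in Ioo ε 1, f R)) := by
  have hi : IntervalIntegrable f volume ε 1 :=
    (intervalIntegrable_iff_integrableOn_Ioo_of_le hε.le).2 hf
  have hc := intervalIntegral.continuousOn_primitive_interval' hi right_mem_uIcc ε left_mem_uIcc
  rw [uIcc_of_le hε.le] at hc
  have h1 : Tendsto (fun a => ∫ R in (1 : ℝ)..a, f R) (𝓝[>] ε) (𝓝 (∫ R in (1 : ℝ)..ε, f R)) := by
    refine Tendsto.mono_left hc ?_
    rw [← nhdsWithin_Ioo_eq_nhdsGT hε]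
    exact nhdsWithin_mono _ Ioo_subset_Icc_self
  have h2 := h1.neg
  rw [← intervalIntegral.integral_symm, intervalIntegral.integral_of_le hε.le,
    integral_Ioc_eq_integral_Ioo] at h2
  exact h2.congr fun a => (intervalIntegral.integral_symm _ _).symm

theorem intervalIntegrable_of_integrableOn_Ioo {f : ℝ → ℝ} {ε a : ℝ} (ha : a ∈ Ioo ε 1)
    (hf : IntegrableOn f (Ioo ε 1)) : IntervalIntegrable f volume a 1 :=
  (intervalIntegrable_iff_integrableOn_Ioo_of_le ha.2.le).2
    (hf.mono_set (Ioo_subset_Ioo_left ha.1.le))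

namespace IsCavityField

variable {vc l lam : ℝ} {T qs rl : ℝ → ℝ}

/-- The boundary term of the energy identity at radius `a` is negligible as `a → 0`. -/
theorem exists_abs_boundary_le (F : IsCavityField m κ h vc T qs) (hm : 1 ≤ m) (hκ : 0 < κ)
    (hh : IsVolumetricEnergy h) (hl0 : 0 < l) (hl : l ≤ vc) (lam : ℝ) {τ : ℝ} (hτ : 0 < τ) :
    ∃ C, 0 ≤ C ∧ ∀ a s, 0 < a → 0 ≤ s → s ≤ lam →
      |a ^ (m + 1) * potential m κ h l vc qs (s / a)| ≤ τ + C * a ^ (m + 1) := by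
  set σ := τ / (|lam| ^ (m + 1) + 1)
  have hσ : 0 < σ := by positivity
  obtain ⟨C, hC⟩ := F.exists_abs_potential_le hm hκ hh hl0 hl hσ
  refine ⟨|C|, abs_nonneg C, fun a s ha hs hs' => ?_⟩
  have h1 := hC (s / a) (by positivity)
  rw [abs_mul, abs_of_pos (show 0 < a ^ (m + 1) by positivity)]
  have h2 : a ^ (m + 1) * |potential m κ h l vc qs (s / a)|
      ≤ a ^ (m + 1) * (σ * (s / a) ^ (m + 1) + C) := by gcongr
  have h3 : a ^ (m + 1) * (σ * (s / a) ^ (m + 1) + C) = σ * s ^ (m + 1) + C * a ^ (m + 1) := by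
    rw [div_pow]; field_simp
  have h4 : σ * s ^ (m + 1) ≤ τ := by
    have h5 : s ^ (m + 1) ≤ |lam| ^ (m + 1) := by
      gcongr; exact hs'.trans (le_abs_self lam)
    calc σ * s ^ (m + 1) ≤ σ * (|lam| ^ (m + 1) + 1) := by gcongr; linarith
      _ = τ := by simp only [σ]; field_simp
  have h5 : C * a ^ (m + 1) ≤ |C| * a ^ (m + 1) := by gcongr; exact le_abs_self C
  linarith

/-- Up to a small error the energy of `r` exceeds the least possible value by the total excess. -/
theorem abs_integral_sub_le (F : IsCavityField m κ h vc T qs) (hm : 1 ≤ m) (hκ : 0 < κ)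
    (hh : IsVolumetricEnergy h) (hl0 : 0 < l) (hl : l ≤ vc) {τ C : ℝ}
    (hC : ∀ a s, 0 < a → 0 ≤ s → s ≤ lam →
      |a ^ (m + 1) * potential m κ h l vc qs (s / a)| ≤ τ + C * a ^ (m + 1))
    {ε a : ℝ} {r : ℝ → ℝ} (hε : 0 ≤ ε) (hr : r ∈ admissible lam ε) (ha : a ∈ Ioo ε 1)
    (hint : IntegrableOn (energyDensity m κ h r) (Ioo ε 1)) :
    IntervalIntegrable (excessDensity m κ h l vc qs r) volume a 1 ∧
    |(∫ R in a..1, energyDensity m κ h r R) - potential m κ h l vc qs lam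
      - ∫ R in a..1, excessDensity m κ h l vc qs r R| ≤ τ + C * a ^ (m + 1) := by
  have ha0 : 0 < a := hε.trans_lt ha.1
  obtain ⟨h1, h2⟩ := F.integral_energyDensity hm hκ hh hl0 hl ha0 ha.2.le
    (absolutelyContinuous_mono hr.1 ha.1.le ha.2.le le_rfl)
    (fun R hR => pos_of_mem_admissible hr ⟨ha.1.trans_le hR.1, hR.2⟩)
    (intervalIntegrable_of_integrableOn_Ioo ha hint)
  refine ⟨h1, ?_⟩
  have h3 := hC a (r a) ha0 (pos_of_mem_admissible hr ⟨ha.1, ha.2.le⟩).le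
    (le_of_mem_admissible hr ⟨ha.1.le, ha.2.le⟩)
  rw [h2, one_pow, one_mul, div_one, hr.2.1]
  rw [← abs_neg] at h3
  convert h3 using 2
  ring

theorem integral_excess_nonneg (F : IsCavityField m κ h vc T qs) (hκ : 0 < κ)
    (hh : IsVolumetricEnergy h) {ε a b : ℝ} {r : ℝ → ℝ} (hε : 0 ≤ ε) (hr : r ∈ admissible lam ε)
    (ha : ε < a) (hab : a ≤ b) (hb : b ≤ 1) :
    0 ≤ ∫ R in a..b, excessDensity m κ h l vc qs r R := by
  rw [intervalIntegral.integral_of_le hab, integral_Ioc_eq_integral_Ioo]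
  refine setIntegral_nonneg_of_ae_restrict ((ae_restrict_iff' measurableSet_Ioo).2 ?_)
  filter_upwards [ae_deriv_pos_of_mem_admissible hr] with x hx hx'
  exact F.excessDensity_nonneg hκ hh (hε.trans_lt (ha.trans hx'.1))
    (pos_of_mem_admissible hr ⟨ha.trans hx'.1, hx'.2.le.trans hb⟩)
    (hx ⟨ha.trans hx'.1, hx'.2.trans_le hb⟩)

/-- Lower bound for the energy: `potential lam` plus the total excess, up to the boundary term at
the inner radius. -/
theorem potential_sub_le_integral (F : IsCavityField m κ h vc T qs) (hm : 1 ≤ m) (hκ : 0 < κ)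
    (hh : IsVolumetricEnergy h) (hl0 : 0 < l) (hl : l ≤ vc) {τ C : ℝ}
    (hC : ∀ a s, 0 < a → 0 ≤ s → s ≤ lam →
      |a ^ (m + 1) * potential m κ h l vc qs (s / a)| ≤ τ + C * a ^ (m + 1))
    {ε : ℝ} {r : ℝ → ℝ} (hε : ε ∈ Ico (0 : ℝ) 1) (hr : r ∈ admissible lam ε)
    (hint : IntegrableOn (energyDensity m κ h r) (Ioo ε 1)) {a : ℝ} (ha : a ∈ Ioo ε 1) :
    ∫ R in a..1, excessDensity m κ h l vc qs r R
      ≤ (∫ R in Ioo ε 1, energyDensity m κ h r R) - potential m κ h l vc qs lam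
        + (τ + C * ε ^ (m + 1)) := by
  have hlim : Tendsto (fun b => (∫ R in b..1, energyDensity m κ h r R)
      - potential m κ h l vc qs lam + (τ + C * b ^ (m + 1))) (𝓝[>] ε)
      (𝓝 ((∫ R in Ioo ε 1, energyDensity m κ h r R) - potential m κ h l vc qs lam
        + (τ + C * ε ^ (m + 1)))) := by
    refine ((tendsto_integral_left hε.2 hint).sub_const _).add ?_
    have : Continuous fun b : ℝ => τ + C * b ^ (m + 1) := by fun_prop
    exact (this.tendsto ε).mono_left nhdsWithin_le_nhds
  refine ge_of_tendsto hlim (Filter.mem_of_superset (Ioo_mem_nhdsGT ha.1) fun b hb => ?_)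
  have hb' : b ∈ Ioo ε 1 := ⟨hb.1, hb.2.trans ha.2⟩
  obtain ⟨h1, h2⟩ := F.abs_integral_sub_le hm hκ hh hl0 hl hC hε.1 hr hb' hint
  have h3 := (abs_le.1 h2).1
  have h4 := intervalIntegral.integral_add_adjacent_intervals (a := b) (b := a) (c := 1)
    (h1.mono_set (by
      rw [uIcc_of_le hb.2.le, uIcc_of_le hb'.2.le]; exact Icc_subset_Icc_right ha.2.le))
    (h1.mono_set (by
      rw [uIcc_of_le ha.2.le, uIcc_of_le hb'.2.le]; exact Icc_subset_Icc_left hb.2.le))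
  have h5 := F.integral_excess_nonneg (l := l) hκ hh hε.1 hr hb'.1 hb.2.le ha.2.le
  simp only [mem_ofPred_eq]
  linarith

/-- The excess of a field solution vanishes, so that its energy is `potential lam` up to the
boundary term. -/
theorem integral_energyDensity_fieldSolution_le (F : IsCavityField m κ h vc T qs) (hm : 1 ≤ m)
    (hκ : 0 < κ) (hh : IsVolumetricEnergy h) (hl0 : 0 < l) (hl : l ≤ vc)
    (S : IsFieldSolution l vc qs lam rl) {τ C : ℝ}
    (hC : ∀ a s, 0 < a → 0 ≤ s → s ≤ lam →
      |a ^ (m + 1) * potential m κ h l vc qs (s / a)| ≤ τ + C * a ^ (m + 1))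
    {ε : ℝ} (hε : ε ∈ Ico (0 : ℝ) 1)
    (hint : IntegrableOn (energyDensity m κ h rl) (Ioo ε 1)) :
    ∫ R in Ioo ε 1, energyDensity m κ h rl R
      ≤ potential m κ h l vc qs lam + (τ + C * ε ^ (m + 1)) := by
  have hr := F.fieldSolution_mem_admissible hκ hh hl0 hl S hε
  have hlim : Tendsto (fun b : ℝ => potential m κ h l vc qs lam + (τ + C * b ^ (m + 1))) (𝓝[>] ε)
      (𝓝 (potential m κ h l vc qs lam + (τ + C * ε ^ (m + 1)))) := by
    have : Continuous fun b : ℝ => potential m κ h l vc qs lam + (τ + C * b ^ (m + 1)) := by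
      fun_prop
    exact (this.tendsto ε).mono_left nhdsWithin_le_nhds
  refine le_of_tendsto_of_tendsto (tendsto_integral_left hε.2 hint) hlim
    (Filter.mem_of_superset (Ioo_mem_nhdsGT hε.2) fun b hb => ?_)
  have h2 := (abs_le.1 (F.abs_integral_sub_le hm hκ hh hl0 hl hC hε.1 hr hb hint).2).2
  have h3 : ∫ R in b..1, excessDensity m κ h l vc qs rl R = 0 := by
    rw [intervalIntegral_congr_of_ae (g := fun _ => (0 : ℝ)) hb.2.le
      (Eventually.of_forall fun R hR =>
        excessDensity_eq_zero hl0 S ⟨hε.1.trans_lt (hb.1.trans hR.1), hR.2.le⟩)]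
    simp
  simp only [mem_ofPred_eq]
  linarith

/-- Field solutions have finite energy: the energy density is the derivative of a function which is
continuous up to the origin, and it is bounded below. -/
theorem integrableOn_energyDensity_fieldSolution (F : IsCavityField m κ h vc T qs) (hm : 1 ≤ m)
    (hκ : 0 < κ) (hh : IsVolumetricEnergy h) (hl0 : 0 < l) (hl : l ≤ vc)
    (S : IsFieldSolution l vc qs lam rl) :
    IntegrableOn (energyDensity m κ h rl) (Ioo 0 1) := by
  have hr := F.fieldSolution_mem_admissible hκ hh hl0 hl S (ε := 0) ⟨le_rfl, one_pos⟩
  obtain ⟨M, hM⟩ := F.exists_fieldVol_le hκ hh hl0 hl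
  set G : ℝ → ℝ := fun R => R ^ (m + 1) * potential m κ h l vc qs (rl R / R) with hG
  have hGd : ∀ R ∈ Ioc (0 : ℝ) 1, HasDerivAt G (energyDensity m κ h rl R) R := fun R hR => by
    refine (F.hasDerivAt_pow_mul_potential hm hκ hh hl0 hl hR.1 (pos_of_isFieldSolution hl0 S hR)
      (S.hasDerivAt R hR)).congr_deriv ?_
    have h1 := excessDensity_eq_zero (m := m) (κ := κ) (h := h) hl0 S hR
    rw [excessDensity, (S.hasDerivAt R hR).deriv] at h1
    rw [mul_sub, h1, sub_zero, energyDensity, (S.hasDerivAt R hR).deriv]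
  have hG0 : G 0 = 0 := by simp [hG]
  have hGc : ContinuousOn G (Icc 0 1) := by
    intro R hR
    rcases hR.1.eq_or_lt with rfl | hlt
    · rw [ContinuousWithinAt, hG0, Metric.tendsto_nhdsWithin_nhds]
      intro τ hτ
      obtain ⟨C, hC0, hC⟩ := F.exists_abs_boundary_le hm hκ hh hl0 hl lam (half_pos hτ)
      have h1 : Tendsto (fun R : ℝ => τ / 2 + C * R ^ (m + 1)) (𝓝 0) (𝓝 (τ / 2)) := by
        have : Continuous fun R : ℝ => τ / 2 + C * R ^ (m + 1) := by fun_prop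
        simpa using this.tendsto 0
      obtain ⟨δ, hδ, H⟩ := Metric.eventually_nhds_iff.1 (h1.eventually_lt_const (half_lt_self hτ))
      refine ⟨δ, hδ, fun R hR hRδ => ?_⟩
      rw [Real.dist_eq, sub_zero]
      rcases hR.1.eq_or_lt with rfl | hlt
      · rw [hG0, abs_zero]; exact hτ
      · exact (hC R (rl R) hlt (pos_of_isFieldSolution hl0 S ⟨hlt, hR.2⟩).le
          (le_of_mem_admissible hr hR)).trans_lt (H hRδ)
    · exact (hGd R ⟨hlt, hR.2⟩).continuousAt.continuousWithinAt
  set B := κ * |M| * (m * |Real.log l|) with hB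
  have hlow : ∀ R ∈ Ioo (0 : ℝ) 1, 0 ≤ energyDensity m κ h rl R + B := by
    intro R hR
    have hR' : R ∈ Ioc (0 : ℝ) 1 := Ioo_subset_Ioc_self hR
    have hv := S.le_stretch R hR'
    have hv0 := hl0.trans_le hv
    rw [energyDensity, (S.hasDerivAt R hR').deriv]
    have hq := F.fieldSlope_pos hv0
    have hδ := hM _ hv0
    rw [fieldVol_of_le hl0 hv] at hδ
    have hlog : -|Real.log l| ≤ 1 / (m + 1) + Real.log (rl R / R) := by
      have h1 := Real.log_le_log hl0 hv
      have h2 := neg_abs_le (Real.log l)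
      have h3 : (0 : ℝ) < 1 / (m + 1) := by positivity
      linarith
    have hE : -B ≤ energy m κ h (fieldSlope vc qs (rl R / R)) (rl R / R) := by
      unfold energy
      have h1 := hh.nonneg (fieldSlope vc qs (rl R / R) * (rl R / R) ^ m) (by positivity)
      have h2 : 0 ≤ κ / (m + 1) * fieldSlope vc qs (rl R / R) ^ (m + 1) := by positivity
      set d := fieldSlope vc qs (rl R / R) * (rl R / R) ^ m
      have hd0 : 0 < d := by positivity
      have h3 : κ * d * (m * (-|Real.log l|))
          ≤ κ * d * (m * (1 / (m + 1) + Real.log (rl R / R))) := by gcongr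
      have h4 : κ * d * (m * |Real.log l|) ≤ B := by
        rw [hB]; gcongr; exact hδ.trans (le_abs_self M)
      linarith
    have hR1 : R ^ m ≤ 1 := pow_le_one₀ hR.1.le hR.2.le
    have hR0 : 0 ≤ R ^ m := pow_nonneg hR.1.le m
    have hB0 : 0 ≤ B := by positivity
    nlinarith
  have h1 : IntegrableOn (fun R => energyDensity m κ h rl R + B) (Ioc 0 1) :=
    intervalIntegral.integrableOn_deriv_of_nonneg (g := fun R => G R + B * R)
      (hGc.add (by fun_prop))
      (fun R hR => (hGd R (Ioo_subset_Ioc_self hR)).add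
        (by simpa using (hasDerivAt_id R).const_mul B)) hlow
  have h2 := h1.sub (integrableOn_const (C := B) (s := Ioc (0 : ℝ) 1) (by simp))
  refine (IntegrableOn.congr_fun h2 (fun R _ => ?_) measurableSet_Ioc).mono_set Ioo_subset_Ioc_self
  simp

/-- The total excess of a minimizer is small, by comparison with the restriction of the field
solution. -/
theorem integral_excess_le_of_isGlobalMinimizer (F : IsCavityField m κ h vc T qs) (hm : 1 ≤ m)
    (hκ : 0 < κ) (hh : IsVolumetricEnergy h) (hl0 : 0 < l) (hl : l ≤ vc)
    (S : IsFieldSolution l vc qs lam rl) {τ C : ℝ}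
    (hC : ∀ a s, 0 < a → 0 ≤ s → s ≤ lam →
      |a ^ (m + 1) * potential m κ h l vc qs (s / a)| ≤ τ + C * a ^ (m + 1))
    {ε : ℝ} (hε : ε ∈ Ico (0 : ℝ) 1) {r : ℝ → ℝ}
    (hr : IsGlobalMinimizer (m + 1) κ h lam ε r) {a : ℝ} (ha : a ∈ Ioo ε 1) :
    IntervalIntegrable (excessDensity m κ h l vc qs r) volume a 1 ∧
    ∫ R in a..1, excessDensity m κ h l vc qs r R ≤ 2 * (τ + C * ε ^ (m + 1)) := by
  have hrl := F.fieldSolution_mem_admissible hκ hh hl0 hl S hε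
  have hli : IntegrableOn (energyDensity m κ h rl) (Ioo ε 1) :=
    (F.integrableOn_energyDensity_fieldSolution hm hκ hh hl0 hl S).mono_set
      (Ioo_subset_Ioo_left hε.1)
  have hle : modEnergy (m + 1) κ h lam ε r ≤ modEnergy (m + 1) κ h lam ε rl := hr.2 hrl
  have hri : IntegrableOn (energyDensity m κ h r) (Ioo ε 1) := by
    by_contra hcon
    rw [modEnergy, modEnergy, modIntegrand_eq_energyDensity, modIntegrand_eq_energyDensity,
      if_neg hcon, if_pos hli, top_le_iff] at hle
    exact EReal.coe_ne_top _ hle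
  rw [modEnergy, modEnergy, modIntegrand_eq_energyDensity, modIntegrand_eq_energyDensity,
    if_pos hri, if_pos hli, EReal.coe_le_coe_iff] at hle
  refine ⟨(F.abs_integral_sub_le hm hκ hh hl0 hl hC hε.1 hr.1 ha hri).1, ?_⟩
  have h1 := F.potential_sub_le_integral hm hκ hh hl0 hl hC hε hr.1 hri ha
  have h2 := F.integral_energyDensity_fieldSolution_le hm hκ hh hl0 hl S hC hε hli
  linarith

theorem isGlobalMinimizer_fieldSolution (F : IsCavityField m κ h vc T qs) (hm : 1 ≤ m)
    (hκ : 0 < κ) (hh : IsVolumetricEnergy h) (hl0 : 0 < l) (hl : l ≤ vc)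
    (S : IsFieldSolution l vc qs lam rl) : IsGlobalMinimizer (m + 1) κ h lam 0 rl := by
  have hε : (0 : ℝ) ∈ Ico (0 : ℝ) 1 := ⟨le_rfl, one_pos⟩
  have hrl := F.fieldSolution_mem_admissible hκ hh hl0 hl S hε
  have hli := F.integrableOn_energyDensity_fieldSolution hm hκ hh hl0 hl S
  refine ⟨hrl, fun s hs => ?_⟩
  simp only [mem_ofPred_eq]
  rw [modEnergy, modEnergy, modIntegrand_eq_energyDensity, modIntegrand_eq_energyDensity,
    if_pos hli]
  split_ifs with hsi
  · rw [EReal.coe_le_coe_iff]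
    refine sub_le_sub_right (le_of_forall_pos_le_add fun τ hτ => ?_) _
    obtain ⟨C, hC0, hC⟩ := F.exists_abs_boundary_le hm hκ hh hl0 hl lam (half_pos hτ)
    have h1 := F.potential_sub_le_integral hm hκ hh hl0 hl hC hε hs hsi
      (a := 1 / 2) ⟨by norm_num, by norm_num⟩
    have h2 := F.integral_energyDensity_fieldSolution_le hm hκ hh hl0 hl S hC hε hli
    have h3 := F.integral_excess_nonneg (l := l) hκ hh le_rfl hs (a := 1 / 2) (b := 1)
      (by norm_num) (by norm_num) le_rfl
    simp only [ne_eq, Nat.succ_ne_zero, not_false_eq_true, zero_pow, mul_zero, add_zero] at h1 h2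
    linarith
  · exact le_top

theorem eqOn_of_isGlobalMinimizer (F : IsCavityField m κ h vc T qs) (hm : 1 ≤ m)
    (hκ : 0 < κ) (hh : IsVolumetricEnergy h) (hl0 : 0 < l) (hl : l ≤ vc)
    (S : IsFieldSolution l vc qs lam rl) {s : ℝ → ℝ}
    (hs : IsGlobalMinimizer (m + 1) κ h lam 0 s) : EqOn s rl (Icc 0 1) := by
  intro R hR
  have hε : (0 : ℝ) ∈ Ico (0 : ℝ) 1 := ⟨le_rfl, one_pos⟩
  have key : ∀ η > 0, |s R - rl R| ≤ η := by
    intro η hη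
    obtain ⟨μ, hμ, ε₀, hε₀, H⟩ := F.uniformly_close hm hκ hh hl0 hl S hη
    obtain ⟨C, -, hC⟩ := F.exists_abs_boundary_le hm hκ hh hl0 hl lam (half_pos hμ)
    refine H 0 s le_rfl hε₀ hs.1 (fun a ha => ?_) R hR
    obtain ⟨h1, h2⟩ := F.integral_excess_le_of_isGlobalMinimizer hm hκ hh hl0 hl S hC hε hs ha
    refine ⟨h1, h2.trans (le_of_eq ?_)⟩
    simp
    ring
  have := le_of_forall_pos_le_add (a := |s R - rl R|) (b := 0) fun η hη => by
    simpa using key η hη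
  exact sub_eq_zero.1 (abs_nonpos_iff.1 this)

theorem puncturedUniformLimit (F : IsCavityField m κ h vc T qs) (hm : 1 ≤ m)
    (hκ : 0 < κ) (hh : IsVolumetricEnergy h) (hl0 : 0 < l) (hl : l ≤ vc)
    (S : IsFieldSolution l vc qs lam rl) {r : ℝ → ℝ → ℝ}
    (hr : ∀ ε ∈ Ioo (0 : ℝ) 1, IsGlobalMinimizer (m + 1) κ h lam ε (r ε)) :
    PuncturedUniformLimit r rl := by
  unfold PuncturedUniformLimit
  rw [ENNReal.tendsto_nhds_zero]
  intro η hη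
  -- an upper bound for the supremum which is a real number
  obtain ⟨η', hη'0, hη'⟩ : ∃ η' : ℝ, 0 < η' ∧ ENNReal.ofReal η' ≤ η := by
    rcases eq_or_ne η ⊤ with rfl | htop
    · exact ⟨1, one_pos, le_top⟩
    · exact ⟨η.toReal, ENNReal.toReal_pos hη.ne' htop, (ENNReal.ofReal_toReal htop).le⟩
  obtain ⟨μ, hμ, ε₀, hε₀, H⟩ := F.uniformly_close hm hκ hh hl0 hl S hη'0
  obtain ⟨C, hC0, hC⟩ := F.exists_abs_boundary_le hm hκ hh hl0 hl lam
    (show 0 < μ / 4 by positivity)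
  have hlim : Tendsto (fun ε : ℝ => 2 * (μ / 4 + C * ε ^ (m + 1))) (𝓝[>] 0) (𝓝 (μ / 2)) := by
    have : Continuous fun ε : ℝ => 2 * (μ / 4 + C * ε ^ (m + 1)) := by fun_prop
    have h1 := (this.tendsto 0).mono_left (nhdsWithin_le_nhds (s := Ioi 0))
    convert h1 using 2
    simp
    ring
  filter_upwards [hlim.eventually_lt_const (half_lt_self hμ),
    Ioo_mem_nhdsGT (show (0 : ℝ) < min ε₀ 1 by positivity)] with ε h1 h2
  have hε : ε ∈ Ioo (0 : ℝ) 1 := ⟨h2.1, h2.2.trans_le (min_le_right _ _)⟩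
  have h3 := H ε (r ε) hε.1.le (h2.2.trans_le (min_le_left _ _)) (hr ε hε).1 fun a ha => by
    obtain ⟨h4, h5⟩ := F.integral_excess_le_of_isGlobalMinimizer hm hκ hh hl0 hl S hC
      ⟨hε.1.le, hε.2⟩ (hr ε hε) ha
    exact ⟨h4, h5.trans h1.le⟩
  exact (iSup₂_le fun R hR => ENNReal.ofReal_le_ofReal (h3 R hR)).trans hη'

theorem isFieldSolution_homogeneous (hle : lam ≤ vc) :
    IsFieldSolution lam vc qs lam (fun R => lam * R) where
  continuousOn := by fun_prop
  zero_nonneg := by simp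
  one := by simp
  le_stretch R hR := by rw [mul_div_cancel_right₀ _ hR.1.ne']
  hasDerivAt R hR := by
    rw [mul_div_cancel_right₀ _ hR.1.ne', fieldSlope, if_pos hle]
    simpa using (hasDerivAt_id R).const_mul lam

end IsCavityField

/-! ### Existence of the field of cavitating extremals -/

/-- The Cauchy stress as a function of `x = r' / (r / R)` and `z = (r / R) ^ (-n)`.  In the variable
`z` the condition `T → 0` at infinite hoop stretch is an initial condition at `z = 0`. -/
noncomputable def ratioStress (m : ℕ) (κ : ℝ) (h : ℝ → ℝ) (x z : ℝ) : ℝ :=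
  κ * x ^ m + deriv h (x / z) + m * κ / (m + 1) * (1 - Real.log z)

theorem stress_eq_ratioStress {v : ℝ} (hv : 0 < v) (x : ℝ) :
    stress m κ h (v * x) v = ratioStress m κ h x ((v ^ (m + 1))⁻¹) := by
  have hm : ((m : ℝ) + 1) ≠ 0 := by positivity
  unfold stress ratioStress
  rw [mul_div_cancel_left₀ _ hv.ne', Real.log_inv, Real.log_pow, div_inv_eq_mul]
  have e : v * x * v ^ m = x * v ^ (m + 1) := by ring
  rw [e]
  push_cast
  field_simp
  ring

theorem ratioStress_lt (hκ : 0 < κ) (hh : IsVolumetricEnergy h) {x y z : ℝ} (hz : 0 < z)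
    (hx : 0 < x) (hxy : x < y) : ratioStress m κ h x z < ratioStress m κ h y z := by
  unfold ratioStress
  have hy := hx.trans hxy
  have h1 : deriv h (x / z) < deriv h (y / z) :=
    (deriv_vol_lt_iff hh (by positivity) (by positivity)).2 (by gcongr)
  have h2 : κ * x ^ m ≤ κ * y ^ m := by gcongr
  linarith

theorem ratioStress_lt_iff (hκ : 0 < κ) (hh : IsVolumetricEnergy h) {x y z : ℝ} (hz : 0 < z)
    (hx : 0 < x) (hy : 0 < y) : ratioStress m κ h x z < ratioStress m κ h y z ↔ x < y :=
  StrictMonoOn.lt_iff_lt (f := fun x => ratioStress m κ h x z) (s := Ioi 0)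
    (fun _ ha _ _ hab => ratioStress_lt hκ hh hz ha hab) hx hy

theorem continuousAt_ratioStress (hh : IsVolumetricEnergy h) {x z : ℝ} (hx : 0 < x) (hz : 0 < z) :
    ContinuousAt (fun p : ℝ × ℝ => ratioStress m κ h p.1 p.2) (x, z) := by
  unfold ratioStress
  have h1 : ContinuousAt (fun p : ℝ × ℝ => deriv h (p.1 / p.2)) (x, z) :=
    ContinuousAt.comp_of_eq (hasDerivAt_deriv_vol hh (div_pos hx hz)).continuousAt
      (continuousAt_fst.div continuousAt_snd hz.ne') rfl
  have h2 : ContinuousAt (fun p : ℝ × ℝ => Real.log p.2) (x, z) :=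
    continuousAt_snd.log hz.ne'
  fun_prop

theorem exists_ratioStress_eq (hκ : 0 < κ) (hh : IsVolumetricEnergy h) {z : ℝ} (hz : 0 < z)
    (T : ℝ) : ∃ x, 0 < x ∧ ratioStress m κ h x z = T := by
  set c := m * κ / (m + 1) * (1 - Real.log z) with hc
  have h1 : Tendsto (fun x : ℝ => x / z) (𝓝[>] 0) (𝓝[>] 0) := by
    refine tendsto_nhdsWithin_iff.2 ⟨?_, ?_⟩
    · have : Continuous fun x : ℝ => x / z := by fun_prop
      simpa using (this.tendsto 0).mono_left (nhdsWithin_le_nhds (s := Ioi 0))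
    · filter_upwards [self_mem_nhdsWithin] with x hx
      exact div_pos hx hz
  obtain ⟨x₁, ⟨hx₁, hx₁'⟩⟩ := (((hh.deriv_tendsto_zero.comp h1).eventually_le_atBot
    (T - c - κ)).and (Ioo_mem_nhdsGT (zero_lt_one (α := ℝ)))).exists
  obtain ⟨x₂, ⟨hx₂, hx₂'⟩⟩ := (((hh.deriv_tendsto_top.comp
    (tendsto_id.atTop_div_const hz)).eventually_ge_atTop (T - c)).and
    (eventually_gt_atTop 0)).exists
  simp only [Function.comp, id] at hx₁ hx₂
  have hcont : ContinuousOn (fun x => ratioStress m κ h x z) (Ioi 0) := fun x hx =>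
    (ContinuousAt.comp (f := fun x : ℝ => (x, z)) (g := fun p : ℝ × ℝ => ratioStress m κ h p.1 p.2)
      (continuousAt_ratioStress hh hx hz)
      (by fun_prop : Continuous fun x : ℝ => (x, z)).continuousAt).continuousWithinAt
  obtain ⟨x, hx, hxT⟩ := isPreconnected_Ioi.intermediate_value (f := fun x => ratioStress m κ h x z)
    (show x₁ ∈ Ioi (0 : ℝ) from hx₁'.1) (show x₂ ∈ Ioi (0 : ℝ) from hx₂') hcont
    (show T ∈ Icc _ _ from ⟨by
      have : κ * x₁ ^ m ≤ κ := by
        have := pow_le_one₀ (n := m) hx₁'.1.le hx₁'.2.le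
        nlinarith
      simp only [ratioStress, ← hc]
      linarith, by
      have : 0 ≤ κ * x₂ ^ m := by positivity
      simp only [ratioStress, ← hc]
      linarith⟩)
  exact ⟨x, hx, hxT⟩

/-- The ratio `x` determined by `z` and the Cauchy stress `T`. -/
noncomputable def stretchRatio (m : ℕ) (κ : ℝ) (h : ℝ → ℝ) (z T : ℝ) : ℝ :=
  Classical.epsilon fun x => 0 < x ∧ ratioStress m κ h x z = T

theorem stretchRatio_pos (hκ : 0 < κ) (hh : IsVolumetricEnergy h) {z : ℝ} (hz : 0 < z) (T : ℝ) :
    0 < stretchRatio m κ h z T :=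
  (Classical.epsilon_spec (exists_ratioStress_eq (m := m) hκ hh hz T)).1

theorem ratioStress_stretchRatio (hκ : 0 < κ) (hh : IsVolumetricEnergy h) {z : ℝ} (hz : 0 < z)
    (T : ℝ) : ratioStress m κ h (stretchRatio m κ h z T) z = T :=
  (Classical.epsilon_spec (exists_ratioStress_eq (m := m) hκ hh hz T)).2

theorem lt_stretchRatio_iff (hκ : 0 < κ) (hh : IsVolumetricEnergy h) {z T c : ℝ} (hz : 0 < z)
    (hc : 0 < c) : c < stretchRatio m κ h z T ↔ ratioStress m κ h c z < T := by
  rw [← ratioStress_lt_iff (m := m) hκ hh hz hc (stretchRatio_pos hκ hh hz T),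
    ratioStress_stretchRatio hκ hh hz]

theorem stretchRatio_lt_iff (hκ : 0 < κ) (hh : IsVolumetricEnergy h) {z T c : ℝ} (hz : 0 < z)
    (hc : 0 < c) : stretchRatio m κ h z T < c ↔ T < ratioStress m κ h c z := by
  rw [← ratioStress_lt_iff (m := m) hκ hh hz (stretchRatio_pos hκ hh hz T) hc,
    ratioStress_stretchRatio hκ hh hz]

theorem stretchRatio_mono (hκ : 0 < κ) (hh : IsVolumetricEnergy h) {z T S : ℝ} (hz : 0 < z)
    (hTS : T ≤ S) : stretchRatio m κ h z T ≤ stretchRatio m κ h z S := by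
  have hS := stretchRatio_pos (m := m) hκ hh hz S
  by_contra! hlt
  rw [lt_stretchRatio_iff hκ hh hz hS, ratioStress_stretchRatio hκ hh hz] at hlt
  linarith

theorem continuousAt_stretchRatio (hκ : 0 < κ) (hh : IsVolumetricEnergy h) {z T : ℝ}
    (hz : 0 < z) : ContinuousAt (fun p : ℝ × ℝ => stretchRatio m κ h p.1 p.2) (z, T) := by
  have hpos : ∀ᶠ p : ℝ × ℝ in 𝓝 (z, T), 0 < p.1 := continuousAt_fst.eventually (lt_mem_nhds hz)
  have hc : ∀ c, 0 < c → ContinuousAt (fun p : ℝ × ℝ => ratioStress m κ h c p.1 - p.2) (z, T) :=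
    fun c hc => ((continuousAt_ratioStress hh hc hz).comp_of_eq
      (f := fun p : ℝ × ℝ => (c, p.1)) (by fun_prop) rfl).sub continuousAt_snd
  refine tendsto_order.2 ⟨fun c hcX => ?_, fun c hcX => ?_⟩
  · rcases le_or_gt c 0 with h0 | h0
    · filter_upwards [hpos] with p hp
      exact h0.trans_lt (stretchRatio_pos hκ hh hp _)
    · have h1 := (lt_stretchRatio_iff hκ hh hz h0).1 hcX
      filter_upwards [hpos, (hc c h0).eventually (gt_mem_nhds (sub_neg.2 h1))] with p hp hp'
      exact (lt_stretchRatio_iff hκ hh hp h0).2 (sub_neg.1 hp')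
  · have h0 : 0 < c := (stretchRatio_pos hκ hh hz T).trans hcX
    have h1 := (stretchRatio_lt_iff hκ hh hz h0).1 hcX
    filter_upwards [hpos, (hc c h0).eventually (lt_mem_nhds (sub_pos.2 h1))] with p hp hp'
    exact (stretchRatio_lt_iff hκ hh hp h0).2 (sub_pos.1 hp')

/-- The right-hand side of the equilibrium equation `dT/dz = stressGrowth z T`; the ratio `x` is
truncated at its value `1` in homogeneous states. -/
noncomputable def stressGrowth (m : ℕ) (κ : ℝ) (h : ℝ → ℝ) (z T : ℝ) : ℝ :=
  stressDecay m κ (min (stretchRatio m κ h z T) 1) / ((m + 1) * z)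

theorem stressDecay_mono (hκ : 0 < κ) {x y : ℝ} (hx : 0 ≤ x) (hxy : x ≤ y) :
    stressDecay m κ x ≤ stressDecay m κ y := by
  unfold stressDecay
  have h0 : 0 ≤ y := hx.trans hxy
  have h1 : ∑ i ∈ Finset.range m, x ^ i ≤ ∑ i ∈ Finset.range m, y ^ i :=
    Finset.sum_le_sum fun i _ => by gcongr
  have h2 : 0 ≤ ∑ i ∈ Finset.range m, x ^ i := Finset.sum_nonneg fun i _ => by positivity
  gcongr

theorem stressDecay_le (hκ : 0 < κ) {x : ℝ} (hx0 : 0 ≤ x) (hx1 : x ≤ 1) :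
    stressDecay m κ x ≤ κ * m * m * x := by
  have h1 : ∑ i ∈ Finset.range m, x ^ i ≤ m := by
    calc ∑ i ∈ Finset.range m, x ^ i ≤ ∑ i ∈ Finset.range m, (1 : ℝ) :=
          Finset.sum_le_sum fun i _ => pow_le_one₀ hx0 hx1
      _ = m := by simp
  unfold stressDecay
  calc κ * m * x * ∑ i ∈ Finset.range m, x ^ i ≤ κ * m * x * m := by gcongr
    _ = _ := by ring

theorem stressGrowth_nonneg (hκ : 0 < κ) (hh : IsVolumetricEnergy h) {z : ℝ} (hz : 0 < z) (T : ℝ) :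
    0 ≤ stressGrowth m κ h z T := by
  have h1 := stressDecay_nonneg (m := m) hκ
    (le_min (stretchRatio_pos (m := m) hκ hh hz T).le zero_le_one)
  unfold stressGrowth; positivity

theorem stressGrowth_mono (hκ : 0 < κ) (hh : IsVolumetricEnergy h) {z T S : ℝ} (hz : 0 < z)
    (hTS : T ≤ S) : stressGrowth m κ h z T ≤ stressGrowth m κ h z S := by
  unfold stressGrowth
  gcongr
  exact stressDecay_mono hκ (le_min (stretchRatio_pos hκ hh hz T).le zero_le_one)
    (min_le_min_right _ (stretchRatio_mono hκ hh hz hTS))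

theorem continuousAt_stressGrowth (hκ : 0 < κ) (hh : IsVolumetricEnergy h) {z T : ℝ}
    (hz : 0 < z) : ContinuousAt (fun p : ℝ × ℝ => stressGrowth m κ h p.1 p.2) (z, T) := by
  unfold stressGrowth
  have hm : (0 : ℝ) < m + 1 := by positivity
  refine ContinuousAt.div ?_ (by fun_prop) (mul_pos hm hz).ne'
  exact (continuous_stressDecay m κ).continuousAt.comp
    ((continuousAt_stretchRatio hκ hh hz).min continuousAt_const)

/-- A linear function of `z` is a supersolution of the equilibrium equation. -/
theorem exists_supersolution (hκ : 0 < κ) (hh : IsVolumetricEnergy h) :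
    ∃ M, 0 ≤ M ∧ ∀ z, 0 < z → ∀ T, T ≤ M * z → stressGrowth m κ h z T ≤ M := by
  obtain ⟨Δ, hΔ, hΔ1⟩ := ((hh.deriv_tendsto_top.eventually_ge_atTop (κ * m * m)).and
    (eventually_ge_atTop 1)).exists
  refine ⟨κ * m * m * Δ / (m + 1), by positivity, fun z hz T hT => ?_⟩
  have hX := stretchRatio_pos (m := m) hκ hh hz T
  have hmin : min (stretchRatio m κ h z T) 1 ≤ Δ * z := by
    rcases le_or_gt 1 (Δ * z) with h1 | h1
    · exact (min_le_right _ _).trans h1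
    · refine (min_le_left _ _).trans (not_lt.1 fun hlt => ?_)
      rw [lt_stretchRatio_iff hκ hh hz (by positivity)] at hlt
      unfold ratioStress at hlt
      rw [mul_div_cancel_right₀ _ hz.ne'] at hlt
      have hz1 : z ≤ 1 := by nlinarith
      have hlog : Real.log z ≤ 0 := Real.log_nonpos hz.le hz1
      have h2 : 0 ≤ m * κ / (m + 1) * (1 - Real.log z) := by
        have : 0 ≤ 1 - Real.log z := by linarith
        positivity
      have h3 : 0 ≤ κ * (Δ * z) ^ m := by positivity
      have h4 : κ * m * m * Δ / (m + 1) * z ≤ κ * m * m := by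
        have e : κ * m * m * Δ / (m + 1) * z = κ * m * m * ((Δ * z) / (m + 1)) := by ring
        rw [e]
        have h5 : (Δ * z) / (m + 1) ≤ 1 := by
          rw [div_le_one (by positivity)]
          have : (0 : ℝ) ≤ m := by positivity
          linarith
        have h6 : 0 ≤ κ * m * m := by positivity
        nlinarith
      linarith
  unfold stressGrowth
  rw [div_le_iff₀ (by positivity)]
  refine (stressDecay_le hκ (le_min hX.le zero_le_one) (min_le_right _ _)).trans ?_
  calc κ * m * m * min (stretchRatio m κ h z T) 1 ≤ κ * m * m * (Δ * z) := by gcongr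
    _ = _ := by field_simp

/-- Picard iteration for `dT/dz = stressGrowth z T`, `T(0) = 0`. -/
noncomputable def stressIter (m : ℕ) (κ : ℝ) (h : ℝ → ℝ) : ℕ → ℝ → ℝ
  | 0 => fun _ => 0
  | k + 1 => fun z => ∫ w in (0 : ℝ)..z, stressGrowth m κ h w (stressIter m κ h k w)

theorem intervalIntegrable_of_bounded {φ : ℝ → ℝ} {M z : ℝ} (hφ : ContinuousOn φ (Ioi 0))
    (hb : ∀ w, 0 < w → |φ w| ≤ M) (hz : 0 ≤ z) : IntervalIntegrable φ volume 0 z := by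
  rw [intervalIntegrable_iff_integrableOn_Ioc_of_le hz]
  have h1 : IntegrableOn (fun _ : ℝ => M) (Ioc 0 z) volume := integrableOn_const (by simp)
  refine h1.mono' ((hφ.mono fun x hx => hx.1).aestronglyMeasurable measurableSet_Ioc) ?_
  exact (ae_restrict_iff' measurableSet_Ioc).2 (Eventually.of_forall fun w hw => hb w hw.1)

theorem stressIter_spec (hκ : 0 < κ) (hh : IsVolumetricEnergy h) {M : ℝ} (hM0 : 0 ≤ M)
    (hM : ∀ z, 0 < z → ∀ T, T ≤ M * z → stressGrowth m κ h z T ≤ M) (k : ℕ) :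
    (∀ z, 0 < z → 0 ≤ stressIter m κ h k z ∧ stressIter m κ h k z ≤ M * z) ∧
    ∀ z, 0 < z → ∀ w, 0 < w → |stressIter m κ h k z - stressIter m κ h k w| ≤ M * |z - w| := by
  induction k with
  | zero =>
    refine ⟨fun z hz => ⟨le_rfl, ?_⟩, fun z _ w _ => ?_⟩
    · simp only [stressIter]; positivity
    · simp only [stressIter, sub_self, abs_zero]; positivity
  | succ k ih =>
    have hcont : ContinuousOn (fun w => stressGrowth m κ h w (stressIter m κ h k w)) (Ioi 0) := by
      intro w hw
      have h1 : ContinuousAt (stressIter m κ h k) w := by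
        refine ContinuousOn.continuousAt (s := Ioi 0) ?_ (Ioi_mem_nhds hw)
        exact (LipschitzOnWith.of_dist_le_mul (K := ⟨M, hM0⟩) fun a ha b hb =>
          ih.2 a ha b hb).continuousOn
      exact ((continuousAt_stressGrowth hκ hh hw).comp_of_eq
        (f := fun w => (w, stressIter m κ h k w)) (continuousAt_id.prodMk h1)
        rfl).continuousWithinAt
    have hnn : ∀ w, 0 < w → 0 ≤ stressGrowth m κ h w (stressIter m κ h k w) := fun w hw =>
      stressGrowth_nonneg hκ hh hw _
    have hle : ∀ w, 0 < w → stressGrowth m κ h w (stressIter m κ h k w) ≤ M := fun w hw =>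
      hM w hw _ (ih.1 w hw).2
    have habs : ∀ w, 0 < w → |stressGrowth m κ h w (stressIter m κ h k w)| ≤ M := fun w hw => by
      rw [abs_of_nonneg (hnn w hw)]; exact hle w hw
    have hint : ∀ z, 0 < z → IntervalIntegrable
        (fun w => stressGrowth m κ h w (stressIter m κ h k w)) volume 0 z := fun z hz =>
      intervalIntegrable_of_bounded hcont habs hz.le
    have hlip : ∀ z, 0 < z → ∀ w, 0 < w →
        |stressIter m κ h (k + 1) z - stressIter m κ h (k + 1) w| ≤ M * |z - w| := by
      intro z hz w hw
      simp only [stressIter]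
      rw [intervalIntegral.integral_interval_sub_left (hint z hz) (hint w hw)]
      refine intervalIntegral.norm_integral_le_of_norm_le_const (C := M)
        (f := fun w => stressGrowth m κ h w (stressIter m κ h k w)) fun x hx => habs x ?_
      exact (lt_min hw hz).trans hx.1
    refine ⟨fun z hz => ⟨?_, ?_⟩, hlip⟩
    · simp only [stressIter]
      rw [intervalIntegral.integral_of_le hz.le]
      exact setIntegral_nonneg measurableSet_Ioc fun w hw => hnn w hw.1
    · simp only [stressIter]
      have h1 := intervalIntegral.norm_integral_le_of_norm_le_const (a := 0) (b := z) (C := M)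
        (f := fun w => stressGrowth m κ h w (stressIter m κ h k w)) fun w hw => habs w (by
          rw [uIoc_of_le hz.le] at hw; exact hw.1)
      rw [sub_zero, abs_of_pos hz] at h1
      exact (le_abs_self _).trans h1

theorem continuousOn_stressGrowth_comp (hκ : 0 < κ) (hh : IsVolumetricEnergy h) {M : ℝ}
    (hM0 : 0 ≤ M) {T : ℝ → ℝ} (hT : ∀ z, 0 < z → ∀ w, 0 < w → |T z - T w| ≤ M * |z - w|) :
    ContinuousOn (fun w => stressGrowth m κ h w (T w)) (Ioi 0) := by
  intro w hw
  have h1 : ContinuousAt T w := by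
    refine ContinuousOn.continuousAt (s := Ioi 0) ?_ (Ioi_mem_nhds hw)
    exact (LipschitzOnWith.of_dist_le_mul (K := ⟨M, hM0⟩)
      fun a ha b hb => hT a ha b hb).continuousOn
  exact ((continuousAt_stressGrowth hκ hh hw).comp_of_eq
    (f := fun w => (w, T w)) (continuousAt_id.prodMk h1) rfl).continuousWithinAt

/-- The equilibrium equation for the stress has a solution which vanishes at `z = 0`.  The right
side is monotone but not uniformly Lipschitz in `T` near `z = 0`, so the solution is found as the
limit of a monotone iteration below the supersolution. -/
theorem exists_stress_solution (hκ : 0 < κ) (hh : IsVolumetricEnergy h) :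
    ∃ (T : ℝ → ℝ) (M : ℝ), (∀ z, 0 < z → 0 ≤ T z ∧ T z ≤ M * z) ∧
      ∀ z, 0 < z → HasDerivAt T (stressGrowth m κ h z (T z)) z := by
  obtain ⟨M, hM0, hM⟩ := exists_supersolution (m := m) hκ hh
  have hspec := stressIter_spec hκ hh hM0 hM
  have hbd : ∀ z, 0 < z → ∀ k, |stressGrowth m κ h z (stressIter m κ h k z)| ≤ M :=
    fun z hz k => by
      rw [abs_of_nonneg (stressGrowth_nonneg hκ hh hz _)]
      exact hM z hz _ ((hspec k).1 z hz).2
  have hint : ∀ k z, 0 < z → IntervalIntegrable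
      (fun w => stressGrowth m κ h w (stressIter m κ h k w)) volume 0 z := fun k z hz =>
    intervalIntegrable_of_bounded (continuousOn_stressGrowth_comp hκ hh hM0 (hspec k).2)
      (fun w hw => hbd w hw k) hz.le
  have hmono : ∀ k z, 0 < z → stressIter m κ h k z ≤ stressIter m κ h (k + 1) z := by
    intro k
    induction k with
    | zero => exact fun z hz => ((hspec 1).1 z hz).1
    | succ k ih =>
      intro z hz
      change ∫ w in (0 : ℝ)..z, _ ≤ ∫ w in (0 : ℝ)..z, _
      refine intervalIntegral_le_of_ae hz.le (hint k z hz) (hint (k + 1) z hz)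
        (Eventually.of_forall fun w hw => stressGrowth_mono hκ hh hw.1 (ih w hw.1))
  set T : ℝ → ℝ := fun z => ⨆ k, stressIter m κ h k z with hT
  have hlim : ∀ z, 0 < z → Tendsto (fun k => stressIter m κ h k z) atTop (𝓝 (T z)) := fun z hz =>
    tendsto_atTop_ciSup (monotone_nat_of_le_succ fun k => hmono k z hz)
      ⟨M * z, by rintro _ ⟨k, rfl⟩; exact ((hspec k).1 z hz).2⟩
  have hT1 : ∀ z, 0 < z → 0 ≤ T z ∧ T z ≤ M * z := fun z hz =>
    ⟨ge_of_tendsto' (hlim z hz) fun k => ((hspec k).1 z hz).1,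
      le_of_tendsto' (hlim z hz) fun k => ((hspec k).1 z hz).2⟩
  have hT2 : ∀ z, 0 < z → ∀ w, 0 < w → |T z - T w| ≤ M * |z - w| := fun z hz w hw =>
    le_of_tendsto' ((hlim z hz).sub (hlim w hw)).abs fun k => (hspec k).2 z hz w hw
  have hgc := continuousOn_stressGrowth_comp (m := m) hκ hh hM0 hT2
  have hgb : ∀ w, 0 < w → |stressGrowth m κ h w (T w)| ≤ M := fun w hw => by
    rw [abs_of_nonneg (stressGrowth_nonneg hκ hh hw _)]
    exact hM w hw _ (hT1 w hw).2
  have hTeq : ∀ z, 0 < z → T z = ∫ w in (0 : ℝ)..z, stressGrowth m κ h w (T w) := by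
    intro z hz
    have h1 := (hlim z hz).comp (tendsto_add_atTop_nat 1)
    refine tendsto_nhds_unique h1 ?_
    change Tendsto (fun k => ∫ w in (0 : ℝ)..z, stressGrowth m κ h w (stressIter m κ h k w)) _ _
    refine intervalIntegral.tendsto_integral_filter_of_dominated_convergence (fun _ => M)
      (Eventually.of_forall fun k => by
        rw [uIoc_of_le hz.le]; exact (hint k z hz).1.aestronglyMeasurable)
      (Eventually.of_forall fun k => Eventually.of_forall fun w hw => ?_)
      intervalIntegrable_const (Eventually.of_forall fun w hw => ?_)
    · rw [uIoc_of_le hz.le] at hw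
      exact hbd w hw.1 k
    · rw [uIoc_of_le hz.le] at hw
      exact (ContinuousAt.comp_of_eq (continuousAt_stressGrowth hκ hh hw.1)
        (f := fun T => (w, T)) (by fun_prop : Continuous fun T : ℝ => (w, T)).continuousAt
        rfl).tendsto.comp (hlim w hw.1)
  refine ⟨T, M, hT1, fun z hz => ?_⟩
  have h1 := intervalIntegral.integral_hasDerivAt_right
    (intervalIntegrable_of_bounded hgc hgb hz.le)
    (hgc.stronglyMeasurableAtFilter isOpen_Ioi z hz) (hgc.continuousAt (Ioi_mem_nhds hz))
  exact h1.congr_of_eventuallyEq ((lt_mem_nhds hz).mono fun w hw => hTeq w hw)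

/-- The cavitating stress meets the stress of homogeneous states: the former increases with `z` from
`0`, while the latter decreases from `∞` to `-∞`. -/
theorem exists_crossing (hκ : 0 < κ) (hh : IsVolumetricEnergy h) {T : ℝ → ℝ} {M : ℝ}
    (hT1 : ∀ z, 0 < z → 0 ≤ T z ∧ T z ≤ M * z)
    (hT2 : ∀ z, 0 < z → HasDerivAt T (stressGrowth m κ h z (T z)) z) :
    ∃ zc, 0 < zc ∧ T zc = ratioStress m κ h 1 zc ∧
      ∀ z, 0 < z → z < zc → T z < ratioStress m κ h 1 z := by
  have hTc : ContinuousOn T (Ioi 0) := fun z hz => (hT2 z hz).continuousAt.continuousWithinAt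
  have hTm : MonotoneOn T (Ioi 0) := by
    refine monotoneOn_of_hasDerivWithinAt_nonneg (convex_Ioi 0) hTc
      (fun z hz => (hT2 z (interior_subset hz)).hasDerivWithinAt) fun z hz => ?_
    exact stressGrowth_nonneg hκ hh (interior_subset hz) _
  have hGc : ContinuousOn (fun z => ratioStress m κ h 1 z) (Ioi 0) := fun z hz =>
    (ContinuousAt.comp_of_eq (continuousAt_ratioStress hh one_pos hz)
      (f := fun z : ℝ => ((1 : ℝ), z))
      (by fun_prop : Continuous fun z : ℝ => ((1 : ℝ), z)).continuousAt
      rfl).continuousWithinAt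
  have hinv : Tendsto (fun z : ℝ => 1 / z) (𝓝[>] 0) atTop := by
    simpa using tendsto_inv_nhdsGT_zero (𝕜 := ℝ)
  have hmk : 0 ≤ m * κ / (m + 1) := by positivity
  obtain ⟨z₁, h1, h2, h2'⟩ := ((hh.deriv_tendsto_top.comp hinv).eventually_ge_atTop |M| |>.and
    (Ioo_mem_nhdsGT (zero_lt_one (α := ℝ)))).exists
  have hz₁ : T z₁ ≤ ratioStress m κ h 1 z₁ := by
    have h3 := (hT1 z₁ h2).2
    have h4 : Real.log z₁ ≤ 0 := Real.log_nonpos h2.le h2'.le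
    have h5 : 0 ≤ m * κ / (m + 1) * (1 - Real.log z₁) := mul_nonneg hmk (by linarith)
    have h6 : M * z₁ ≤ |M| := by nlinarith [le_abs_self M, abs_nonneg M]
    simp only [Function.comp] at h1
    simp only [ratioStress, one_pow]
    linarith
  have hinv' : Tendsto (fun z : ℝ => 1 / z) atTop (𝓝[>] 0) := by
    simpa using tendsto_inv_atTop_nhdsGT_zero (𝕜 := ℝ)
  obtain ⟨z₂, h3, h4⟩ := ((hh.deriv_tendsto_zero.comp hinv').eventually_le_atBot
    (-κ - m * κ / (m + 1)) |>.and (eventually_ge_atTop 1)).exists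
  have h4' : 0 < z₂ := by linarith
  have hz₂ : ratioStress m κ h 1 z₂ ≤ T z₂ := by
    have h5 := (hT1 z₂ h4').1
    have h6 : 0 ≤ m * κ / (m + 1) * Real.log z₂ := mul_nonneg hmk (Real.log_nonneg h4)
    simp only [Function.comp] at h3
    simp only [ratioStress, one_pow]
    linarith
  obtain ⟨zc, hzc, hzc'⟩ := isPreconnected_Ioi.intermediate_value₂ (show z₁ ∈ Ioi (0 : ℝ) from h2)
    (show z₂ ∈ Ioi (0 : ℝ) from h4') hTc hGc hz₁ hz₂
  refine ⟨zc, hzc, hzc', fun z hz hlt => ?_⟩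
  have h5 := hTm hz hzc hlt.le
  have h6 : deriv h (1 / zc) < deriv h (1 / z) :=
    (deriv_vol_lt_iff hh (one_div_pos.2 hzc) (one_div_pos.2 hz)).2 (one_div_lt_one_div_of_lt hz hlt)
  have h7 : m * κ / (m + 1) * (1 - Real.log zc) ≤ m * κ / (m + 1) * (1 - Real.log z) := by
    have := Real.log_le_log hz hlt.le
    gcongr
  simp only [ratioStress, one_pow] at hzc' ⊢
  linarith

/-- The field is the solution of `exists_stress_solution` in the variable `v = z ^ (-1 / n)`; the
truncation of `x` at `1` is inactive before the crossing, that is, for `v ≥ vc`. -/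
theorem exists_isCavityField (hκ : 0 < κ) (hh : IsVolumetricEnergy h) :
    ∃ vc T qs, IsCavityField m κ h vc T qs := by
  obtain ⟨T, M, hT1, hT2⟩ := exists_stress_solution (m := m) hκ hh
  obtain ⟨zc, hzc, hzcT, hzlt⟩ := exists_crossing hκ hh hT1 hT2
  set vc : ℝ := (zc⁻¹) ^ (((m + 1 : ℕ) : ℝ)⁻¹) with hvc
  have hvc0 : 0 < vc := Real.rpow_pos_of_pos (inv_pos.2 hzc) _
  have hvcz : (vc ^ (m + 1))⁻¹ = zc := by
    rw [hvc, Real.rpow_inv_natCast_pow (inv_pos.2 hzc).le (Nat.succ_ne_zero m), inv_inv]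
  set Z : ℝ → ℝ := fun v => (v ^ (m + 1))⁻¹ with hZ
  have hZ0 : ∀ v, 0 < v → 0 < Z v := fun v hv => by simp only [hZ]; positivity
  have hZd : ∀ v, 0 < v → HasDerivAt Z (-((m + 1) * Z v / v)) v := fun v hv => by
    refine ((hasDerivAt_pow (m + 1) v).inv (by positivity)).congr_deriv ?_
    simp only [hZ, Nat.add_sub_cancel]
    push_cast
    field_simp
    ring
  set X : ℝ → ℝ := fun v => stretchRatio m κ h (Z v) (T (Z v)) with hX
  have hX0 : ∀ v, 0 < v → 0 < X v := fun v hv => stretchRatio_pos hκ hh (hZ0 v hv) _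
  have hXvc : X vc = 1 := by
    have h1 := ratioStress_stretchRatio (m := m) hκ hh hzc (T zc)
    have h2 : stretchRatio m κ h zc (T zc) = 1 := by
      apply le_antisymm
      · by_contra! hcon
        rw [lt_stretchRatio_iff hκ hh hzc one_pos, hzcT] at hcon
        exact lt_irrefl _ hcon
      · by_contra! hcon
        rw [stretchRatio_lt_iff hκ hh hzc one_pos, hzcT] at hcon
        exact lt_irrefl _ hcon
    simp only [hX, hZ, hvcz, h2]
  have hXlt : ∀ v, vc < v → X v < 1 := fun v hv => by
    have hv0 := hvc0.trans hv
    refine (stretchRatio_lt_iff hκ hh (hZ0 v hv0) one_pos).2 (hzlt _ (hZ0 v hv0) ?_)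
    rw [← hvcz]
    simp only [hZ]
    gcongr
  refine ⟨vc, fun v => T (Z v), fun v => v * X v, ?_⟩
  constructor
  · exact hvc0
  · exact fun v hv => mul_pos hv (hX0 v hv)
  · rw [hXvc, mul_one]
  · intro v hv
    have := hXlt v hv
    have hv0 := hvc0.trans hv
    nlinarith
  · intro v hv
    have h1 := (hZd v hv).continuousAt
    have h2 : ContinuousAt (fun v => T (Z v)) v :=
      ContinuousAt.comp_of_eq (hT2 _ (hZ0 v hv)).continuousAt h1 rfl
    exact continuousAt_id.mul (ContinuousAt.comp_of_eq
      (g := fun p : ℝ × ℝ => stretchRatio m κ h p.1 p.2) (f := fun v => (Z v, T (Z v)))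
      (continuousAt_stretchRatio hκ hh (hZ0 v hv)) (h1.prodMk h2) rfl)
  · intro v hv
    rw [stress_eq_ratioStress hv]
    exact (ratioStress_stretchRatio hκ hh (hZ0 v hv) _).symm
  · intro v hv
    have hv0 := hvc0.trans_le hv
    have hXle : X v ≤ 1 := by
      rcases hv.eq_or_lt with rfl | hlt
      · exact hXvc.le
      · exact (hXlt v hlt).le
    refine (HasDerivAt.comp (h := Z) v (hT2 _ (hZ0 v hv0)) (hZd v hv0)).congr_deriv ?_
    have hZv := hZ0 v hv0
    rw [stressGrowth, min_eq_left hXle, mul_div_cancel_left₀ _ hv0.ne']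
    field_simp
  · have h1 : Tendsto Z atTop (𝓝 0) :=
      tendsto_inv_atTop_zero.comp (tendsto_pow_atTop (Nat.succ_ne_zero m))
    have h2 : Tendsto (fun v => M * Z v) atTop (𝓝 0) := by simpa using h1.const_mul M
    refine tendsto_of_tendsto_of_tendsto_of_le_of_le' tendsto_const_nhds h2 ?_ ?_
    · filter_upwards [eventually_gt_atTop 0] with v hv
      exact (hT1 _ (hZ0 v hv)).1
    · filter_upwards [eventually_gt_atTop 0] with v hv
      exact (hT1 _ (hZ0 v hv)).2

/-! ### The cavitating solution -/

theorem modPhi₁_eq_stress {q v : ℝ} (hv : 0 < v) :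
    modPhi₁ (m + 1) κ h q v = v ^ m * stress m κ h q v := by
  rw [modPhi₁, stress, Nat.add_sub_cancel, div_pow]
  push_cast
  field_simp
  ring

theorem modPhi₂_eq_stress (q v : ℝ) : modPhi₂ (m + 1) κ h q v
    = q * v ^ (m - 1) * (stress m κ h q v + κ - κ * (q / v) ^ m) := by
  rw [modPhi₂, stress, Nat.add_sub_cancel, show m + 1 - 2 = m - 1 by omega]
  push_cast
  ring

theorem modCauchyStress_eq_stress {q v : ℝ} (hv : 0 < v) :
    modCauchyStress (m + 1) κ h q v = stress m κ h q v := by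
  rw [modCauchyStress, modPhi₁_eq_stress hv, Nat.add_sub_cancel]
  field_simp

namespace IsCavityField

variable {vc : ℝ} {T qs : ℝ → ℝ}

/-- The autonomous equation for the hoop stretch in the variable `s = - log R`, solved by separation
of variables after the substitution `v = vc + exp w`, which moves the rest point `vc` to `-∞`. -/
theorem exists_hoopStretch_log (F : IsCavityField m κ h vc T qs) (hm : 1 ≤ m) (hκ : 0 < κ)
    (hh : IsVolumetricEnergy h) :
    ∃ W : ℝ → ℝ, (∀ s, HasDerivAt W ((vc + Real.exp (W s) - qs (vc + Real.exp (W s)))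
      / Real.exp (W s)) s) ∧ Tendsto W atTop atTop ∧ Tendsto W atBot atBot := by
  have hvc := F.vc_pos
  set v : ℝ → ℝ := fun w => vc + Real.exp w with hv
  have hvlt : ∀ w, vc < v w := fun w => by simp only [hv]; linarith [Real.exp_pos w]
  have hv0 : ∀ w, 0 < v w := fun w => hvc.trans (hvlt w)
  have hvcont : Continuous v := by simp only [hv]; fun_prop
  have hg : ∀ w, 0 < v w - qs (v w) := fun w => sub_pos.2 (F.slope_lt _ (hvlt w))
  set φ : ℝ → ℝ := fun w => Real.exp w / (v w - qs (v w)) with hφ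
  have hφ0 : ∀ w, 0 < φ w := fun w => div_pos (Real.exp_pos w) (hg w)
  have hφc : Continuous φ := by
    refine Real.continuous_exp.div (hvcont.sub ?_) fun w => (hg w).ne'
    exact continuous_iff_continuousAt.2 fun w =>
      ContinuousAt.comp (g := qs) (F.continuousAt_slope _ (hv0 w)) hvcont.continuousAt
  -- near the rest point the travel time is infinite because the slope is Lipschitz
  obtain ⟨L, hL0, hL⟩ := F.exists_lipschitz_slope_Icc hm hκ hh (vc + 1)
  set c : ℝ := min (1 / (1 + vc)) (1 / (1 + L)) with hc
  have hc0 : 0 < c := by positivity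
  have hcφ : ∀ w, c ≤ φ w := by
    intro w
    have he := Real.exp_pos w
    rcases le_total 0 w with hw | hw
    · refine (min_le_left _ _).trans ?_
      have h1 : 1 ≤ Real.exp w := Real.one_le_exp hw
      have h2 := F.slope_pos _ (hv0 w)
      rw [div_le_div_iff₀ (by positivity) (hg w)]
      have : v w = vc + Real.exp w := rfl
      nlinarith
    · refine (min_le_right _ _).trans ?_
      have h1 : Real.exp w ≤ 1 := Real.exp_le_one_iff.2 hw
      have h2 := hL (v w) ⟨(hvlt w).le, by simp only [hv]; linarith⟩ vc ⟨le_rfl, by linarith⟩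
      rw [F.slope_vc] at h2
      have h3 := (abs_le.1 h2).1
      have h4 : v w - vc = Real.exp w := by simp only [hv]; ring
      rw [h4, abs_of_pos he] at h3
      rw [div_le_div_iff₀ (by positivity) (hg w)]
      have : v w = vc + Real.exp w := rfl
      nlinarith
  set σ : ℝ → ℝ := fun w => ∫ x in (0 : ℝ)..w, φ x with hσ
  have hσd : ∀ w, HasDerivAt σ (φ w) w := fun w =>
    intervalIntegral.integral_hasDerivAt_right (hφc.intervalIntegrable 0 w)
      hφc.stronglyMeasurable.stronglyMeasurableAtFilter hφc.continuousAt
  have hσc : Continuous σ := continuous_iff_continuousAt.2 fun w => (hσd w).continuousAt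
  have hσm : StrictMono σ := strictMono_of_deriv_pos fun w => by rw [(hσd w).deriv]; exact hφ0 w
  have hσl : Monotone fun w => σ w - c * w := by
    have hd : ∀ w, HasDerivAt (fun w => σ w - c * w) (φ w - c * 1) w := fun w =>
      (hσd w).sub ((hasDerivAt_id w).const_mul c)
    refine monotone_of_deriv_nonneg (fun w => (hd w).differentiableAt) fun w => ?_
    rw [(hd w).deriv]
    linarith [hcφ w]
  have hσ0 : σ 0 = 0 := by simp [hσ]
  have htop : Tendsto σ atTop atTop := by
    refine tendsto_atTop_mono' _ ?_ (tendsto_id.const_mul_atTop hc0)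
    filter_upwards [eventually_ge_atTop 0] with w hw
    have := hσl hw
    simp only [hσ0, id] at this ⊢
    linarith
  have hbot : Tendsto σ atBot atBot := by
    refine tendsto_atBot_mono' _ ?_ (tendsto_id.const_mul_atBot hc0)
    filter_upwards [eventually_le_atBot 0] with w hw
    have := hσl hw
    simp only [hσ0, id] at this ⊢
    linarith
  set e : ℝ ≃o ℝ := hσm.orderIsoOfSurjective σ (hσc.surjective htop hbot)
  have he : ∀ s, σ (e.symm s) = s := fun s => e.apply_symm_apply s
  refine ⟨e.symm, fun s => ?_, e.symm.tendsto_atTop, e.symm.tendsto_atBot⟩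
  refine (HasDerivAt.of_local_left_inverse e.symm.continuous.continuousAt (hσd _) (hφ0 _).ne'
    (Eventually.of_forall he)).congr_deriv ?_
  simp only [hφ, inv_div, hv]

/-- A cavitating solution of the slope field on the whole of `(0, ∞)`. -/
theorem exists_fieldCurve (F : IsCavityField m κ h vc T qs) (hm : 1 ≤ m) (hκ : 0 < κ)
    (hh : IsVolumetricEnergy h) :
    ∃ r : ℝ → ℝ, 0 < r 0 ∧ ContinuousWithinAt r (Ici 0) 0 ∧
      (∀ R, 0 < R → HasDerivAt r (qs (r R / R)) R) ∧ (∀ R, 0 < R → vc < r R / R) ∧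
      Tendsto (fun R => r R / R) atTop (𝓝 vc) ∧ Tendsto (fun R => r R / R) (𝓝[>] 0) atTop := by
  obtain ⟨W, hWd, hWtop, hWbot⟩ := F.exists_hoopStretch_log hm hκ hh
  set V : ℝ → ℝ := fun R => vc + Real.exp (W (-Real.log R)) with hV
  have hVlt : ∀ R, vc < V R := fun R => by simp only [hV]; linarith [Real.exp_pos (W (-Real.log R))]
  have hV0 : ∀ R, 0 < V R := fun R => F.vc_pos.trans (hVlt R)
  have hVd : ∀ R, 0 < R → HasDerivAt V ((qs (V R) - V R) / R) R := by
    intro R hR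
    have h1 := ((HasDerivAt.comp R (hWd (-Real.log R))
      (Real.hasDerivAt_log hR.ne').neg).exp).const_add vc
    refine h1.congr_deriv ?_
    have := Real.exp_pos (W (-Real.log R))
    simp only [hV, Function.comp, Pi.neg_apply]
    field_simp
    ring
  have hVtop : Tendsto V (𝓝[>] 0) atTop := by
    refine tendsto_atTop_add_const_left _ _ (Real.tendsto_exp_atTop.comp (hWtop.comp ?_))
    exact tendsto_neg_atBot_atTop.comp Real.tendsto_log_nhdsGT_zero
  have hVbot : Tendsto V atTop (𝓝 vc) := by
    have h1 := (Real.tendsto_exp_atBot.comp (hWbot.comp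
      (tendsto_neg_atTop_atBot.comp Real.tendsto_log_atTop))).const_add vc
    simpa using h1
  set f : ℝ → ℝ := fun R => R * V R with hf
  have hfd : ∀ R, 0 < R → HasDerivAt f (qs (V R)) R := by
    intro R hR
    refine ((hasDerivAt_id R).mul (hVd R hR)).congr_deriv ?_
    simp only [id]
    field_simp
    ring
  have hf0 : ∀ R, 0 < R → 0 < f R := fun R hR => mul_pos hR (hV0 R)
  have hfc : ContinuousOn f (Ioi 0) := fun R hR => (hfd R hR).continuousAt.continuousWithinAt
  have hfm : MonotoneOn f (Ioi 0) := by
    refine monotoneOn_of_hasDerivWithinAt_nonneg (convex_Ioi 0) hfc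
      (fun R hR => (hfd R (interior_subset hR)).hasDerivWithinAt) fun R _ => ?_
    exact (F.slope_pos _ (hV0 R)).le
  -- `f ^ n - M * R ^ n` decreases in `R` and is positive for some `R`, because `V → ∞` at the
  -- origin; hence the limit of `f` at the origin is positive.
  obtain ⟨M, hM⟩ := F.exists_volRatio_le hκ hh
  have hga : AntitoneOn (fun R => f R ^ (m + 1) - M * R ^ (m + 1)) (Ioi 0) := by
    have hd : ∀ R, 0 < R → HasDerivAt (fun R => f R ^ (m + 1) - M * R ^ (m + 1))
        ((m + 1) * R ^ m * (qs (V R) * V R ^ m - M)) R := by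
      intro R hR
      refine (((hfd R hR).pow (m + 1)).sub ((hasDerivAt_pow (m + 1) R).const_mul M)).congr_deriv ?_
      simp only [hf, Nat.add_sub_cancel, mul_pow]
      push_cast
      ring
    refine antitoneOn_of_hasDerivWithinAt_nonpos (convex_Ioi 0)
      (fun R hR => (hd R hR).continuousAt.continuousWithinAt)
      (fun R hR => (hd R (interior_subset hR)).hasDerivWithinAt) fun R hR => ?_
    have hR0 : 0 < R := interior_subset hR
    exact mul_nonpos_of_nonneg_of_nonpos (by positivity) (by linarith [hM _ (hVlt R).le])
  obtain ⟨R₀, hR₀, hR₀0⟩ := ((((tendsto_pow_atTop (Nat.succ_ne_zero m)).comp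
    hVtop).eventually_gt_atTop M).and self_mem_nhdsWithin).exists
  have hR₀0 : 0 < R₀ := hR₀0
  set δ := f R₀ ^ (m + 1) - M * R₀ ^ (m + 1) with hδ
  have hδ0 : 0 < δ := by
    have : δ = R₀ ^ (m + 1) * (V R₀ ^ (m + 1) - M) := by simp only [hδ, hf, mul_pow]; ring
    rw [this]
    exact mul_pos (by positivity) (sub_pos.2 hR₀)
  set L := sInf (f '' Ioi 0) with hLdef
  have hbdd : BddBelow (f '' Ioi 0) := ⟨0, by rintro _ ⟨R, hR, rfl⟩; exact (hf0 R hR).le⟩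
  have hlim : Tendsto f (𝓝[>] 0) (𝓝 L) := hfm.tendsto_nhdsGT hbdd
  have hM0 : 0 ≤ M := by
    have := F.slope_pos vc F.vc_pos
    have h2 := F.vc_pos
    exact le_trans (by positivity) (hM vc le_rfl)
  have hL0 : 0 ≤ L := ge_of_tendsto hlim (eventually_mem_nhdsWithin.mono fun R hR => (hf0 R hR).le)
  have hLδ : δ ≤ L ^ (m + 1) := by
    refine ge_of_tendsto (hlim.pow (m + 1)) ?_
    filter_upwards [Ioo_mem_nhdsGT hR₀0] with R hR
    have h1 := hga hR.1 hR₀0 hR.2.le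
    have h2 : 0 ≤ M * R ^ (m + 1) := mul_nonneg hM0 (pow_nonneg hR.1.le _)
    simp only at h1
    linarith
  have hLpos : 0 < L := by
    rcases hL0.eq_or_lt with h0 | h0
    · rw [← h0, zero_pow (Nat.succ_ne_zero m)] at hLδ
      linarith
    · exact h0
  set r : ℝ → ℝ := fun R => if R ≤ 0 then L else f R with hr
  have hrf : ∀ R, 0 < R → r R = f R := fun R hR => if_neg (not_le.2 hR)
  have hrV : ∀ R, 0 < R → r R / R = V R := fun R hR => by
    rw [hrf R hR, hf]; field_simp
  have hr0 : r 0 = L := if_pos le_rfl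
  refine ⟨r, hr0 ▸ hLpos, ?_, fun R hR => ?_, fun R hR => ?_, ?_, ?_⟩
  · rw [← continuousWithinAt_Ioi_iff_Ici, ContinuousWithinAt, hr0]
    exact hlim.congr' (eventually_mem_nhdsWithin.mono fun R hR => (hrf R hR).symm)
  · rw [hrV R hR]
    exact (hfd R hR).congr_of_eventuallyEq ((lt_mem_nhds hR).mono hrf)
  · rw [hrV R hR]; exact hVlt R
  · exact hVbot.congr' ((eventually_gt_atTop 0).mono fun R hR => (hrV R hR).symm)
  · exact hVtop.congr' (eventually_mem_nhdsWithin.mono fun R hR => (hrV R hR).symm)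

theorem isCavitatingSolution_fieldCurve (F : IsCavityField m κ h vc T qs) (hm : 1 ≤ m) {r : ℝ → ℝ}
    (hr0 : 0 < r 0) (hrc : ContinuousWithinAt r (Ici 0) 0)
    (hrd : ∀ R, 0 < R → HasDerivAt r (qs (r R / R)) R) (hrv : ∀ R, 0 < R → vc < r R / R)
    (hrtop : Tendsto (fun R => r R / R) (𝓝[>] 0) atTop) :
    IsCavitatingSolution (m + 1) κ h r := by
  have hder : ∀ R, 0 < R → deriv r R = qs (r R / R) := fun R hR => (hrd R hR).deriv
  have hv0 : ∀ R, 0 < R → 0 < r R / R := fun R hR => F.vc_pos.trans (hrv R hR)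
  have hvc : ContinuousOn (fun R => r R / R) (Ioi 0) := fun R hR =>
    (hasDerivAt_div_id hR (hrd R hR)).continuousAt.continuousWithinAt
  refine ⟨hr0, hrc, ?_, fun R hR => ?_, fun R hR => ?_, ?_⟩
  · rw [show (1 : WithTop ℕ∞) = 0 + 1 by simp, contDiffOn_succ_iff_deriv_of_isOpen isOpen_Ioi]
    refine ⟨fun R hR => (hrd R hR).differentiableAt.differentiableWithinAt, by simp, ?_⟩
    rw [contDiffOn_zero]
    refine ContinuousOn.congr (f := fun R => qs (r R / R)) (fun R hR => ?_) fun R hR => hder R hR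
    exact (ContinuousAt.comp (g := qs) (f := fun R => r R / R) (F.continuousAt_slope _ (hv0 R hR))
      (hasDerivAt_div_id hR (hrd R hR)).continuousAt).continuousWithinAt
  · rw [hder R hR]; exact F.slope_pos _ (hv0 R hR)
  · have hvd := hasDerivAt_div_id hR (hrd R hR)
    have hTd : HasDerivAt (fun S => T (r S / S)) _ R :=
      HasDerivAt.comp R (F.hasDerivAt_stress _ (hrv R hR).le) hvd
    have h1 := ((hrd R hR).pow m).mul hTd
    have heq : (fun S => S ^ (m + 1 - 1) * modPhi₁ (m + 1) κ h (deriv r S) (r S / S))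
        =ᶠ[𝓝 R] fun S => r S ^ m * T (r S / S) := by
      filter_upwards [lt_mem_nhds hR] with S hS
      have hS : 0 < S := hS
      rw [modPhi₁_eq_stress (hv0 S hS), hder S hS, ← F.stress_eq _ (hv0 S hS), Nat.add_sub_cancel,
        div_pow]
      field_simp
    refine HasDerivAt.congr_of_eventuallyEq ?_ heq
    refine h1.congr_deriv ?_
    rw [modPhi₂_eq_stress, hder R hR, ← F.stress_eq _ (hv0 R hR)]
    have hv := hv0 R hR
    have hrR : r R = r R / R * R := by field_simp
    set v := r R / R with hvdef
    set q := qs v with hq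
    have h2 := sub_one_mul_stressDecay m κ (q / v)
    have h3 : -stressDecay m κ (q / v) / v * ((q - v) / R)
        = -((q / v - 1) * stressDecay m κ (q / v)) / R := by field_simp
    simp only [Pi.pow_apply]
    rw [h3, h2, hrR, div_pow q v, div_pow q v]
    obtain ⟨k, rfl⟩ : ∃ k, m = k + 1 := ⟨m - 1, by omega⟩
    simp only [Nat.add_sub_cancel, show k + 1 + 1 - 2 = k by omega]
    push_cast
    field_simp
    ring
  · refine (F.tendsto_stress.comp hrtop).congr' (eventually_mem_nhdsWithin.mono fun R hR => ?_)
    have hR : 0 < R := hR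
    simp only [Function.comp]
    rw [modCauchyStress_eq_stress (hv0 R hR), hder R hR, ← F.stress_eq _ (hv0 R hR)]

theorem isCriticalStretch_vc (F : IsCavityField m κ h vc T qs) (hm : 1 ≤ m) (hκ : 0 < κ)
    (hh : IsVolumetricEnergy h) : IsCriticalStretch (m + 1) κ h vc := by
  obtain ⟨r, h0, h1, h2, h3, h4, h5⟩ := F.exists_fieldCurve hm hκ hh
  refine ⟨r, F.isCavitatingSolution_fieldCurve hm h0 h1 h2 h3 h5, ?_, h4⟩
  have h6 := (F.continuousAt_slope vc F.vc_pos).tendsto.comp h4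
  rw [F.slope_vc] at h6
  exact h6.congr' ((eventually_gt_atTop 0).mono fun R hR => (h2 R hR).deriv.symm)

/-- The cavitating solution on the unit ball with boundary displacement `lam > vc` is a rescaling of
the one on `(0, ∞)`. -/
theorem exists_isFieldSolution_cavitating (F : IsCavityField m κ h vc T qs) (hm : 1 ≤ m)
    (hκ : 0 < κ) (hh : IsVolumetricEnergy h) {lam : ℝ} (hlam : vc < lam) :
    ∃ rl, IsFieldSolution vc vc qs lam rl ∧ 0 < rl 0 := by
  obtain ⟨r, h0, h1, h2, h3, h4, h5⟩ := F.exists_fieldCurve hm hκ hh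
  have hvc : ContinuousOn (fun R => r R / R) (Ioi 0) := fun R hR =>
    (hasDerivAt_div_id hR (h2 R hR)).continuousAt.continuousWithinAt
  obtain ⟨R₁, hR₁, hR₁0⟩ := ((h5.eventually_ge_atTop lam).and self_mem_nhdsWithin).exists
  obtain ⟨R₂, hR₂, hR₂0⟩ := ((h4.eventually_le_const hlam).and (eventually_gt_atTop 0)).exists
  obtain ⟨ρ, hρ0, hρ⟩ := isPreconnected_Ioi.intermediate_value (show R₂ ∈ Ioi (0 : ℝ) from hR₂0)
    (show R₁ ∈ Ioi (0 : ℝ) from hR₁0) hvc ⟨hR₂, hR₁⟩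
  have hρ0 : 0 < ρ := hρ0
  have hdiv : ∀ R, r (ρ * R) / ρ / R = r (ρ * R) / (ρ * R) := fun R => div_div _ _ _
  have hd : ∀ R, 0 < R →
      HasDerivAt (fun R => r (ρ * R) / ρ) (qs (r (ρ * R) / ρ / R)) R := fun R hR => by
    have h6 := (HasDerivAt.comp R (h2 (ρ * R) (by positivity))
      ((hasDerivAt_id R).const_mul ρ)).div_const ρ
    refine h6.congr_deriv ?_
    rw [hdiv]
    field_simp
  refine ⟨fun R => r (ρ * R) / ρ, ⟨fun R hR => ?_, ?_, ?_, fun R hR => ?_, fun R hR => ?_⟩, ?_⟩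
  · rcases hR.1.eq_or_lt with rfl | hR0
    · refine ContinuousWithinAt.div_const ?_ ρ
      refine ContinuousWithinAt.comp (g := r) (f := fun R => ρ * R) (t := Ici 0) (by simpa using h1)
        (by fun_prop) fun x hx => mul_nonneg hρ0.le hx.1
    · exact (hd R hR0).continuousAt.continuousWithinAt
  · simp only [mul_zero]; positivity
  · simpa using hρ
  · rw [hdiv]; exact (h3 _ (mul_pos hρ0 hR.1)).le
  · rw [F.fieldSlope_of_le]
    · exact hd R hR.1
    · rw [hdiv]; exact (h3 _ (mul_pos hρ0 hR.1)).le
  · simp only [mul_zero]; positivity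

end IsCavityField

/-! ### Uniqueness of the critical stretch -/

section CavitatingSolution

variable {r : ℝ → ℝ}

theorem hasDerivAt_cavitating (C : IsCavitatingSolution (m + 1) κ h r) {R : ℝ} (hR : 0 < R) :
    HasDerivAt r (deriv r R) R :=
  ((C.contDiffOn.differentiableOn one_ne_zero).differentiableAt (Ioi_mem_nhds hR)).hasDerivAt

theorem continuousOn_deriv_cavitating (C : IsCavitatingSolution (m + 1) κ h r) :
    ContinuousOn (deriv r) (Ioi 0) :=
  C.contDiffOn.continuousOn_deriv_of_isOpen isOpen_Ioi le_rfl

theorem tendsto_cavitating (C : IsCavitatingSolution (m + 1) κ h r) :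
    Tendsto r (𝓝[>] 0) (𝓝 (r 0)) :=
  continuousWithinAt_Ioi_iff_Ici.2 C.continuous_zero

theorem cavitating_pos (C : IsCavitatingSolution (m + 1) κ h r) {R : ℝ} (hR : 0 < R) :
    0 < r R := by
  have h1 : MonotoneOn r (Ioi 0) := by
    refine monotoneOn_of_hasDerivWithinAt_nonneg (convex_Ioi 0)
      (fun R hR => (hasDerivAt_cavitating C hR).continuousAt.continuousWithinAt)
      (fun R hR => (hasDerivAt_cavitating C (interior_subset hR)).hasDerivWithinAt) fun R hR => ?_
    exact (C.deriv_pos R (interior_subset hR)).le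
  refine C.cavity.trans_le (le_of_tendsto (tendsto_cavitating C) ?_)
  filter_upwards [Ioo_mem_nhdsGT hR] with S hS
  exact h1 hS.1 hR hS.2.le

theorem stretch_pos (C : IsCavitatingSolution (m + 1) κ h r) {R : ℝ} (hR : 0 < R) :
    0 < r R / R := div_pos (cavitating_pos C hR) hR

theorem tendsto_stretch_zero (C : IsCavitatingSolution (m + 1) κ h r) :
    Tendsto (fun R => r R / R) (𝓝[>] 0) atTop := by
  simp only [div_eq_mul_inv]
  exact (tendsto_cavitating C).pos_mul_atTop C.cavity tendsto_inv_nhdsGT_zero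

theorem tendsto_stress_zero (C : IsCavitatingSolution (m + 1) κ h r) :
    Tendsto (fun R => stress m κ h (deriv r R) (r R / R)) (𝓝[>] 0) (𝓝 0) :=
  C.stress_free.congr' (eventually_mem_nhdsWithin.mono fun _ hR =>
    modCauchyStress_eq_stress (stretch_pos C hR))

/-- The radial equilibrium equation in terms of the Cauchy stress. -/
theorem hasDerivAt_stress_cavitating (C : IsCavitatingSolution (m + 1) κ h r) (hm : 1 ≤ m) {R : ℝ}
    (hR : 0 < R) :
    HasDerivAt (fun S => stress m κ h (deriv r S) (r S / S))
      (m * κ * (deriv r R / (r R / R) - (deriv r R / (r R / R)) ^ (m + 1)) / R) R := by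
  have hr0 := cavitating_pos C hR
  have h1 := (C.equilibrium R hR).div ((hasDerivAt_cavitating C hR).pow m)
    (pow_ne_zero m hr0.ne')
  have heq : (fun S => stress m κ h (deriv r S) (r S / S)) =ᶠ[𝓝 R]
      fun S => S ^ (m + 1 - 1) * modPhi₁ (m + 1) κ h (deriv r S) (r S / S) / r S ^ m := by
    filter_upwards [lt_mem_nhds hR] with S hS
    have := cavitating_pos C hS
    rw [modPhi₁_eq_stress (stretch_pos C hS), Nat.add_sub_cancel, div_pow]
    field_simp
  refine (h1.congr_of_eventuallyEq heq).congr_deriv ?_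
  rw [modPhi₁_eq_stress (stretch_pos C hR), modPhi₂_eq_stress]
  obtain ⟨k, rfl⟩ : ∃ k, m = k + 1 := ⟨m - 1, by omega⟩
  simp only [Nat.add_sub_cancel, show k + 1 + 1 - 2 = k by omega, Pi.pow_apply]
  set σ := stress (k + 1) κ h (deriv r R) (r R / R)
  simp only [div_pow]
  push_cast
  field_simp
  ring

/-- Near the cavity the hoop stretch exceeds the radial one, as otherwise the stress would blow
up. -/
theorem eventually_deriv_lt_stretch (C : IsCavitatingSolution (m + 1) κ h r) (hκ : 0 < κ)
    (hh : IsVolumetricEnergy h) : ∀ᶠ R in 𝓝[>] 0, deriv r R < r R / R := by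
  have h1 := (hh.deriv_tendsto_top.comp ((tendsto_pow_atTop (Nat.succ_ne_zero m)).comp
    (tendsto_stretch_zero C))).eventually_ge_atTop 0
  filter_upwards [h1, (tendsto_stress_zero C).eventually_lt_const hκ,
    (tendsto_stretch_zero C).eventually_ge_atTop 1, self_mem_nhdsWithin] with R h2 h3 h4 hR
  by_contra! hcon
  have hv := stretch_pos C hR
  have h5 : stress m κ h (r R / R) (r R / R) ≤ stress m κ h (deriv r R) (r R / R) := by
    rcases hcon.eq_or_lt with he | hlt
    · rw [← he]
    · exact (stress_lt_stress hκ hh hv hv hlt).le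
  have h6 : κ ≤ stress m κ h (r R / R) (r R / R) := by
    simp only [Function.comp] at h2
    have h7 := Real.log_nonneg h4
    rw [stress, div_self hv.ne', one_pow, ← pow_succ']
    have : 0 ≤ m * κ * (1 / (m + 1) + Real.log (r R / R)) := by positivity
    linarith
  linarith

end CavitatingSolution

/-- Over the ball of radius `R`, the energy of a cavitating solution, expressed by its virial, minus
the value of the calibration at the same boundary displacement. -/
noncomputable def energyGap (m : ℕ) (κ : ℝ) (h : ℝ → ℝ) (l vc : ℝ) (qs r : ℝ → ℝ) (R : ℝ) : ℝ :=
  R ^ (m + 1) * (virial m κ h (deriv r R) (r R / R) / (m + 1))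
    - R ^ (m + 1) * potential m κ h l vc qs (r R / R)

namespace IsCavityField

variable {vc l : ℝ} {T qs r : ℝ → ℝ}

theorem hasDerivAt_energyGap (F : IsCavityField m κ h vc T qs) (hm : 1 ≤ m) (hκ : 0 < κ)
    (hh : IsVolumetricEnergy h) (hl0 : 0 < l) (hl : l ≤ vc)
    (C : IsCavitatingSolution (m + 1) κ h r) {R : ℝ} (hR : 0 < R) :
    HasDerivAt (energyGap m κ h l vc qs r) (excessDensity m κ h l vc qs r R) R := by
  have hv := stretch_pos C hR
  have hd := hasDerivAt_cavitating C hR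
  have h1 := F.hasDerivAt_pow_mul_potential hm hκ hh hl0 hl hR (cavitating_pos C hR) hd
  have h2 := hasDerivAt_virial hm hκ hh (q := deriv r) (v := fun R => r R / R)
    ((continuousOn_deriv_cavitating C).continuousAt (Ioi_mem_nhds hR)) (C.deriv_pos R hR) hv
    (hasDerivAt_div_id hR hd) (hasDerivAt_stress_cavitating C hm hR)
    (Eventually.of_forall fun _ => rfl)
  have h3 := ((hasDerivAt_pow (m + 1) R).mul (h2.div_const ((m : ℝ) + 1))).sub h1
  refine h3.congr_deriv ?_
  rw [excessDensity, virial]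
  set v := r R / R with hvdef
  set q := deriv r R
  have hm0 : ((m : ℝ) + 1) ≠ 0 := by positivity
  simp only [Nat.add_sub_cancel]
  push_cast
  field_simp
  ring

/-- Both energies are `o(1)` because the hoop stretch tends to infinity while `r` is bounded. -/
theorem tendsto_energyGap (F : IsCavityField m κ h vc T qs) (hm : 1 ≤ m) (hκ : 0 < κ)
    (hh : IsVolumetricEnergy h) (C : IsCavitatingSolution (m + 1) κ h r) :
    Tendsto (energyGap m κ h l vc qs r) (𝓝[>] 0) (𝓝 0) := by
  have hv := tendsto_stretch_zero C
  have h1 := tendsto_virial_div_pow hm hκ hh (q := deriv r) (v := fun R => r R / R)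
    (eventually_mem_nhdsWithin.mono fun R hR => C.deriv_pos R hR) hv (tendsto_stress_zero C)
  have h2 := (F.tendsto_potential_div_pow (l := l) hm hκ hh).comp hv
  have h3 := ((tendsto_cavitating C).pow (m + 1)).mul ((h1.div_const ((m : ℝ) + 1)).sub h2)
  rw [zero_div, sub_zero, mul_zero] at h3
  refine h3.congr' (eventually_mem_nhdsWithin.mono fun R hR => ?_)
  have hR : 0 < R := hR
  have := cavitating_pos C hR
  simp only [energyGap, Function.comp, div_pow]
  field_simp

theorem energyGap_nonneg (F : IsCavityField m κ h vc T qs) (hm : 1 ≤ m) (hκ : 0 < κ)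
    (hh : IsVolumetricEnergy h) (hl0 : 0 < l) (hl : l ≤ vc)
    (C : IsCavitatingSolution (m + 1) κ h r) {R : ℝ} (hR : 0 < R) :
    0 ≤ energyGap m κ h l vc qs r R := by
  have hd := fun R (hR : 0 < R) => F.hasDerivAt_energyGap hm hκ hh hl0 hl C hR
  have h1 : MonotoneOn (energyGap m κ h l vc qs r) (Ioi 0) := by
    refine monotoneOn_of_hasDerivWithinAt_nonneg (convex_Ioi 0)
      (fun R hR => (hd R hR).continuousAt.continuousWithinAt)
      (fun R hR => (hd R (interior_subset hR)).hasDerivWithinAt) fun R hR => ?_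
    have hR : 0 < R := interior_subset hR
    exact F.excessDensity_nonneg hκ hh hR (cavitating_pos C hR) (C.deriv_pos R hR)
  refine le_of_tendsto (F.tendsto_energyGap (l := l) hm hκ hh C) ?_
  filter_upwards [Ioo_mem_nhdsGT hR] with S hS
  exact h1 hS.1 hR hS.2.le

/-- On the branch `v ≤ vc` of homogeneous states the calibration is the homogeneous energy, which
exceeds the energy of a cavitating solution with `q < v`. -/
theorem vc_lt_stretch (F : IsCavityField m κ h vc T qs) (hm : 1 ≤ m) (hκ : 0 < κ)
    (hh : IsVolumetricEnergy h) (C : IsCavitatingSolution (m + 1) κ h r) {R : ℝ} (hR : 0 < R)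
    (hlt : deriv r R < r R / R) : vc < r R / R := by
  by_contra! hle
  have hv := stretch_pos C hR
  have h1 := F.energyGap_nonneg hm hκ hh hv hle C hR
  have h2 := F.energy_eq_potential hv hle hv (r R / R)
  have hs : fieldSlope vc qs (r R / R) = r R / R := if_pos hle
  rw [fieldVol_of_le hv le_rfl, hs, excess, powBregman_self, volBregman_self,
    ← virial_eq_energy_self] at h2
  have h3 := virial_lt_virial (m := m) hκ hh hv (C.deriv_pos R hR) hlt le_rfl
  rw [energyGap, ← mul_sub] at h1
  have h4 := nonneg_of_mul_nonneg_right h1 (by positivity : 0 < R ^ (m + 1))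
  rw [sub_nonneg, le_div_iff₀ (by positivity)] at h4
  linarith

theorem potential_of_le (F : IsCavityField m κ h vc T qs) (hl0 : 0 < l) (hl : l ≤ vc) {v : ℝ}
    (hv : vc ≤ v) : potential m κ h l vc qs v = virial m κ h (qs v) v / (m + 1) := by
  have hv0 := F.vc_pos.trans_le hv
  have h1 := F.energy_eq_potential hl0 hl hv0 (qs v)
  rw [fieldVol_of_le hl0 (hl.trans hv), F.fieldStress_of_le hl0 (hl.trans hv),
    F.fieldSlope_of_le hv, excess, powBregman_self, volBregman_self] at h1
  rw [eq_div_iff (by positivity), virial]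
  linarith

theorem energyGap_eq (F : IsCavityField m κ h vc T qs) {R : ℝ} (hv : vc ≤ r R / R) :
    energyGap m κ h vc vc qs r R = R ^ (m + 1) / (m + 1)
      * (virial m κ h (deriv r R) (r R / R) - virial m κ h (qs (r R / R)) (r R / R)) := by
  rw [energyGap, F.potential_of_le F.vc_pos le_rfl hv]
  ring

theorem slope_le_deriv (F : IsCavityField m κ h vc T qs) (hm : 1 ≤ m) (hκ : 0 < κ)
    (hh : IsVolumetricEnergy h) (C : IsCavitatingSolution (m + 1) κ h r) {R : ℝ} (hR : 0 < R)
    (hlt : deriv r R < r R / R) : qs (r R / R) ≤ deriv r R := by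
  have hv := F.vc_lt_stretch hm hκ hh C hR hlt
  have h1 := F.energyGap_nonneg hm hκ hh F.vc_pos le_rfl C hR
  rw [F.energyGap_eq hv.le] at h1
  have h2 := nonneg_of_mul_nonneg_right h1 (by positivity)
  by_contra! hcon
  have := virial_lt_virial (m := m) hκ hh (stretch_pos C hR) (C.deriv_pos R hR) hcon
    (F.slope_le hv.le)
  linarith

/-- As long as `r' < r / R`, a cavitating solution belongs to the field: the energy gap is
nonnegative, while its quotient by `r ^ n` decreases from the value `0` at the cavity. -/
theorem deriv_eq_slope (F : IsCavityField m κ h vc T qs) (hm : 1 ≤ m) (hκ : 0 < κ)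
    (hh : IsVolumetricEnergy h) (C : IsCavitatingSolution (m + 1) κ h r) {B : ℝ}
    (hB : ∀ R ∈ Ioo 0 B, deriv r R < r R / R) {R : ℝ} (hR : R ∈ Ioo 0 B) :
    deriv r R = qs (r R / R) := by
  have hd : ∀ R ∈ Ioo 0 B, HasDerivAt (fun R => energyGap m κ h vc vc qs r R / r R ^ (m + 1))
      ((excessDensity m κ h vc vc qs r R * r R ^ (m + 1) - energyGap m κ h vc vc qs r R
        * ((m + 1 : ℕ) * r R ^ m * deriv r R)) / (r R ^ (m + 1)) ^ 2) R := fun R hR =>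
    (F.hasDerivAt_energyGap hm hκ hh F.vc_pos le_rfl C hR.1).div
      ((hasDerivAt_cavitating C hR.1).pow (m + 1)) (pow_ne_zero _ (cavitating_pos C hR.1).ne')
  have hanti : AntitoneOn (fun R => energyGap m κ h vc vc qs r R / r R ^ (m + 1)) (Ioo 0 B) := by
    refine antitoneOn_of_hasDerivWithinAt_nonpos (convex_Ioo 0 B)
      (fun R hR => (hd R hR).continuousAt.continuousWithinAt)
      (fun R hR => (hd R (interior_subset hR)).hasDerivWithinAt) fun R hR => ?_
    replace hR : R ∈ Ioo 0 B := interior_subset hR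
    have hR0 : 0 < R := hR.1
    have hlt := hB R hR
    have hv := stretch_pos C hR0
    have hvc := F.vc_lt_stretch hm hκ hh C hR0 hlt
    have hq := C.deriv_pos R hR0
    have hp := F.slope_pos _ hv
    have hpq := F.slope_le_deriv hm hκ hh C hR0 hlt
    refine div_nonpos_of_nonpos_of_nonneg ?_ (by positivity)
    have h1 := excess_le (m := m) hκ hh hv hp hpq
    have h2 := energy_eq_add_excess (m := m) (κ := κ) (h := h) hv (deriv r R) (qs (r R / R))
    rw [F.energyGap_eq hvc.le, excessDensity, fieldVol_of_le F.vc_pos hvc.le,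
      F.fieldSlope_of_le hvc.le]
    have hrR : r R = r R / R * R := by field_simp
    rw [virial, virial, h2, hrR, mul_div_cancel_right₀ _ hR0.ne']
    set v := r R / R
    set q := deriv r R
    set p := qs v
    set E := excess m κ h v q p (p * v ^ m)
    have h3 : (v - q) * (E - q * (v ^ m * stress m κ h q v - v ^ m * stress m κ h p v)) ≤ 0 :=
      mul_nonpos_of_nonneg_of_nonpos (by linarith) (by linarith)
    have h4 : 0 ≤ R ^ m * (v * R) ^ m * R := by positivity
    have h5 := mul_nonpos_of_nonneg_of_nonpos h4 h3
    have hm0 : ((m : ℝ) + 1) ≠ 0 := by positivity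
    refine le_trans (le_of_eq ?_) h5
    push_cast
    field_simp
    ring
  have hlim : Tendsto (fun R => energyGap m κ h vc vc qs r R / r R ^ (m + 1)) (𝓝[>] 0) (𝓝 0) := by
    have := (F.tendsto_energyGap (l := vc) hm hκ hh C).div ((tendsto_cavitating C).pow (m + 1))
      (pow_ne_zero _ C.cavity.ne')
    rwa [zero_div] at this
  have h1 : energyGap m κ h vc vc qs r R / r R ^ (m + 1) ≤ 0 := by
    refine ge_of_tendsto hlim ?_
    filter_upwards [Ioo_mem_nhdsGT hR.1] with S hS
    exact hanti ⟨hS.1, hS.2.trans hR.2⟩ hR hS.2.le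
  have hlt := hB R hR
  have hR0 : 0 < R := hR.1
  have hvc := F.vc_lt_stretch hm hκ hh C hR0 hlt
  have hpow := pow_pos (cavitating_pos C hR0) (m + 1)
  rw [div_le_iff₀ hpow, zero_mul, F.energyGap_eq hvc.le] at h1
  have h2 := nonpos_of_mul_nonpos_right h1 (by positivity)
  refine le_antisymm ?_ (F.slope_le_deriv hm hκ hh C hR0 hlt)
  by_contra! hcon
  have := virial_lt_virial (m := m) hκ hh (stretch_pos C hR0) (F.slope_pos _ (stretch_pos C hR0))
    hcon hlt.le
  linarith

/-- A solution of the slope field does not reach the homogeneous state `vc` at a finite radius. -/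
theorem vc_lt_stretch_of_deriv_eq (F : IsCavityField m κ h vc T qs) (hm : 1 ≤ m) (hκ : 0 < κ)
    (hh : IsVolumetricEnergy h) {a b : ℝ} (ha : 0 < a) (hab : a < b)
    (hd : ∀ R ∈ Icc a b, HasDerivAt r (qs (r R / R)) R) (hv : ∀ R ∈ Ico a b, vc < r R / R) :
    vc < r b / b := by
  have hvd : ∀ R ∈ Icc a b, HasDerivAt (fun R => r R / R) _ R := fun R hR =>
    hasDerivAt_div_id (ha.trans_le hR.1) (hd R hR)
  have hvc : ContinuousOn (fun R => r R / R) (Icc a b) := fun R hR =>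
    (hvd R hR).continuousAt.continuousWithinAt
  obtain ⟨V, hV⟩ := isCompact_Icc.exists_bound_of_continuousOn hvc
  obtain ⟨L, hL0, hL⟩ := F.exists_lipschitz_slope_Icc hm hκ hh (max V vc)
  set K := (1 + L) / a with hK
  have hud : ∀ R ∈ Icc a b, HasDerivAt (fun R => (r R / R - vc) * Real.exp (K * R))
      ((qs (r R / R) - r R / R) / R * Real.exp (K * R)
        + (r R / R - vc) * (Real.exp (K * R) * (K * 1))) R := fun R hR =>
    ((hvd R hR).sub_const vc).mul ((hasDerivAt_id R).const_mul K).exp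
  have hmono : MonotoneOn (fun R => (r R / R - vc) * Real.exp (K * R)) (Icc a b) := by
    refine monotoneOn_of_hasDerivWithinAt_nonneg (convex_Icc a b)
      (fun R hR => (hud R hR).continuousAt.continuousWithinAt)
      (fun R hR => (hud R (interior_subset hR)).hasDerivWithinAt) fun R hR => ?_
    rw [interior_Icc] at hR
    have hR0 : 0 < R := ha.trans hR.1
    have h1 := hv R ⟨hR.1.le, hR.2⟩
    have h2 := (le_abs_self _).trans (hV R (Ioo_subset_Icc_self hR))
    have h3 := hL (r R / R) ⟨h1.le, h2.trans (le_max_left _ _)⟩ vc ⟨le_rfl, le_max_right _ _⟩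
    rw [F.slope_vc, abs_of_pos (sub_pos.2 h1)] at h3
    have h4 := (abs_le.1 h3).1
    have h5 : (r R / R - qs (r R / R)) / R ≤ (r R / R - vc) * K := by
      rw [hK, ← mul_div_assoc]
      have : 0 ≤ r R / R - vc := by linarith
      apply div_le_div₀ (by positivity) (by nlinarith) ha hR.1.le
    have h6 : (qs (r R / R) - r R / R) / R = -((r R / R - qs (r R / R)) / R) := by ring
    rw [h6]
    have h7 := Real.exp_pos (K * R)
    nlinarith
  have h1 := hmono (left_mem_Icc.2 hab.le) (right_mem_Icc.2 hab.le) hab.le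
  have h2 := mul_pos (sub_pos.2 (hv a ⟨le_rfl, hab⟩)) (Real.exp_pos (K * a))
  have h3 := (mul_pos_iff_of_pos_right (Real.exp_pos (K * b))).1 (h2.trans_le h1)
  linarith

/-- A cavitating solution never becomes homogeneous.  Up to the first radius `B` with `r' = r / R`
it belongs to the field, so that `r / R = vc` at `B`, which the uniqueness of the rest point `vc`
excludes. -/
theorem deriv_lt_stretch (F : IsCavityField m κ h vc T qs) (hm : 1 ≤ m) (hκ : 0 < κ)
    (hh : IsVolumetricEnergy h) (C : IsCavitatingSolution (m + 1) κ h r) {R : ℝ} (hR : 0 < R) :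
    deriv r R < r R / R := by
  by_contra! hcon
  obtain ⟨b, hb, hb'⟩ := mem_nhdsGT_iff_exists_Ioo_subset.1 (eventually_deriv_lt_stretch C hκ hh)
  have hb : 0 < b := hb
  set a := b / 2 with ha
  have ha0 : 0 < a := by positivity
  have hvc : ContinuousOn (fun R => r R / R) (Ioi 0) := fun R hR =>
    (hasDerivAt_div_id hR (hasDerivAt_cavitating C hR)).continuousAt.continuousWithinAt
  have hdc := continuousOn_deriv_cavitating C
  have haR : a ≤ R := by
    by_contra! hlt
    exact not_lt.2 hcon (hb' ⟨hR, by linarith⟩)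
  -- the first radius at which the two stretches agree
  set s : Set ℝ := {S ∈ Icc a R | r S / S ≤ deriv r S} with hs
  have hsub : Icc a R ⊆ Ioi 0 := fun S hS => ha0.trans_le hS.1
  have hsc : IsCompact s :=
    isCompact_Icc.of_isClosed_subset
      (isClosed_Icc.isClosed_le (hvc.mono hsub) (hdc.mono hsub)) fun S hS => hS.1
  obtain ⟨B, hBs, hBmin⟩ := hsc.exists_isLeast ⟨R, ⟨haR, le_rfl⟩, hcon⟩
  have hB0 : 0 < B := ha0.trans_le hBs.1.1
  have hbef : ∀ S ∈ Ioo 0 B, deriv r S < r S / S := by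
    intro S hS
    rcases lt_or_ge S b with hSb | hSb
    · exact hb' ⟨hS.1, hSb⟩
    · by_contra! hle
      exact not_le.2 hS.2 (hBmin ⟨⟨by linarith, hS.2.le.trans hBs.1.2⟩, hle⟩)
  have haB : a < B := by
    rcases hBs.1.1.eq_or_lt with he | hlt
    · exact absurd hBs.2 (not_le.2 (he ▸ hb' ⟨ha0, by linarith⟩))
    · exact hlt
  have heq : ∀ S ∈ Ioo 0 B, deriv r S = qs (r S / S) := fun S hS =>
    F.deriv_eq_slope hm hκ hh C hbef hS
  have heqB : deriv r B = qs (r B / B) := by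
    have h1 : Tendsto (deriv r) (𝓝[<] B) (𝓝 (deriv r B)) :=
      (hdc.continuousAt (Ioi_mem_nhds hB0)).tendsto.mono_left nhdsWithin_le_nhds
    have h2 : Tendsto (fun S => qs (r S / S)) (𝓝[<] B) (𝓝 (qs (r B / B))) :=
      (ContinuousAt.comp (g := qs) (f := fun S => r S / S)
        (F.continuousAt_slope _ (stretch_pos C hB0))
        (hvc.continuousAt (Ioi_mem_nhds hB0))).tendsto.mono_left nhdsWithin_le_nhds
    refine tendsto_nhds_unique h1 (h2.congr' ?_)
    filter_upwards [Ioo_mem_nhdsLT hB0] with S hS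
    exact (heq S hS).symm
  have h3 := F.vc_lt_stretch_of_deriv_eq hm hκ hh (r := r) ha0 haB (fun S hS => ?_)
    (fun S hS => F.vc_lt_stretch hm hκ hh C (ha0.trans_le hS.1) (hbef S ⟨ha0.trans_le hS.1, hS.2⟩))
  · have h4 := F.slope_lt _ h3
    rw [← heqB] at h4
    exact not_le.2 h4 hBs.2
  · have hS0 : 0 < S := ha0.trans_le hS.1
    have := hasDerivAt_cavitating C hS0
    rcases hS.2.eq_or_lt with he | hlt
    · rw [he] at this ⊢
      rwa [heqB] at this
    · rwa [heq S ⟨hS0, hlt⟩] at this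

/-- The limit of the hoop stretch is a fixed point of the slope, and `vc` is the only one in
`[vc, ∞)`. -/
theorem eq_of_isCriticalStretch (F : IsCavityField m κ h vc T qs) (hm : 1 ≤ m) (hκ : 0 < κ)
    (hh : IsVolumetricEnergy h) {lamc : ℝ} (hc : IsCriticalStretch (m + 1) κ h lamc) :
    lamc = vc := by
  obtain ⟨r, C, h1, h2⟩ := hc
  have hlt := fun R (hR : 0 < R) => F.deriv_lt_stretch hm hκ hh C hR
  have hle : vc ≤ lamc := ge_of_tendsto h2 ((eventually_gt_atTop 0).mono fun R hR =>
    (F.vc_lt_stretch hm hκ hh C hR (hlt R hR)).le)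
  have h3 := (F.continuousAt_slope lamc (F.vc_pos.trans_le hle)).tendsto.comp h2
  have h4 : qs lamc = lamc := by
    refine tendsto_nhds_unique h3 (h1.congr' ((eventually_gt_atTop 0).mono fun R hR => ?_))
    exact F.deriv_eq_slope hm hκ hh C (B := R + 1) (fun S hS => hlt S hS.1) ⟨hR, by linarith⟩
  rcases hle.eq_or_lt with he | hlt'
  · exact he.symm
  · exact absurd h4 (F.slope_lt _ hlt').ne

end IsCavityField

end Cavitation

theorem mainTheorem9 (n : ℕ) (hn : 2 ≤ n) (κ : ℝ) (hκ : 0 < κ)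
    (h : ℝ → ℝ) (hh : IsVolumetricEnergy h) :
    (∃! lamc : ℝ, IsCriticalStretch n κ h lamc) ∧
    ∀ lamc : ℝ, IsCriticalStretch n κ h lamc →
      ∀ lam : ℝ, 0 < lam →
        ∀ r : ℝ → ℝ → ℝ, (∀ ε ∈ Ioo (0 : ℝ) 1, IsGlobalMinimizer n κ h lam ε (r ε)) →
          (lam ≤ lamc → PuncturedUniformLimit r (fun R => lam * R)) ∧
          (lamc < lam →
            ∃ rlam : ℝ → ℝ, IsGlobalMinimizer n κ h lam 0 rlam ∧ 0 < rlam 0 ∧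
              (∀ s : ℝ → ℝ, IsGlobalMinimizer n κ h lam 0 s → EqOn s rlam (Icc 0 1)) ∧
              PuncturedUniformLimit r rlam) := by
  obtain ⟨m, rfl⟩ : ∃ m, n = m + 1 := ⟨n - 1, by omega⟩
  have hm : 1 ≤ m := by omega
  obtain ⟨vc, T, qs, F⟩ := Cavitation.exists_isCavityField (m := m) hκ hh
  have huniq := fun lamc (hc : IsCriticalStretch (m + 1) κ h lamc) =>
    F.eq_of_isCriticalStretch hm hκ hh hc
  refine ⟨⟨vc, F.isCriticalStretch_vc hm hκ hh, huniq⟩, fun lamc hc lam hlam r hr => ?_⟩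
  obtain rfl := huniq lamc hc
  refine ⟨fun hle => ?_, fun hlt => ?_⟩
  · exact F.puncturedUniformLimit hm hκ hh hlam hle
      (Cavitation.IsCavityField.isFieldSolution_homogeneous hle) hr
  · obtain ⟨rlam, S, hpos⟩ := F.exists_isFieldSolution_cavitating hm hκ hh hlt
    exact ⟨rlam, F.isGlobalMinimizer_fieldSolution hm hκ hh F.vc_pos le_rfl S, hpos,
      fun s hs => F.eqOn_of_isGlobalMinimizer hm hκ hh F.vc_pos le_rfl S hs,
      F.puncturedUniformLimit hm hκ hh F.vc_pos le_rfl S hr⟩
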